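/- Let $\mathbb{F}$ be a perfect field and let $\mathsf{M}:\mathbb{N}\to\mathbb{N}$ be such that two polynomials of degree less than $N$ in $\mathbb{F}[x]$ can be multiplied in $\mathsf{M}(N)$ operations $(+,-,\times,\div)$ in $\mathbb{F}$, and such that $\mathsf{M}$ is super-linear: $\mathsf{M}(N)\ge N$ and $\mathsf{M}(N+N')\ge \mathsf{M}(N)+\mathsf{M}(N')$ for positive $N,N'$. Let $\mathfrak{m}\subset\mathbb{F}[x_1,x_2]$ be a maximal ideal, $\mathbb{K}:=\mathbb{F}[y_1,y_2]/\tilde{\mathfrak{m}}$, where $\tilde{\mathfrak{m}}$ is $\mathfrak{m}$ with its variables renamed $y_1,y_2$, and let $\alpha=(\alpha_1,\alpha_2)\in\mathbb{K}^2$ be the residue classes of $y_1,y_2$. Let $J\subset\mathbb{K}[\xi_1,\xi_2]$ be a primary ideal at $\alpha$, that is, primary with radical $\langle \xi_1-\alpha_1,\xi_2-\alpha_2\rangle$; let $I\subset\mathbb{F}[x_1,x_2]$ be its preimage under $x_i\mapsto \xi_i$, and let $J'$ be the image of $J$ under the translation $\xi_i\mapsto\xi_i+\alpha_i$. Let $d,\mu,n$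 be the degrees of $\mathfrak{m},J',I$, that is, $d=\dim_{\mathbb{F}}\mathbb{F}[x_1,x_2]/\mathfrak{m}$, $\mu=\dim_{\mathbb{K}}\mathbb{K}[\xi_1,\xi_2]/J'$, $n=\dim_{\mathbb{F}}\mathbb{F}[x_1,x_2]/I$. Untangling is the morphism of $\mathbb{F}$-algebras $$\pi_{\mathfrak{m},J'}:\ \mathbb{F}[x_1,x_2]/I\to\mathbb{K}[\xi_1,\xi_2]/J',\qquad x_i\mapsto\xi_i+\alpha_i .$$ Use the lexicographic orders with $x_1<x_2$ and $\xi_1<\xi_2$, and represent residue classes modulo $\mathfrak{m}$, $I$, $J'$ on the bases of monomials that are divisible by no leading monomial of $\mathfrak{m}$, $I$, $J'$ respectively. Let $(T_1,T_2)$ be the reduced Gröbner basis of $\mathfrak{m}$, with $T_1<T_2$. Assume that * ($\mathbf{H}_2$) $\mathbb{F}$ has characteristic $0$ or at least $n$; * ($\mathbf{H}_3$) $J'$ is a monomial ideal. Then, given the coefficients of $T_1$, $T_2$ and of $F\in\mathbb{F}[x_1,x_2]/I$, one can compute the coefficients of $\pi_{\mathfrak{m},J'}(F)$ in either $$O(\mathsf{M}(dn))\qquad\text{or}\qquad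 O(\mathsf{M}(\mu n)\log\mu)$$ operations $(+,-,\times,\div)$ in $\mathbb{F}$, and in particular in $O(\mathsf{M}(\lfloor n^{1.5}\rfloor)\log n)$ operations. More precisely, there are straight-line programs of these lengths, without division by zero on any such input, that depend only on $\mathbb{F}$, $\mathsf{M}$ and the three monomial bases, and the constants in the $O(\cdot)$ are absolute. -/

import Mathlib

open MvPolynomial

/-! ### Straight-line programs over a field -/

/-- The four arithmetic operations. -/
inductive ArithOp
  | add
  | sub
  | mul
  | div

open Classical in
/-- The value of an arithmetic operation; a division by zero has no value. -/
noncomputable def ArithOp.eval {F : Type*} [Field F] : ArithOp → F → F → Option F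
  | .add, a, b => some (a + b)
  | .sub, a, b => some (a - b)
  | .mul, a, b => some (a * b)
  | .div, a, b => if b = 0 then none else some (a / b)

/-- An operand is an input, a constant of the field, or the result of the `k`-th operation
performed so far. -/
inductive Operand (F ι : Type*)
  | input (i : ι)
  | const (c : F)
  | result (k : ℕ)

/-- The value of an operand, for the input `x` and the list `r` of the results so far
(a reference beyond the end of `r` stands for the constant `0`). -/
def Operand.val {F ι : Type*} [Field F] (x : ι → F) (r : List F) : Operand F ι → F
  | .input i => x i
  | .const c => c
  | .result k => r.getD k 0

/-- An instruction performs one operation on two operands. -/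
structure Instruction (F ι : Type*) where
  op : ArithOp
  left : Operand F ι
  right : Operand F ι

/-- Execute a list of instructions on the input `x`, starting from the list `r` of earlier
results; there is no value if a division by zero is attempted. -/
noncomputable def runInstructions {F ι : Type*} [Field F] (x : ι → F) :
    List (Instruction F ι) → List F → Option (List F)
  | [], r => some r
  | s :: l, r =>
      (s.op.eval (s.left.val x r) (s.right.val x r)).bind
        fun v => runInstructions x l (r ++ [v])

/-- A straight-line program over `F`, with inputs indexed by `ι` and outputs indexed by `o`. -/
structure StraightLineProgram (F ι o : Type*) where
  code : List (Instruction F ι)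
  out : o → Operand F ι

/-- The number of operations `+, -, ×, ÷` in `F` that the program performs. -/
def StraightLineProgram.cost {F ι o : Type*} (P : StraightLineProgram F ι o) : ℕ :=
  P.code.length

/-- On the input `x` the program runs without a division by zero and its output is `y`. -/
def StraightLineProgram.Computes {F ι o : Type*} [Field F] (P : StraightLineProgram F ι o)
    (x : ι → F) (y : o → F) : Prop :=
  ∃ r, runInstructions x P.code [] = some r ∧ ∀ j, (P.out j).val x r = y j

/-- `M` is a multiplication time for `F[x]`: the product of two polynomials of degree less than
`n` is computed, on their coefficients, in at most `M n` operations in `F`; and `M` is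
super-linear. -/
structure IsMultiplicationTime (F : Type*) [Field F] (M : ℕ → ℕ) : Prop where
  exists_program : ∀ n : ℕ, ∃ P : StraightLineProgram F (Fin 2 × ℕ) ℕ, P.cost ≤ M n ∧
    ∀ a b : Polynomial F, a.degree < n → b.degree < n →
      P.Computes (fun i => (![a, b] i.1).coeff i.2) (fun k => (a * b).coeff k)
  self_le : ∀ n : ℕ, n ≤ M n
  superadditive : ∀ m n : ℕ, 0 < m → 0 < n → M m + M n ≤ M (m + n)

/-! ### Lexicographic order, Gröbner bases and normal forms in two variables -/

/-- The lexicographic order on the monomials in `X 0`, `X 1` for which `X 0 < X 1`. -/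
noncomputable def lexOrder : MonomialOrder (Fin 2) where
  syn := (MonomialOrder.lex (σ := Fin 2)).syn
  toSyn := (Finsupp.domCongr (Equiv.swap (0 : Fin 2) 1)).trans
    (MonomialOrder.lex (σ := Fin 2)).toSyn
  toSyn_monotone := fun a b h => by
    refine (MonomialOrder.lex (σ := Fin 2)).toSyn_monotone (fun i => ?_)
    exact h ((Equiv.swap (0 : Fin 2) 1).symm i)

/-- The family `g` is the minimal reduced Gröbner basis of the ideal `I`, listed by increasing
leading monomials. -/
structure IsReducedGroebnerBasis {k : Type*} [Field k] {t : ℕ}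
    (I : Ideal (MvPolynomial (Fin 2) k)) (g : Fin t → MvPolynomial (Fin 2) k) : Prop where
  mem : ∀ i, g i ∈ I
  monic : ∀ i, lexOrder.Monic (g i)
  exists_le : ∀ p ∈ I, p ≠ 0 → ∃ i, lexOrder.degree (g i) ≤ lexOrder.degree p
  reduced : ∀ i j, i ≠ j → ∀ e ∈ (g i).support, ¬ lexOrder.degree (g j) ≤ e
  increasing : StrictMono fun i => lexOrder.toSyn (lexOrder.degree (g i))

/-- The exponents of the monomials that no leading monomial of a nonzero element of `I` divides:
the monomial basis of the quotient by `I`. -/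
def standardMonomials {k : Type*} [CommRing k] (I : Ideal (MvPolynomial (Fin 2) k)) :
    Set (Fin 2 →₀ ℕ) :=
  {e | ∀ p ∈ I, p ≠ 0 → ¬ lexOrder.degree p ≤ e}

/-- `p` is a linear combination of the standard monomials of `I`, and it represents the residue
class `z` modulo `I`. -/
def IsNormalForm {k : Type*} [CommRing k] (I : Ideal (MvPolynomial (Fin 2) k))
    (p : MvPolynomial (Fin 2) k) (z : MvPolynomial (Fin 2) k ⧸ I) : Prop :=
  (p.support : Set (Fin 2 →₀ ℕ)) ⊆ standardMonomials I ∧ Ideal.Quotient.mk I p = z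

/-- A monomial ideal: an ideal generated by monomials. -/
def IsMonomialIdeal {k : Type*} [CommRing k] (I : Ideal (MvPolynomial (Fin 2) k)) : Prop :=
  ∃ S : Set (Fin 2 →₀ ℕ), I = Ideal.span ((fun e => monomial e (1 : k)) '' S)

/-! ### The untangling map -/

section Untangling

variable {F : Type*} [Field F] (m : Ideal (MvPolynomial (Fin 2) F))

/-- The residue ring `𝕂 = F[y₁, y₂] / m`. -/
def ResidueRing : Type _ := MvPolynomial (Fin 2) F ⧸ m

noncomputable instance : CommRing (ResidueRing m) :=
  inferInstanceAs (CommRing (MvPolynomial (Fin 2) F ⧸ m))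

noncomputable instance : Algebra F (ResidueRing m) :=
  inferInstanceAs (Algebra F (MvPolynomial (Fin 2) F ⧸ m))

/-- The coordinates `α = (α₁, α₂)`: the residue classes of the variables in `𝕂`. -/
noncomputable def alpha (i : Fin 2) : ResidueRing m := Ideal.Quotient.mk m (X i)

variable {m}

/-- `J` is a primary ideal at the point `α`: its radical is `⟨ξ₁ - α₁, ξ₂ - α₂⟩`. -/
def IsPrimaryAtAlpha (J : Ideal (MvPolynomial (Fin 2) (ResidueRing m))) : Prop :=
  J.IsPrimary ∧ J.radical = Ideal.span (Set.range fun i => X i - C (alpha m i))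

/-- The ideal `I` of `F[x₁, x₂]`: the preimage of `J` under `F[x₁, x₂] → 𝕂[ξ₁, ξ₂]`,
`xᵢ ↦ ξᵢ`. -/
noncomputable def contraction (J : Ideal (MvPolynomial (Fin 2) (ResidueRing m))) :
    Ideal (MvPolynomial (Fin 2) F) :=
  J.comap (MvPolynomial.map (algebraMap F (ResidueRing m)))

variable (m) in
/-- The translation `ξᵢ ↦ ξᵢ + αᵢ` of `𝕂[ξ₁, ξ₂]`. -/
noncomputable def translation :
    MvPolynomial (Fin 2) (ResidueRing m) →ₐ[ResidueRing m] MvPolynomial (Fin 2) (ResidueRing m) :=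
  aeval fun i => X i + C (alpha m i)

/-- The ideal `J'`: the image of `J` under the translation. -/
noncomputable def translatedIdeal (J : Ideal (MvPolynomial (Fin 2) (ResidueRing m))) :
    Ideal (MvPolynomial (Fin 2) (ResidueRing m)) :=
  J.map (translation m)

variable (m) in
/-- The `F`-algebra morphism `F[x₁, x₂] → 𝕂[ξ₁, ξ₂]`, `xᵢ ↦ ξᵢ + αᵢ`. -/
noncomputable def shiftHom :
    MvPolynomial (Fin 2) F →ₐ[F] MvPolynomial (Fin 2) (ResidueRing m) :=
  aeval fun i => X i + C (alpha m i)

theorem contraction_le_comap (J : Ideal (MvPolynomial (Fin 2) (ResidueRing m))) :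
    contraction J ≤ (translatedIdeal J).comap (shiftHom m) := by
  intro p hp
  have h : shiftHom m p = translation m (MvPolynomial.map (algebraMap F (ResidueRing m)) p) := by
    simp only [shiftHom, translation, aeval_map_algebraMap]
  rw [Ideal.mem_comap, h]
  exact Ideal.mem_map_of_mem _ hp

/-- Untangling: the `F`-algebra morphism `F[x₁, x₂] / I → 𝕂[ξ₁, ξ₂] / J'`, `xᵢ ↦ ξᵢ + αᵢ`. -/
noncomputable def untangling (J : Ideal (MvPolynomial (Fin 2) (ResidueRing m))) :
    (MvPolynomial (Fin 2) F ⧸ contraction J) →ₐ[F]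
      (MvPolynomial (Fin 2) (ResidueRing m) ⧸ translatedIdeal J) :=
  Ideal.quotientMapₐ (translatedIdeal J) (shiftHom m) (contraction_le_comap J)

/-- The program `P` computes the untangling map. Its inputs are the coefficients of `T 0` and
`T 1` (the Gröbner basis of `m`) and of an element `f` of the span of the standard monomials of
`I`. Its outputs are the coefficients of the normal form `G` of the image of `f`, each
coefficient `G.coeff e`, in `𝕂`, being given by the coefficients of its normal form `g e`
modulo `m`. -/
def ComputesUntangling
    (P : StraightLineProgram F (Fin 3 × (Fin 2 →₀ ℕ)) ((Fin 2 →₀ ℕ) × (Fin 2 →₀ ℕ)))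
    (T : Fin 2 → MvPolynomial (Fin 2) F)
    (J : Ideal (MvPolynomial (Fin 2) (ResidueRing m))) : Prop :=
  ∀ f : MvPolynomial (Fin 2) F,
    (f.support : Set (Fin 2 →₀ ℕ)) ⊆ standardMonomials (contraction J) →
    ∃ (G : MvPolynomial (Fin 2) (ResidueRing m)) (g : (Fin 2 →₀ ℕ) → MvPolynomial (Fin 2) F),
      IsNormalForm (translatedIdeal J) G
        (untangling J (Ideal.Quotient.mk (contraction J) f)) ∧
      (∀ e, IsNormalForm m (g e) (G.coeff e)) ∧
      P.Computes (fun i => (![T 0, T 1, f] i.1).coeff i.2) (fun j => (g j.1).coeff j.2)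

end Untangling

/-- The degree of an ideal of `k[X 0, X 1]`: the dimension of the quotient over `k`. -/
noncomputable def idealDegree {k : Type*} [CommRing k] (I : Ideal (MvPolynomial (Fin 2) k)) : ℕ :=
  Module.finrank k (MvPolynomial (Fin 2) k ⧸ I)

/-- A recipe that chooses a straight-line program over `F` from three sets of monomials alone:
the monomial bases of the quotients by `m`, by `I` and by `J'`. -/
abbrev UntanglingAlgorithm (F : Type*) : Type _ :=
  Set (Fin 2 →₀ ℕ) → Set (Fin 2 →₀ ℕ) → Set (Fin 2 →₀ ℕ) →
    StraightLineProgram F (Fin 3 × (Fin 2 →₀ ℕ)) ((Fin 2 →₀ ℕ) × (Fin 2 →₀ ℕ))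

/-- On the data `(m, T, J)`, the algorithm computes untangling in at most `B` operations. -/
def UntanglingAlgorithm.Untangles {F : Type*} [Field F] (A : UntanglingAlgorithm F)
    {m : Ideal (MvPolynomial (Fin 2) F)} (T : Fin 2 → MvPolynomial (Fin 2) F)
    (J : Ideal (MvPolynomial (Fin 2) (ResidueRing m))) (B : ℝ) : Prop :=
  let P := A (standardMonomials m) (standardMonomials (contraction J))
    (standardMonomials (translatedIdeal J))
  ComputesUntangling P T J ∧ (P.cost : ℝ) ≤ B

/-! ### Polynomials: degree bounds, high and low parts -/

/-! Untangling is a Taylor expansion. The coefficient of `ξ₁^k ξ₂^l` in `f(ξ + α)` is the divided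
derivative of `f` of order `(k, l)` at `α` (`coeff_aeval_X_add_C`). As `J'` is monomial, reduction
modulo `J'` just discards the monomials outside its staircase (`IsMonomialIdeal.isNormalForm_sum`).
So `μ` divided derivatives of a polynomial with at most `n` terms have to be evaluated at `α`. This
is done in two ways.

All at once: translate the rows by `α₁`, then the columns by `α₂`. A shift of length `N` is one
convolution with factorials, which are invertible because the characteristic is `0` or at least `n`.
The coefficients lie in `𝕂`, a tower of two monic extensions defined by `T₁` and `T₂`; Kronecker
substitution multiplies the lengths by `d`, whence `O(M(dn))` (`reach_evalDeriv_of_taylor`).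

One by one: differentiate coefficientwise, reduce each row modulo `T₁`, then the result modulo `T₂`.
Every nonempty row of the staircase of `I` is at least as long as the degree of `T₁`
(`IsPrimaryAtAlpha.exponent_mem_standardMonomials`), so reducing a row costs as much as a product of
its own length. One derivative takes `O(M(n))`, all of them `O(M(μn))` (`reach_evalDeriv`). No
logarithm arises; the factor `log μ` only matters at `μ = 1`, where the bound vanishes: then `I =
m`, and the input is already the output.

Over a perfect field `α` lifts to `F[x₁, x₂] / I` by Newton iteration, so untangling is onto and `dμ
≤ n` (`idealDegree_mul_le`). Hence the smaller of `d` and `μ` is at most `√n`, which gives the last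
bound.

One program has to serve all ideals with the same monomial bases. Therefore everything is computed
for generic `T₁`, `T₂` and `f`, whose coefficients are functions of the input. `CostModel` records
which functions are reachable at which cost, and `CostModel.adjoin` carries this to each step of the
tower. `Polynomial.exists_specialization` then maps the generic result to `𝕂`. -/

namespace Polynomial

variable {B : Type*} [CommRing B]

/-- The set of the coefficients of a polynomial. -/
def coeffSet (p : B[X]) : Set B := Set.range p.coeff

theorem coeff_mem_coeffSet (p : B[X]) (i : ℕ) : p.coeff i ∈ p.coeffSet := ⟨i, rfl⟩

/-- The shift by one in the bound for `q` makes the bound for the product sharp without truncated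
subtraction. -/
theorem degree_mul_lt_of_lt {p q : B[X]} {a b : ℕ} (hp : p.degree < a)
    (hq : q.degree < ((b + 1 : ℕ) : WithBot ℕ)) : (p * q).degree < ((a + b : ℕ) : WithBot ℕ) := by
  rw [degree_lt_iff_coeff_zero] at *
  intro m hm
  rw [coeff_mul]
  refine Finset.sum_eq_zero fun x hx => ?_
  rw [Finset.HasAntidiagonal.mem_antidiagonal] at hx
  rcases le_or_gt a x.1 with h | h
  · rw [hp _ h, zero_mul]
  · rw [hq _ (by omega), mul_zero]

theorem degree_lt_of_degree_lt_of_le {p : B[X]} {a b : ℕ} (hp : p.degree < a) (h : a ≤ b) :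
    p.degree < b :=
  hp.trans_le (by exact_mod_cast h)

theorem degree_add_lt_of_lt {p q : B[X]} {a : ℕ} (hp : p.degree < a) (hq : q.degree < a) :
    (p + q).degree < a :=
  (degree_add_le p q).trans_lt (max_lt hp hq)

theorem degree_sub_lt_of_lt {p q : B[X]} {a : ℕ} (hp : p.degree < a) (hq : q.degree < a) :
    (p - q).degree < a :=
  (degree_sub_le p q).trans_lt (max_lt hp hq)

theorem degree_X_pow_lt_succ (a : ℕ) : (X ^ a : B[X]).degree < ((a + 1 : ℕ) : WithBot ℕ) :=
  (degree_X_pow_le a).trans_lt (by exact_mod_cast Nat.lt_succ_self a)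

theorem degree_X_pow_mul_lt {p : B[X]} {a : ℕ} (k : ℕ) (hp : p.degree < a) :
    (X ^ k * p).degree < ((k + a : ℕ) : WithBot ℕ) := by
  rw [mul_comm, add_comm]
  exact degree_mul_lt_of_lt hp (degree_X_pow_lt_succ k)

theorem degree_lt_of_X_pow_mul {p : B[X]} {a k : ℕ} (hp : (X ^ k * p).degree < ((k + a : ℕ) : WithBot ℕ)) :
    p.degree < a := by
  rw [degree_lt_iff_coeff_zero] at *
  intro m hm
  rw [← coeff_X_pow_mul p k]
  exact hp _ (by omega)

/-- The part of `p` of degree at least `d`, divided by `X ^ d`. -/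
noncomputable def highPart (d : ℕ) (p : B[X]) : B[X] := p /ₘ X ^ d

/-- The part of `p` of degree less than `d`. -/
noncomputable def lowPart (d : ℕ) (p : B[X]) : B[X] := p %ₘ X ^ d

theorem lowPart_add_highPart (d : ℕ) (p : B[X]) :
    lowPart d p + X ^ d * highPart d p = p := modByMonic_add_div p (X ^ d)

theorem degree_lowPart_lt (d : ℕ) (p : B[X]) : (lowPart d p).degree < d := by
  nontriviality B
  exact (degree_modByMonic_lt p (monic_X_pow d)).trans_le (degree_X_pow_le d)

theorem coeff_highPart (d : ℕ) (p : B[X]) (i : ℕ) : (highPart d p).coeff i = p.coeff (i + d) := by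
  conv_rhs => rw [← lowPart_add_highPart d p]
  rw [coeff_add, coeff_X_pow_mul,
    (degree_lt_iff_coeff_zero _ _).1 (degree_lowPart_lt d p) _ (by omega), zero_add]

theorem coeff_lowPart (d : ℕ) (p : B[X]) (i : ℕ) :
    (lowPart d p).coeff i = if i < d then p.coeff i else 0 := by
  split_ifs with h
  · conv_rhs => rw [← lowPart_add_highPart d p]
    rw [coeff_add, coeff_X_pow_mul', if_neg (by omega), add_zero]
  · exact (degree_lt_iff_coeff_zero _ _).1 (degree_lowPart_lt d p) _ (by omega)

theorem degree_highPart_lt {d a : ℕ} {p : B[X]} (hp : p.degree < ((d + a : ℕ) : WithBot ℕ)) :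
    (highPart d p).degree < a := by
  rw [degree_lt_iff_coeff_zero] at *
  intro m hm
  rw [coeff_highPart]
  exact hp _ (by omega)

/-! ### Cost models -/

/-- A cost model on an `F`-algebra `B`: `Reach S k U` says that the elements of `U` can be computed
from those of `S` in `k` operations of the field `F`. Additions and multiplications by constants
take `unit` operations, and `mulCost n` operations are enough for a product of polynomials of
degree less than `n`. -/
structure CostModel (F B : Type*) [Field F] [CommRing B] [Algebra F B] where
  Reach : Set B → ℕ → Set B → Prop
  unit : ℕ
  mulCost : ℕ → ℕ
  mono : ∀ {S S' U U' : Set B} {k k' : ℕ}, Reach S k U → S ⊆ S' → k ≤ k' → U' ⊆ U → Reach S' k' U'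
  trans : ∀ {S U V : Set B} {k l : ℕ}, Reach S k U → Reach (S ∪ U) l V →
    Reach S (k + l) (S ∪ U ∪ V)
  free : ∀ S : Set B, Reach S 0 (S ∪ Set.range (algebraMap F B))
  add : ∀ a b : B, Reach {a, b} unit {a + b}
  smul : ∀ (c : F) (a : B), Reach {a} unit {c • a}
  mul : ∀ (n : ℕ) (p q : Polynomial B), p.degree < n → q.degree < n →
    Reach (p.coeffSet ∪ q.coeffSet) (mulCost n) (p * q).coeffSet
  unit_mul_le : ∀ n, unit * n ≤ mulCost n
  superadditive : ∀ m n, mulCost m + mulCost n ≤ mulCost (m + n)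

namespace CostModel

variable {F B : Type*} [Field F] [CommRing B] [Algebra F B] (𝓜 : CostModel F B)

theorem mulCost_mono {m n : ℕ} (h : m ≤ n) : 𝓜.mulCost m ≤ 𝓜.mulCost n := by
  obtain ⟨k, rfl⟩ := Nat.exists_eq_add_of_le h
  exact (Nat.le_add_right _ _).trans (𝓜.superadditive m k)

theorem mul_mulCost_le (k n : ℕ) : k * 𝓜.mulCost n ≤ 𝓜.mulCost (k * n) := by
  induction k with
  | zero => simp
  | succ k ih =>
    rw [add_mul, add_mul, one_mul, one_mul]
    exact (Nat.add_le_add_right ih _).trans (𝓜.superadditive _ _)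

/-- Super-linearity in this form turns costs per row or per column into a cost for the whole
staircase. -/
theorem sum_mulCost_le {ι : Type*} (s : Finset ι) (f : ι → ℕ) :
    ∑ i ∈ s, 𝓜.mulCost (f i) ≤ 𝓜.mulCost (∑ i ∈ s, f i) := by
  classical
  induction s using Finset.induction_on with
  | empty => simp
  | insert i s hi ih =>
    rw [Finset.sum_insert hi, Finset.sum_insert hi]
    exact (Nat.add_le_add_left ih _).trans (𝓜.superadditive _ _)

variable {𝓜} {S U V : Set B} {k l : ℕ}

theorem Reach.subset_right (h : 𝓜.Reach S k U) (hV : V ⊆ U) : 𝓜.Reach S k V :=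
  𝓜.mono h subset_rfl le_rfl hV

theorem Reach.subset_left (h : 𝓜.Reach S k U) (hV : S ⊆ V) : 𝓜.Reach V k U :=
  𝓜.mono h hV le_rfl subset_rfl

theorem Reach.cost_le (h : 𝓜.Reach S k U) (hl : k ≤ l) : 𝓜.Reach S l U :=
  𝓜.mono h subset_rfl hl subset_rfl

theorem reach_of_subset (h : U ⊆ S ∪ Set.range (algebraMap F B)) : 𝓜.Reach S k U :=
  𝓜.mono (𝓜.free S) subset_rfl (Nat.zero_le _) h

theorem Reach.trans (h : 𝓜.Reach S k U) (h' : 𝓜.Reach (S ∪ U) l V) : 𝓜.Reach S (k + l) V :=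
  (CostModel.trans 𝓜 h h').subset_right Set.subset_union_right

theorem Reach.union (h : 𝓜.Reach S k U) (h' : 𝓜.Reach S l V) : 𝓜.Reach S (k + l) (U ∪ V) :=
  (CostModel.trans 𝓜 h (h'.subset_left Set.subset_union_left)).subset_right (by
    intro x hx; rcases hx with hx | hx <;> simp [hx])

theorem Reach.biUnion {ι : Type*} (s : Finset ι) {k : ι → ℕ} {U : ι → Set B}
    (h : ∀ i ∈ s, 𝓜.Reach S (k i) (U i)) : 𝓜.Reach S (∑ i ∈ s, k i) (⋃ i ∈ s, U i) := by
  classical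
  induction s using Finset.induction_on with
  | empty => exact reach_of_subset (by simp)
  | insert i s hi ih =>
    rw [Finset.sum_insert hi, Finset.set_biUnion_insert]
    exact (h i (Finset.mem_insert_self i s)).union
      (ih fun j hj => h j (Finset.mem_insert_of_mem hj))

theorem zero_mem_consts : (0 : B) ∈ Set.range (algebraMap F B) := ⟨0, map_zero _⟩

theorem one_mem_consts : (1 : B) ∈ Set.range (algebraMap F B) := ⟨1, map_one _⟩

theorem reach_coeffSet {p : B[X]} {n : ℕ} (hp : p.degree < n) {k : ℕ → ℕ}
    (h : ∀ i < n, 𝓜.Reach S (k i) {p.coeff i}) :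
    𝓜.Reach S (∑ i ∈ Finset.range n, k i) p.coeffSet := by
  have h1 : 𝓜.Reach S 0 {(0 : B)} :=
    reach_of_subset (by simpa using Or.inr zero_mem_consts)
  refine (((Reach.biUnion (Finset.range n) fun i hi => h i (Finset.mem_range.1 hi)).union
    h1).subset_right ?_).cost_le (by omega)
  rintro _ ⟨i, rfl⟩
  by_cases hi : i < n
  · exact Or.inl (Set.mem_biUnion (x := i) (by simpa using hi) rfl)
  · exact Or.inr ((degree_lt_iff_coeff_zero _ _).1 hp i (by omega))

theorem reach_coeffSet_of_le {p : B[X]} {n c : ℕ} (hp : p.degree < n)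
    (h : ∀ i < n, 𝓜.Reach S c {p.coeff i}) : 𝓜.Reach S (n * c) p.coeffSet := by
  simpa using reach_coeffSet hp (k := fun _ => c) h

/-- Constants of `F` are free operands, so they may be counted among the known elements. -/
theorem Reach.of_known (h : 𝓜.Reach (S ∪ Set.range (algebraMap F B)) k U) : 𝓜.Reach S k U :=
  (Reach.trans (k := 0) (reach_of_subset subset_rfl)
    (h.subset_left Set.subset_union_right)).cost_le (by omega)

theorem reach_add {p q : B[X]} {n : ℕ} (hp : p.degree < n) (hq : q.degree < n)
    (h1 : p.coeffSet ⊆ S ∪ Set.range (algebraMap F B))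
    (h2 : q.coeffSet ⊆ S ∪ Set.range (algebraMap F B)) :
    𝓜.Reach S (𝓜.unit * n) (p + q).coeffSet := by
  refine Reach.of_known ?_
  generalize S ∪ Set.range (algebraMap F B) = S at *
  rw [mul_comm]
  refine reach_coeffSet_of_le (degree_add_lt_of_lt hp hq) fun i _ => ?_
  rw [coeff_add]
  refine (𝓜.add _ _).subset_left ?_
  rintro x (rfl | rfl)
  exacts [h1 (coeff_mem_coeffSet _ _), h2 (coeff_mem_coeffSet _ _)]

theorem reach_sub {p q : B[X]} {n : ℕ} (hp : p.degree < n) (hq : q.degree < n)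
    (h1 : p.coeffSet ⊆ S ∪ Set.range (algebraMap F B))
    (h2 : q.coeffSet ⊆ S ∪ Set.range (algebraMap F B)) :
    𝓜.Reach S (2 * (𝓜.unit * n)) (p - q).coeffSet := by
  refine Reach.of_known ?_
  generalize S ∪ Set.range (algebraMap F B) = S at *
  have h : 𝓜.Reach S (n * (𝓜.unit + 𝓜.unit)) (p - q).coeffSet := by
    refine reach_coeffSet_of_le (degree_sub_lt_of_lt hp hq) fun i _ => ?_
    have h3 : (p - q).coeff i = p.coeff i + (-1 : F) • q.coeff i := by
      simp [sub_eq_add_neg]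
    rw [h3]
    refine Reach.trans ((𝓜.smul (-1) (q.coeff i)).subset_left ?_) ((𝓜.add _ _).subset_left ?_)
    · rintro x rfl
      exact h2 (coeff_mem_coeffSet _ _)
    · rintro x (rfl | rfl)
      exacts [Or.inl (h1 (coeff_mem_coeffSet _ _)), Or.inr rfl]
  exact h.cost_le (le_of_eq (by ring))

theorem coeffSet_highPart (d : ℕ) (p : B[X]) : (highPart d p).coeffSet ⊆ p.coeffSet := by
  rintro _ ⟨i, rfl⟩
  exact ⟨i + d, (coeff_highPart d p i).symm⟩

theorem coeffSet_lowPart_subset {d : ℕ} {p : B[X]}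
    (h : p.coeffSet ⊆ S ∪ Set.range (algebraMap F B)) :
    (lowPart d p).coeffSet ⊆ S ∪ Set.range (algebraMap F B) := by
  rintro _ ⟨i, rfl⟩
  rw [coeff_lowPart]
  split_ifs
  exacts [h (coeff_mem_coeffSet _ _), Or.inr zero_mem_consts]

theorem coeffSet_X_pow_mul_subset {d : ℕ} {p : B[X]}
    (h : p.coeffSet ⊆ S ∪ Set.range (algebraMap F B)) :
    (X ^ d * p).coeffSet ⊆ S ∪ Set.range (algebraMap F B) := by
  rintro _ ⟨i, rfl⟩
  rw [coeff_X_pow_mul']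
  split_ifs
  exacts [h (coeff_mem_coeffSet _ _), Or.inr zero_mem_consts]

theorem coeffSet_X_pow_subset (d : ℕ) :
    (X ^ d : B[X]).coeffSet ⊆ S ∪ Set.range (algebraMap F B) := by
  rintro _ ⟨i, rfl⟩
  rw [coeff_X_pow]
  split_ifs
  exacts [Or.inr one_mem_consts, Or.inr zero_mem_consts]

theorem reach_mul {p q : B[X]} {n : ℕ} (hp : p.degree < n) (hq : q.degree < n)
    (h1 : p.coeffSet ⊆ S ∪ Set.range (algebraMap F B))
    (h2 : q.coeffSet ⊆ S ∪ Set.range (algebraMap F B)) :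
    𝓜.Reach S (𝓜.mulCost n) (p * q).coeffSet :=
  ((𝓜.mul n p q hp hq).subset_left (Set.union_subset h1 h2)).of_known

/-- Polynomials of twice the degree are multiplied by splitting them in two halves. -/
theorem reach_mul_two {p q : B[X]} {n : ℕ} (hp : p.degree < ((2 * n : ℕ) : WithBot ℕ))
    (hq : q.degree < ((2 * n : ℕ) : WithBot ℕ)) (h1 : p.coeffSet ⊆ S ∪ Set.range (algebraMap F B))
    (h2 : q.coeffSet ⊆ S ∪ Set.range (algebraMap F B)) :
    𝓜.Reach S (13 * 𝓜.mulCost n) (p * q).coeffSet := by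
  rw [two_mul] at hp hq
  set p0 := lowPart n p
  set p1 := highPart n p
  set q0 := lowPart n q
  set q1 := highPart n q
  have dp0 : p0.degree < n := degree_lowPart_lt n p
  have dp1 : p1.degree < n := degree_highPart_lt hp
  have dq0 : q0.degree < n := degree_lowPart_lt n q
  have dq1 : q1.degree < n := degree_highPart_lt hq
  have dmul : ∀ {a b : B[X]}, a.degree < n → b.degree < n → (a * b).degree < ((2 * n : ℕ) : WithBot ℕ) := by
    intro a b ha hb
    rw [two_mul]
    exact degree_mul_lt_of_lt ha (degree_lt_of_degree_lt_of_le hb (Nat.le_succ n))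
  -- Schoolbook splitting: four products of half the size, and additions of lengths `2n`, `3n` and
  -- `4n`, hence the constant `4 + 9 = 13`.
  have key : p * q = (p0 * q0 + X ^ n * (p0 * q1 + p1 * q0)) + X ^ (2 * n) * (p1 * q1) := by
    conv_lhs => rw [← lowPart_add_highPart n p, ← lowPart_add_highPart n q]
    change (p0 + X ^ n * p1) * (q0 + X ^ n * q1) = _
    ring
  have hm := 𝓜.unit_mul_le n
  set S' := S ∪ Set.range (algebraMap F B) with hS
  have sp0 : p0.coeffSet ⊆ S' := coeffSet_lowPart_subset h1
  have sq0 : q0.coeffSet ⊆ S' := coeffSet_lowPart_subset h2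
  have sp1 : p1.coeffSet ⊆ S' := (coeffSet_highPart _ _).trans h1
  have sq1 : q1.coeffSet ⊆ S' := (coeffSet_highPart _ _).trans h2
  have e1 := ((reach_mul (𝓜 := 𝓜) dp0 dq0 sp0 sq0).union (reach_mul (𝓜 := 𝓜) dp0 dq1 sp0 sq1)).union
    ((reach_mul (𝓜 := 𝓜) dp1 dq0 sp1 sq0).union (reach_mul (𝓜 := 𝓜) dp1 dq1 sp1 sq1))
  set U1 := (p0 * q0).coeffSet ∪ (p0 * q1).coeffSet ∪ ((p1 * q0).coeffSet ∪ (p1 * q1).coeffSet)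
  have e2 : 𝓜.Reach (S ∪ U1) (𝓜.unit * (2 * n)) (p0 * q1 + p1 * q0).coeffSet :=
    reach_add (dmul dp0 dq1) (dmul dp1 dq0)
      (fun x hx => Or.inl (Or.inr (Or.inl (Or.inr hx))))
      (fun x hx => Or.inl (Or.inr (Or.inr (Or.inl hx))))
  have e3 : 𝓜.Reach (S ∪ U1 ∪ (p0 * q1 + p1 * q0).coeffSet) (𝓜.unit * (3 * n))
      (p0 * q0 + X ^ n * (p0 * q1 + p1 * q0)).coeffSet := by
    refine reach_add ?_ ?_
        (fun x hx => Or.inl (Or.inl (Or.inr (Or.inl (Or.inl hx)))))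
        (coeffSet_X_pow_mul_subset fun x hx => Or.inl (Or.inr hx))
    · exact degree_lt_of_degree_lt_of_le (dmul dp0 dq0) (by omega)
    · rw [show 3 * n = n + 2 * n by omega]
      exact degree_X_pow_mul_lt n (degree_add_lt_of_lt (dmul dp0 dq1) (dmul dp1 dq0))
  have e4 : 𝓜.Reach (S ∪ U1 ∪ (p0 * q1 + p1 * q0).coeffSet ∪
      (p0 * q0 + X ^ n * (p0 * q1 + p1 * q0)).coeffSet) (𝓜.unit * (4 * n)) (p * q).coeffSet := by
    rw [key]
    refine reach_add ?_ ?_ (fun x hx => Or.inl (Or.inr hx))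
        (coeffSet_X_pow_mul_subset fun x hx => Or.inl (Or.inl (Or.inl (Or.inr (Or.inr (Or.inr hx))))))
    · refine degree_add_lt_of_lt (degree_lt_of_degree_lt_of_le (dmul dp0 dq0) (by omega)) ?_
      rw [show 4 * n = n + 3 * n by omega]
      exact degree_X_pow_mul_lt n (degree_add_lt_of_lt
        (degree_lt_of_degree_lt_of_le (dmul dp0 dq1) (by omega))
        (degree_lt_of_degree_lt_of_le (dmul dp1 dq0) (by omega)))
    · rw [show 4 * n = 2 * n + 2 * n by omega]
      exact degree_X_pow_mul_lt _ (dmul dp1 dq1)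
  refine (e1.trans (e2.trans (e3.trans e4))).cost_le ?_
  have : 𝓜.unit * (2 * n) + 𝓜.unit * (3 * n) + 𝓜.unit * (4 * n) = 9 * (𝓜.unit * n) := by ring
  omega

end CostModel

end Polynomial

namespace Polynomial

/-! ### Reciprocals and Euclidean division -/

section Reciprocal

variable {B : Type*} [CommRing B]

/-- `w` is the quotient of `X ^ (2 * d)` by `t`. -/
structure IsReciprocal (t w : B[X]) (d : ℕ) : Prop where
  degree_lt : w.degree < ((d + 1 : ℕ) : WithBot ℕ)
  degree_sub_lt : (X ^ (2 * d) - w * t).degree < (d : WithBot ℕ)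

/-- One cubic Newton step, from precision `e` to precision `d ≤ 3 * e`. -/
theorem IsReciprocal.of_newton {t s : B[X]} {d e : ℕ} (hed : d ≤ 3 * e)
    (hs : s.degree < ((e + 1 : ℕ) : WithBot ℕ)) (ht : t.degree < ((d + 1 : ℕ) : WithBot ℕ))
    (E : B[X]) (hE : E.degree < d) (hst : X ^ (d + e) - s * t = E) :
    IsReciprocal t (highPart (d + 3 * e)
      (X ^ (2 * (d + e)) * s + (X ^ (d + e) * (E * s) + E * (E * s)))) d := by
  -- Since `s * t = X ^ (d + e) - E`, multiplying `s` by the truncated geometric series gives `S * t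
  -- = X ^ (3 * (d + e)) - E ^ 3`. The error `E ^ 3` is small enough because `3 * d ≤ 2 * d + 3 *
  -- e`.
  set S := X ^ (2 * (d + e)) * s + (X ^ (d + e) * (E * s) + E * (E * s))
  have hEs : (E * s).degree < ((d + e : ℕ) : WithBot ℕ) := degree_mul_lt_of_lt hE hs
  have hS : S.degree < ((d + 3 * e + (d + 1) : ℕ) : WithBot ℕ) := by
    refine degree_add_lt_of_lt ?_ (degree_add_lt_of_lt ?_ ?_)
    · exact degree_lt_of_degree_lt_of_le (degree_X_pow_mul_lt _ hs) (by omega)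
    · exact degree_lt_of_degree_lt_of_le (degree_X_pow_mul_lt _ hEs) (by omega)
    · exact degree_lt_of_degree_lt_of_le (degree_mul_lt_of_lt hE
        (degree_lt_of_degree_lt_of_le hEs (Nat.le_succ _))) (by omega)
  refine ⟨degree_highPart_lt hS, ?_⟩
  have h1 : S * t = X ^ (3 * (d + e)) - E ^ 3 := by
    have : s * t = X ^ (d + e) - E := by rw [← hst]; ring
    calc S * t = (X ^ (2 * (d + e)) + (X ^ (d + e) * E + E * E)) * (s * t) := by ring
      _ = _ := by rw [this]; ring
  have h2 : X ^ (d + 3 * e) * (X ^ (2 * d) - highPart (d + 3 * e) S * t) =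
      E * (E * E) + lowPart (d + 3 * e) S * t := by
    have h3 := lowPart_add_highPart (d + 3 * e) S
    have h4 : X ^ (d + 3 * e) * X ^ (2 * d) = (X : B[X]) ^ (3 * (d + e)) := by ring
    calc _ = X ^ (d + 3 * e) * X ^ (2 * d) - (X ^ (d + 3 * e) * highPart (d + 3 * e) S) * t := by
          ring
      _ = X ^ (3 * (d + e)) - (S - lowPart (d + 3 * e) S) * t := by
          rw [h4, show X ^ (d + 3 * e) * highPart (d + 3 * e) S = S - lowPart (d + 3 * e) S by
            linear_combination h3]
      _ = X ^ (3 * (d + e)) - S * t + lowPart (d + 3 * e) S * t := by ring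
      _ = _ := by rw [h1]; ring
  refine degree_lt_of_X_pow_mul (k := d + 3 * e) ?_
  rw [h2]
  have hE' := degree_lt_of_degree_lt_of_le hE (Nat.le_succ d)
  refine degree_add_lt_of_lt ?_ ?_
  · exact degree_lt_of_degree_lt_of_le (degree_mul_lt_of_lt hE (degree_lt_of_degree_lt_of_le
      (degree_mul_lt_of_lt hE hE') (Nat.le_succ _))) (by omega)
  · exact degree_mul_lt_of_lt (degree_lowPart_lt _ _) ht

/-- The reciprocal of the leading part of `t` is a reciprocal of `t` to lower precision. -/
theorem IsReciprocal.degree_sub_lt_of_highPart {t s : B[X]} {d e : ℕ} (hed : e ≤ d)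
    (h : IsReciprocal (highPart (d - e) t) s e) : (X ^ (d + e) - s * t).degree < (d : WithBot ℕ) := by
  have h1 : X ^ (d + e) - s * t =
      X ^ (d - e) * (X ^ (2 * e) - s * highPart (d - e) t) - lowPart (d - e) t * s := by
    have h2 : (X : B[X]) ^ (d + e) = X ^ (d - e) * X ^ (2 * e) := by
      rw [← pow_add]; congr 1; omega
    conv_lhs => rw [← lowPart_add_highPart (d - e) t, h2]
    ring
  rw [h1]
  refine degree_sub_lt_of_lt ?_ ?_
  · exact degree_lt_of_degree_lt_of_le (degree_X_pow_mul_lt _ h.degree_sub_lt) (by omega)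
  · exact degree_lt_of_degree_lt_of_le (degree_mul_lt_of_lt (degree_lowPart_lt _ _) h.degree_lt)
      (by omega)

/-- Division with remainder of `p` by means of the reciprocal of `t`. -/
theorem modByMonic_eq_of_isReciprocal [Nontrivial B] {t w p : B[X]} {d : ℕ} (ht : t.Monic)
    (hd : t.natDegree = d) (h : IsReciprocal t w d) (hp : p.degree < ((d + d : ℕ) : WithBot ℕ)) :
    p %ₘ t = p - highPart d (highPart d p * w) * t := by
  have htd : t.degree < ((d + 1 : ℕ) : WithBot ℕ) := by
    rw [degree_eq_natDegree ht.ne_zero, hd]; exact_mod_cast Nat.lt_succ_self d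
  refine (div_modByMonic_unique (highPart d (highPart d p * w)) _ ht ⟨by ring, ?_⟩).2
  rw [degree_eq_natDegree ht.ne_zero, hd]
  -- Multiplication by `X ^ d` separates three errors: the low part of `p`, the error of `w` and the
  -- low part of the product. Each contributes degree less than `2 * d`.
  refine degree_lt_of_X_pow_mul (k := d) ?_
  have h1 := lowPart_add_highPart d p
  have h2 := lowPart_add_highPart d (highPart d p * w)
  have h3 : X ^ d * (p - highPart d (highPart d p * w) * t) =
      X ^ d * lowPart d p + (X ^ (2 * d) - w * t) * highPart d p +
        lowPart d (highPart d p * w) * t := by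
    calc _ = X ^ d * p - (X ^ d * highPart d (highPart d p * w)) * t := by ring
      _ = X ^ d * (lowPart d p + X ^ d * highPart d p) -
          (highPart d p * w - lowPart d (highPart d p * w)) * t := by
          rw [h1, show X ^ d * highPart d (highPart d p * w) =
            highPart d p * w - lowPart d (highPart d p * w) by linear_combination h2]
      _ = _ := by ring
  rw [h3]
  refine degree_add_lt_of_lt (degree_add_lt_of_lt ?_ ?_) ?_
  · exact degree_X_pow_mul_lt _ (degree_lowPart_lt _ _)
  · exact degree_mul_lt_of_lt h.degree_sub_lt
      (degree_lt_of_degree_lt_of_le (degree_highPart_lt hp) (Nat.le_succ _))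
  · exact degree_mul_lt_of_lt (degree_lowPart_lt _ _) htd

end Reciprocal

/-! ### Cost of reciprocals and of division with remainder. -/

namespace CostModel

variable {F B : Type*} [Field F] [CommRing B] [Algebra F B] {𝓜 : CostModel F B} {S : Set B}

/-- Newton iteration, starting from a reciprocal of the leading half of `t`. By superadditivity the
recursive call at `e ≤ d / 2` costs at most `51 * mulCost d`; three products at `13` each and linear
work of `12` units per coefficient complete `51 + 39 + 12 = 102`. -/
theorem exists_isReciprocal (𝓜 : CostModel F B) (d : ℕ) (hd : 0 < d) (t : B[X])
    (ht : t.degree < ((d + 1 : ℕ) : WithBot ℕ)) (ht1 : t.coeff d = 1) :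
    ∃ w, IsReciprocal t w d ∧ 𝓜.Reach t.coeffSet (102 * 𝓜.mulCost d) w.coeffSet := by
  induction d using Nat.strong_induction_on generalizing t with
  | _ d ih =>
  rcases Nat.lt_or_ge d 2 with h2 | h2
  · obtain rfl : d = 1 := by omega
    have htX : t = X + C (t.coeff 0) := by
      ext i
      rcases i with _ | _ | i
      · simp
      · simpa using ht1
      · rw [(degree_lt_iff_coeff_zero _ _).1 ht _ (by omega)]
        simp [coeff_X]
    generalize t.coeff 0 = b at htX
    have hw : (X - C b).degree < ((1 + 1 : ℕ) : WithBot ℕ) := by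
      rw [degree_lt_iff_coeff_zero]
      intro m hm
      obtain ⟨m, rfl⟩ := Nat.exists_eq_add_of_le hm
      simp [coeff_X, coeff_C, show 1 ≠ 1 + 1 + m by omega]
    refine ⟨X - C b, ⟨hw, ?_⟩, ?_⟩
    · rw [htX, show X ^ (2 * 1) - (X - C b) * (X + C b) = C (b * b) by rw [C_mul]; ring]
      exact degree_C_le.trans_lt (by norm_num)
    · have := 𝓜.unit_mul_le 1
      have h3 : 𝓜.Reach t.coeffSet (2 * 𝓜.unit) (X - C b).coeffSet := by
        refine reach_coeffSet_of_le hw fun i _ => ?_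
        have hb : b ∈ t.coeffSet := ⟨0, by simp [htX]⟩
        rcases i with _ | i
        · rw [show (X - C b : B[X]).coeff 0 = (-1 : F) • b by simp]
          exact (𝓜.smul _ _).subset_left (by simpa using hb)
        · refine reach_of_subset ?_
          rintro x rfl
          rcases i with _ | i
          · right; simpa [coeff_C] using one_mem_consts (F := F) (B := B)
          · right; simpa [coeff_X, coeff_C] using zero_mem_consts (F := F) (B := B)
      exact h3.cost_le (by omega)
  -- Rounding down is what halves the recursive cost. For odd `d` a quadratic step from `e` would
  -- fall short of `d`, while `d ≤ 3 * e` holds for all `d ≥ 2`.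
  obtain ⟨e, hde, he0, hed, he3⟩ : ∃ e, 2 * e ≤ d ∧ 0 < e ∧ e < d ∧ d ≤ 3 * e :=
    ⟨d / 2, by omega, by omega, by omega, by omega⟩
  obtain ⟨s, hs, e1⟩ := ih e hed he0 (highPart (d - e) t)
    (degree_highPart_lt (degree_lt_of_degree_lt_of_le ht (by omega)))
    (by rw [coeff_highPart, show e + (d - e) = d by omega, ht1])
  have e1 := e1.subset_left (coeffSet_highPart _ _)
  have hE := hs.degree_sub_lt_of_highPart hed.le
  set E := X ^ (d + e) - s * t with hEdef
  have hsd := hs.degree_lt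
  have hEs : (E * s).degree < ((d + e : ℕ) : WithBot ℕ) := degree_mul_lt_of_lt hE hsd
  have hEEs : (E * (E * s)).degree < ((d + (d + e) : ℕ) : WithBot ℕ) :=
    degree_mul_lt_of_lt hE (degree_lt_of_degree_lt_of_le hEs (Nat.le_succ _))
  refine ⟨_, IsReciprocal.of_newton he3 hsd ht E hE rfl, ?_⟩
  refine Reach.subset_right ?_ (coeffSet_highPart _ _)
  have e2 : 𝓜.Reach (t.coeffSet ∪ s.coeffSet) (13 * 𝓜.mulCost d) (s * t).coeffSet :=
    reach_mul_two (degree_lt_of_degree_lt_of_le hsd (by omega))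
      (degree_lt_of_degree_lt_of_le ht (by omega)) (fun x hx => Or.inl (Or.inr hx))
      (fun x hx => Or.inl (Or.inl hx))
  have hst2 : (s * t).degree < ((2 * d : ℕ) : WithBot ℕ) := by
    rw [show s * t = X ^ (d + e) - E by rw [hEdef]; ring]
    exact degree_sub_lt_of_lt
      (degree_lt_of_degree_lt_of_le (degree_X_pow_lt_succ _) (by omega))
      (degree_lt_of_degree_lt_of_le hE (by omega))
  have e3 : 𝓜.Reach (t.coeffSet ∪ s.coeffSet ∪ (s * t).coeffSet) (2 * (𝓜.unit * (2 * d)))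
      E.coeffSet :=
    reach_sub (degree_lt_of_degree_lt_of_le (degree_X_pow_lt_succ _) (by omega))
      hst2 (coeffSet_X_pow_subset _) (fun x hx => Or.inl (Or.inr hx))
  have e4 : 𝓜.Reach (t.coeffSet ∪ s.coeffSet ∪ (s * t).coeffSet ∪ E.coeffSet)
      (13 * 𝓜.mulCost d) (E * s).coeffSet :=
    reach_mul_two (degree_lt_of_degree_lt_of_le hE (by omega))
      (degree_lt_of_degree_lt_of_le hsd (by omega)) (fun x hx => Or.inl (Or.inr hx))
      (fun x hx => Or.inl (Or.inl (Or.inl (Or.inr hx))))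
  have e5 : 𝓜.Reach (t.coeffSet ∪ s.coeffSet ∪ (s * t).coeffSet ∪ E.coeffSet ∪ (E * s).coeffSet)
      (13 * 𝓜.mulCost d) (E * (E * s)).coeffSet :=
    reach_mul_two (degree_lt_of_degree_lt_of_le hE (by omega))
      (degree_lt_of_degree_lt_of_le hEs (by omega)) (fun x hx => Or.inl (Or.inl (Or.inr hx)))
      (fun x hx => Or.inl (Or.inr hx))
  have e6 : 𝓜.Reach (t.coeffSet ∪ s.coeffSet ∪ (s * t).coeffSet ∪ E.coeffSet ∪ (E * s).coeffSet ∪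
      (E * (E * s)).coeffSet) (𝓜.unit * (4 * d)) (X ^ (d + e) * (E * s) + E * (E * s)).coeffSet :=
    reach_add (degree_lt_of_degree_lt_of_le (degree_X_pow_mul_lt _ hEs) (by omega))
      (degree_lt_of_degree_lt_of_le hEEs (by omega))
      (coeffSet_X_pow_mul_subset fun x hx => Or.inl (Or.inl (Or.inr hx)))
      (fun x hx => Or.inl (Or.inr hx))
  have e7 : 𝓜.Reach (t.coeffSet ∪ s.coeffSet ∪ (s * t).coeffSet ∪ E.coeffSet ∪ (E * s).coeffSet ∪
      (E * (E * s)).coeffSet ∪ (X ^ (d + e) * (E * s) + E * (E * s)).coeffSet) (𝓜.unit * (4 * d))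
      (X ^ (2 * (d + e)) * s + (X ^ (d + e) * (E * s) + E * (E * s))).coeffSet :=
    reach_add (degree_lt_of_degree_lt_of_le (degree_X_pow_mul_lt _ hsd) (by omega))
      (degree_add_lt_of_lt
        (degree_lt_of_degree_lt_of_le (degree_X_pow_mul_lt _ hEs) (by omega))
        (degree_lt_of_degree_lt_of_le hEEs (by omega)))
      (coeffSet_X_pow_mul_subset fun x hx =>
        Or.inl (Or.inl (Or.inl (Or.inl (Or.inl (Or.inl (Or.inr hx)))))))
      (fun x hx => Or.inl (Or.inr hx))
  refine (e1.trans (e2.trans (e3.trans (e4.trans (e5.trans (e6.trans e7)))))).cost_le ?_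
  have h5 := 𝓜.unit_mul_le d
  have h6 : 2 * 𝓜.mulCost e ≤ 𝓜.mulCost d :=
    (𝓜.mul_mulCost_le 2 e).trans (𝓜.mulCost_mono hde)
  have h7 : 2 * (𝓜.unit * (2 * d)) + 𝓜.unit * (4 * d) + 𝓜.unit * (4 * d) =
    12 * (𝓜.unit * d) := by ring
  omega

theorem reach_modByMonic_of_lt_two_mul [Nontrivial B] {t w p : B[X]} {d : ℕ} (ht : t.Monic)
    (hd : t.natDegree = d) (hd0 : 0 < d)
    (h : IsReciprocal t w d) (hp : p.degree < ((d + d : ℕ) : WithBot ℕ))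
    (hpS : p.coeffSet ⊆ S ∪ Set.range (algebraMap F B))
    (htS : t.coeffSet ⊆ S) (hwS : w.coeffSet ⊆ S) :
    𝓜.Reach S (32 * 𝓜.mulCost d) (p %ₘ t).coeffSet := by
  have htd : t.degree < ((d + 1 : ℕ) : WithBot ℕ) := by
    rw [degree_eq_natDegree ht.ne_zero, hd]; exact_mod_cast Nat.lt_succ_self d
  rw [modByMonic_eq_of_isReciprocal ht hd h hp]
  have h1 := degree_highPart_lt hp
  have hw := h.degree_lt
  have h2 : (highPart d p * w).degree < ((d + d : ℕ) : WithBot ℕ) := degree_mul_lt_of_lt h1 hw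
  have e1 : 𝓜.Reach S (13 * 𝓜.mulCost d) (highPart d p * w).coeffSet :=
    reach_mul_two (degree_lt_of_degree_lt_of_le h1 (by omega))
      (degree_lt_of_degree_lt_of_le hw (by omega)) ((coeffSet_highPart _ _).trans hpS)
      (fun x hx => Or.inl (hwS hx))
  have e2 : 𝓜.Reach (S ∪ (highPart d p * w).coeffSet) (13 * 𝓜.mulCost d)
      (highPart d (highPart d p * w) * t).coeffSet :=
    reach_mul_two (degree_lt_of_degree_lt_of_le (degree_highPart_lt h2) (by omega))
      (degree_lt_of_degree_lt_of_le htd (by omega))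
      (fun x hx => Or.inl (Or.inr (coeffSet_highPart _ _ hx))) (fun x hx => Or.inl (Or.inl (htS hx)))
  have e3 : 𝓜.Reach (S ∪ (highPart d p * w).coeffSet ∪
      (highPart d (highPart d p * w) * t).coeffSet) (2 * (𝓜.unit * (2 * d)))
      (p - highPart d (highPart d p * w) * t).coeffSet :=
    reach_sub (degree_lt_of_degree_lt_of_le hp (by omega))
      (degree_lt_of_degree_lt_of_le (degree_mul_lt_of_lt (degree_highPart_lt h2) htd) (by omega))
      (fun x hx => (hpS hx).imp (fun h => Or.inl (Or.inl h)) id) (fun x hx => Or.inl (Or.inr hx))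
  refine (e1.trans (e2.trans e3)).cost_le ?_
  have h5 := 𝓜.unit_mul_le d
  have h7 : 2 * (𝓜.unit * (2 * d)) = 4 * (𝓜.unit * d) := by ring
  omega

/-- Division by `t` of a polynomial of large degree, block by block. -/
theorem reach_modByMonic [Nontrivial B] {t w : B[X]} {d : ℕ} (ht : t.Monic)
    (hd : t.natDegree = d) (hd0 : 0 < d) (h : IsReciprocal t w d) (L : ℕ) {p : B[X]}
    (hp : p.degree < ((d * L : ℕ) : WithBot ℕ))
    (hpS : p.coeffSet ⊆ S ∪ Set.range (algebraMap F B))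
    (htS : t.coeffSet ⊆ S) (hwS : w.coeffSet ⊆ S) :
    𝓜.Reach S (L * (32 * 𝓜.mulCost d)) (p %ₘ t).coeffSet := by
  induction L generalizing p with
  | zero =>
    have : p = 0 := by simpa using hp
    refine reach_of_subset ?_
    rintro _ ⟨i, rfl⟩
    simp [this]
  | succ L ih =>
    have hh : (highPart d p).degree < ((d * L : ℕ) : WithBot ℕ) :=
      degree_highPart_lt (degree_lt_of_degree_lt_of_le hp (by rw [mul_add]; omega))
    have e1 := ih hh ((coeffSet_highPart _ _).trans hpS)
    have hr : (highPart d p %ₘ t).degree < d := by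
      have := degree_modByMonic_lt (highPart d p) ht
      rwa [degree_eq_natDegree ht.ne_zero, hd] at this
    -- Horner's rule in `X ^ d`: the high part is replaced by its remainder, which leaves a dividend
    -- of degree less than `2 * d`.
    have key : p %ₘ t = (lowPart d p + X ^ d * (highPart d p %ₘ t)) %ₘ t := by
      conv_lhs => rw [← lowPart_add_highPart d p]
      rw [add_modByMonic, add_modByMonic, mul_modByMonic _ (highPart d p %ₘ t),
        mul_modByMonic _ (highPart d p), modByMonic_eq_self_iff ht |>.2 (degree_modByMonic_lt _ ht)]
    rw [key]
    have e2 : 𝓜.Reach (S ∪ (highPart d p %ₘ t).coeffSet) 0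
        (lowPart d p + X ^ d * (highPart d p %ₘ t)).coeffSet := by
      refine reach_of_subset ?_
      rintro _ ⟨i, rfl⟩
      rw [coeff_add, coeff_lowPart, coeff_X_pow_mul']
      split_ifs with h1 h2 h2
      · omega
      · rw [add_zero]
        exact (hpS (coeff_mem_coeffSet _ _)).imp Or.inl id
      · rw [zero_add]
        exact Or.inl (Or.inr (coeff_mem_coeffSet _ _))
      · omega
    refine (e1.trans (e2.trans (reach_modByMonic_of_lt_two_mul ht hd hd0 h (degree_add_lt_of_lt
      (degree_lt_of_degree_lt_of_le (degree_lowPart_lt _ _) (by omega)) (degree_X_pow_mul_lt _ hr))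
      (fun x hx => Or.inl (Or.inr hx)) (fun x hx => Or.inl (Or.inl (htS hx)))
      (fun x hx => Or.inl (Or.inl (hwS hx)))))).cost_le (le_of_eq (by ring))

end CostModel

end Polynomial

namespace Polynomial

/-! ### The cost model on `B[X] / t` -/

section Kronecker

variable {B : Type*} [CommRing B]

/-- Kronecker substitution. -/
theorem coeff_eval_X_pow {P : B[X][X]} {k : ℕ} (hP : ∀ j, (P.coeff j).degree < (k : WithBot ℕ))
    (j i : ℕ) (hi : i < k) : (P.eval (X ^ k)).coeff (k * j + i) = (P.coeff j).coeff i := by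
  rw [eval_eq_sum_range, finsetSum_coeff]
  have h : ∀ l, l ≠ j → (P.coeff l * (X ^ k) ^ l).coeff (k * j + i) = 0 := by
    intro l hl
    rw [← pow_mul, coeff_mul_X_pow']
    split_ifs with h1
    · refine (degree_lt_iff_coeff_zero _ _).1 (hP l) _ ?_
      rcases Nat.lt_or_gt_of_ne hl with h2 | h2
      · have := Nat.mul_le_mul_left k h2
        rw [Nat.mul_succ] at this
        omega
      · have := Nat.mul_le_mul_left k h2
        rw [Nat.mul_succ] at this
        omega
    · rfl
  rw [Finset.sum_eq_single j (fun l _ hl => h l hl)]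
  · rw [← pow_mul, coeff_mul_X_pow', if_pos (Nat.le_add_right _ _), Nat.add_sub_cancel_left]
  · intro hj
    have h0 : P.coeff j = 0 :=
      coeff_eq_zero_of_natDegree_lt (by rw [Finset.mem_range] at hj; omega)
    rw [h0, zero_mul, coeff_zero]

theorem degree_eval_X_pow_lt {P : B[X][X]} {k n : ℕ} (hk : 0 < k)
    (hP : ∀ j, (P.coeff j).degree < (k : WithBot ℕ)) (hn : P.degree < n) :
    (P.eval (X ^ k)).degree < ((k * n : ℕ) : WithBot ℕ) := by
  rw [degree_lt_iff_coeff_zero]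
  intro m hm
  rw [← Nat.div_add_mod m k, coeff_eval_X_pow hP _ _ (Nat.mod_lt _ hk),
    (degree_lt_iff_coeff_zero _ _).1 hn _ ((Nat.le_div_iff_mul_le hk).2 (by rwa [mul_comm])),
    coeff_zero]

theorem coeffSet_eval_X_pow {P : B[X][X]} {k : ℕ} (hk : 0 < k)
    (hP : ∀ j, (P.coeff j).degree < (k : WithBot ℕ)) :
    (P.eval (X ^ k)).coeffSet ⊆ ⋃ j, (P.coeff j).coeffSet := by
  rintro _ ⟨m, rfl⟩
  rw [← Nat.div_add_mod m k, coeff_eval_X_pow hP _ _ (Nat.mod_lt _ hk)]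
  exact Set.mem_iUnion.2 ⟨m / k, coeff_mem_coeffSet _ _⟩

/-- The polynomial of degree less than `n` with the coefficients `f i`. -/
noncomputable def ofCoeffs (n : ℕ) (f : ℕ → B) : B[X] := ∑ i ∈ Finset.range n, monomial i (f i)

theorem coeff_ofCoeffs (n : ℕ) (f : ℕ → B) (i : ℕ) :
    (ofCoeffs n f).coeff i = if i < n then f i else 0 := by
  simp only [ofCoeffs, finsetSum_coeff, coeff_monomial, Finset.sum_ite_eq', Finset.mem_range]

theorem degree_ofCoeffs_lt (n : ℕ) (f : ℕ → B) : (ofCoeffs n f).degree < n := by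
  rw [degree_lt_iff_coeff_zero]
  intro m hm
  rw [coeff_ofCoeffs, if_neg (by omega)]

end Kronecker

namespace CostModel

variable {F B : Type*} [Field F] [CommRing B] [Algebra F B] (𝓜 : CostModel F B)

/-- The coefficients of the representatives modulo `t` of the elements of a set. -/
def repSet {t : B[X]} (ht : t.Monic) (S : Set (AdjoinRoot t)) : Set B :=
  ⋃ b ∈ S, (AdjoinRoot.modByMonicHom ht b).coeffSet

theorem mem_repSet {t : B[X]} {ht : t.Monic} {S : Set (AdjoinRoot t)} {b : AdjoinRoot t}
    (hb : b ∈ S) (i : ℕ) : (AdjoinRoot.modByMonicHom ht b).coeff i ∈ repSet ht S :=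
  Set.mem_biUnion hb (coeff_mem_coeffSet _ _)

theorem repSet_mono {t : B[X]} {ht : t.Monic} {S U : Set (AdjoinRoot t)} (h : S ⊆ U) :
    repSet ht S ⊆ repSet ht U := Set.biUnion_mono h fun _ _ => subset_rfl

theorem repSet_union {t : B[X]} {ht : t.Monic} (S U : Set (AdjoinRoot t)) :
    repSet ht (S ∪ U) = repSet ht S ∪ repSet ht U := Set.biUnion_union _ _ _

theorem repSet_singleton {t : B[X]} {ht : t.Monic} (b : AdjoinRoot t) :
    repSet ht {b} = (AdjoinRoot.modByMonicHom ht b).coeffSet := Set.biUnion_singleton _ _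

theorem degree_modByMonicHom_lt [Nontrivial B] {t : B[X]} {d : ℕ} (ht : t.Monic)
    (hd : t.natDegree = d) (b : AdjoinRoot t) :
    (AdjoinRoot.modByMonicHom ht b).degree < (d : WithBot ℕ) := by
  obtain ⟨p, rfl⟩ := AdjoinRoot.mk_surjective b
  rw [AdjoinRoot.modByMonicHom_mk, ← hd, ← degree_eq_natDegree ht.ne_zero]
  exact degree_modByMonic_lt _ ht

theorem modByMonicHom_algebraMap [Nontrivial B] {t : B[X]} (ht : t.Monic)
    (hd0 : 0 < t.natDegree) (c : F) :
    AdjoinRoot.modByMonicHom ht (algebraMap F (AdjoinRoot t) c) = C (algebraMap F B c) := by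
  have : algebraMap F (AdjoinRoot t) c = AdjoinRoot.mk t (C (algebraMap F B c)) := by
    rw [IsScalarTower.algebraMap_apply F B (AdjoinRoot t)]; rfl
  rw [this, AdjoinRoot.modByMonicHom_mk, (modByMonic_eq_self_iff ht).2]
  exact degree_C_le.trans_lt (by rw [degree_eq_natDegree ht.ne_zero]; exact_mod_cast hd0)

/-- Representatives have degree less than `d`, so the coefficients of a product of lifts have degree
less than `2 * d`, and substituting `X ^ (2 * d)` for the outer variable keeps them apart. The
product of the substituted polynomials costs `13`, the `2 * n` reductions modulo `t` cost `2 * 32`: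
in all `77`. -/
theorem reach_mul_adjoin [Nontrivial B] {t w : B[X]} {d : ℕ} (ht : t.Monic)
    (hd : t.natDegree = d) (hd0 : 0 < d) (h : IsReciprocal t w d) {n : ℕ}
    {p q : (AdjoinRoot t)[X]} (hp : p.degree < n) (hq : q.degree < n) :
    𝓜.Reach (t.coeffSet ∪ w.coeffSet ∪ repSet ht (p.coeffSet ∪ q.coeffSet))
      (77 * 𝓜.mulCost (d * n)) (repSet ht (p * q).coeffSet) := by
  set lift : (AdjoinRoot t)[X] → B[X][X] := fun p =>
    ofCoeffs n fun i => AdjoinRoot.modByMonicHom ht (p.coeff i) with hlift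
  have lift_coeff : ∀ p : (AdjoinRoot t)[X], p.degree < n → ∀ j,
      (lift p).coeff j = AdjoinRoot.modByMonicHom ht (p.coeff j) := by
    intro p hp j
    rw [hlift, coeff_ofCoeffs]
    split_ifs with hj
    · rfl
    · rw [(degree_lt_iff_coeff_zero _ _).1 hp j (by simpa using hj), map_zero]
  have lift_degree : ∀ p : (AdjoinRoot t)[X], p.degree < n → (lift p).degree < n :=
    fun p _ => degree_ofCoeffs_lt _ _
  have lift_map : ∀ p : (AdjoinRoot t)[X], p.degree < n → (lift p).map (AdjoinRoot.mk t) = p := by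
    intro p hp
    ext j
    rw [coeff_map, lift_coeff p hp]
    exact AdjoinRoot.mk_leftInverse ht _
  have lift_coeff_degree : ∀ p : (AdjoinRoot t)[X], p.degree < n → ∀ j,
      ((lift p).coeff j).degree < (d : WithBot ℕ) := by
    intro p hp j
    rw [lift_coeff p hp]
    exact degree_modByMonicHom_lt ht hd _
  have hk : 0 < 2 * d := by omega
  have lcd : ∀ p : (AdjoinRoot t)[X], p.degree < n → ∀ j,
      ((lift p).coeff j).degree < ((2 * d : ℕ) : WithBot ℕ) := fun p hp j =>
    degree_lt_of_degree_lt_of_le (lift_coeff_degree p hp j) (by omega)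
  have sub : ∀ p : (AdjoinRoot t)[X], p.degree < n →
      ((lift p).eval (X ^ (2 * d))).coeffSet ⊆ repSet ht p.coeffSet := by
    intro p hp
    refine (coeffSet_eval_X_pow hk (lcd p hp)).trans (Set.iUnion_subset fun j => ?_)
    rw [lift_coeff p hp]
    rintro _ ⟨i, rfl⟩
    exact mem_repSet (coeff_mem_coeffSet _ _) i
  have e1 : 𝓜.Reach (t.coeffSet ∪ w.coeffSet ∪ repSet ht (p.coeffSet ∪ q.coeffSet))
      (13 * 𝓜.mulCost (d * n)) ((lift p * lift q).eval (X ^ (2 * d))).coeffSet := by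
    rw [eval_mul]
    refine reach_mul_two ?_ ?_ ?_ ?_
    · rw [← mul_assoc]; exact degree_eval_X_pow_lt hk (lcd p hp) (lift_degree p hp)
    · rw [← mul_assoc]; exact degree_eval_X_pow_lt hk (lcd q hq) (lift_degree q hq)
    · intro x hx
      exact Or.inl (Or.inr (repSet_mono Set.subset_union_left (sub p hp hx)))
    · intro x hx
      exact Or.inl (Or.inr (repSet_mono Set.subset_union_right (sub q hq hx)))
  have dpq : ∀ j, ((lift p * lift q).coeff j).degree < ((2 * d : ℕ) : WithBot ℕ) := by
    intro j
    rw [coeff_mul, two_mul]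
    refine (degree_lt_iff_coeff_zero _ _).2 fun m hm => ?_
    rw [finsetSum_coeff]
    refine Finset.sum_eq_zero fun x _ => (degree_lt_iff_coeff_zero _ _).1 ?_ m hm
    exact degree_mul_lt_of_lt (lift_coeff_degree p hp _)
      (degree_lt_of_degree_lt_of_le (lift_coeff_degree q hq _) (Nat.le_succ _))
  have hrep : ∀ j, AdjoinRoot.modByMonicHom ht ((p * q).coeff j) =
      (lift p * lift q).coeff j %ₘ t := by
    intro j
    rw [← AdjoinRoot.modByMonicHom_mk ht, ← coeff_map, Polynomial.map_mul, lift_map p hp,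
      lift_map q hq]
  set S := t.coeffSet ∪ w.coeffSet ∪ repSet ht (p.coeffSet ∪ q.coeffSet)
  have e2 : 𝓜.Reach (S ∪ ((lift p * lift q).eval (X ^ (2 * d))).coeffSet)
      (∑ j ∈ Finset.range (2 * n), 32 * 𝓜.mulCost d)
      (⋃ j ∈ Finset.range (2 * n), ((lift p * lift q).coeff j %ₘ t).coeffSet) := by
    refine Reach.biUnion _ fun j _ => ?_
    refine reach_modByMonic_of_lt_two_mul ht hd hd0 h (by rw [← two_mul]; exact dpq j) ?_
      (fun x hx => Or.inl (Or.inl (Or.inl hx))) (fun x hx => Or.inl (Or.inl (Or.inr hx)))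
    rintro _ ⟨i, rfl⟩
    rcases Nat.lt_or_ge i (2 * d) with hi | hi
    · rw [← coeff_eval_X_pow dpq j i hi]
      exact Or.inl (Or.inr (coeff_mem_coeffSet _ _))
    · rw [(degree_lt_iff_coeff_zero _ _).1 (dpq j) i hi]
      exact Or.inr zero_mem_consts
  have e3 : 𝓜.Reach S 0 {(0 : B)} :=
    reach_of_subset (by simp)
  refine (((e1.trans e2).union e3).subset_right ?_).cost_le ?_
  · refine Set.iUnion₂_subset ?_
    rintro _ ⟨j, rfl⟩ _ ⟨i, rfl⟩
    by_cases hj : j < 2 * n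
    · rw [hrep]
      exact Or.inl (Set.mem_biUnion (x := j) (by simpa using hj) (coeff_mem_coeffSet _ _))
    · have : (p * q).degree < ((n + n : ℕ) : WithBot ℕ) := degree_mul_lt_of_lt hp
        (degree_lt_of_degree_lt_of_le hq (Nat.le_succ _))
      rw [(degree_lt_iff_coeff_zero _ _).1 this j (by omega), map_zero]
      exact Or.inr rfl
  · have := 𝓜.mul_mulCost_le n d
    rw [mul_comm n d] at this
    rw [Finset.sum_const, Finset.card_range, smul_eq_mul]
    have h2 : 2 * n * (32 * 𝓜.mulCost d) = 64 * (n * 𝓜.mulCost d) := by ring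
    omega

/-- The cost model on `B[X] / t`: elements are given by the coefficients of their representatives
of degree less than `d`, and the coefficients of `t` and of its reciprocal are available. -/
def adjoin [Nontrivial B] {t w : B[X]} {d : ℕ} (ht : t.Monic) (hd : t.natDegree = d) (hd0 : 0 < d)
    (h : IsReciprocal t w d) : CostModel F (AdjoinRoot t) where
  Reach S k U := 𝓜.Reach (t.coeffSet ∪ w.coeffSet ∪ repSet ht S) k (repSet ht U)
  unit := d * 𝓜.unit
  mulCost n := 77 * 𝓜.mulCost (d * n)
  mono h hS hk hU := 𝓜.mono h (Set.union_subset_union_right _ (repSet_mono hS)) hk (repSet_mono hU)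
  trans h h' := by
    rw [repSet_union, ← Set.union_assoc] at h'
    rw [repSet_union, repSet_union]
    exact (𝓜.trans h h').subset_right
      (Set.union_subset_union_left _ (Set.union_subset_union_left _ Set.subset_union_right))
  free S := by
    rw [repSet_union]
    refine reach_of_subset (Set.union_subset (fun x hx => Or.inl (Or.inr hx)) ?_)
    refine Set.iUnion₂_subset ?_
    rintro _ ⟨c, rfl⟩ _ ⟨i, rfl⟩
    rw [modByMonicHom_algebraMap ht (hd ▸ hd0), coeff_C]
    split_ifs
    exacts [Or.inr ⟨c, rfl⟩, Or.inr zero_mem_consts]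
  add a b := by
    rw [repSet_singleton, map_add, mul_comm]
    refine reach_add (degree_modByMonicHom_lt ht hd a) (degree_modByMonicHom_lt ht hd b) ?_ ?_
    · rintro _ ⟨i, rfl⟩
      exact Or.inl (Or.inr (mem_repSet (by simp) i))
    · rintro _ ⟨i, rfl⟩
      exact Or.inl (Or.inr (mem_repSet (by simp) i))
  smul c a := by
    have h1 : AdjoinRoot.modByMonicHom ht (c • a) =
        C (algebraMap F B c) * AdjoinRoot.modByMonicHom ht a := by
      rw [← smul_eq_C_mul, ← map_smul, algebraMap_smul]
    rw [repSet_singleton, repSet_singleton]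
    refine reach_coeffSet_of_le (degree_modByMonicHom_lt ht hd _) fun i _ => ?_
    rw [h1, coeff_C_mul, ← Algebra.smul_def]
    refine (𝓜.smul _ _).subset_left ?_
    rintro _ rfl
    exact Or.inr (coeff_mem_coeffSet _ _)
  mul n p q hp hq := 𝓜.reach_mul_adjoin ht hd hd0 h hp hq
  unit_mul_le n := by
    have := 𝓜.unit_mul_le (d * n)
    have h2 : d * 𝓜.unit * n = 𝓜.unit * (d * n) := by ring
    omega
  superadditive m n := by
    have := 𝓜.superadditive (d * m) (d * n)
    rw [← mul_add] at this
    omega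

/-! ### Taylor shift -/

variable {𝓜} {S : Set B}

/-- Each power is the previous one times `a`, a product of constant polynomials. By superadditivity
the total stays below `mulCost N`. -/
theorem reach_pow (a : B) (haS : a ∈ S) (N : ℕ) :
    𝓜.Reach S (N * 𝓜.mulCost 1) ((fun i => a ^ i) '' Set.Iio N) := by
  induction N with
  | zero => exact reach_of_subset (by simp)
  | succ N ih =>
    have h : 𝓜.Reach (S ∪ (fun i => a ^ i) '' Set.Iio N) (𝓜.mulCost 1) {a ^ N} := by
      rcases N with _ | N
      · exact reach_of_subset (by simpa using Or.inr one_mem_consts)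
      · have hC : ∀ b : B, (C b).degree < ((1 : ℕ) : WithBot ℕ) := fun b =>
          degree_C_le.trans_lt (by norm_num)
        have hCS : ∀ b ∈ S ∪ (fun i => a ^ i) '' Set.Iio (N + 1), (C b).coeffSet ⊆
            S ∪ (fun i => a ^ i) '' Set.Iio (N + 1) ∪ Set.range (algebraMap F B) := by
          rintro b hb _ ⟨i, rfl⟩
          rw [coeff_C]
          split_ifs
          exacts [Or.inl hb, Or.inr zero_mem_consts]
        refine (reach_mul (hC a) (hC (a ^ N)) (hCS _ (Or.inl haS))
          (hCS _ (Or.inr ⟨N, Nat.lt_succ_self N, rfl⟩))).subset_right ?_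
        rintro _ rfl
        exact ⟨0, by rw [← C_mul, coeff_C_zero, pow_succ']⟩
    refine ((CostModel.trans 𝓜 ih h).subset_right ?_).cost_le (le_of_eq (by ring))
    rintro _ ⟨i, hi, rfl⟩
    rcases Nat.lt_succ_iff_lt_or_eq.1 hi with h | rfl
    · exact Or.inl (Or.inr ⟨i, h, rfl⟩)
    · exact Or.inr rfl

/-- As `choose (v + k) k = (v + k)! / (k! v!)`, the sum for the coefficient of index `k` correlates
the sequences `j! p_j` and `a ^ v / v!`. Reversing the first sequence turns the correlation into a
product, read at the index `N - 1 - k`. -/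
theorem coeff_taylor_eq {N : ℕ} (hN : ∀ i < N, (i.factorial : F) ≠ 0)
    {p : B[X]} (hp : p.degree < N) (a : B) (k : ℕ) (hk : k < N) :
    (taylor a p).coeff k = (k.factorial : F)⁻¹ •
      (ofCoeffs N (fun u => ((N - 1 - u).factorial : F) • p.coeff (N - 1 - u)) *
        ofCoeffs N (fun v => (v.factorial : F)⁻¹ • a ^ v)).coeff (N - 1 - k) := by
  rw [taylor_coeff, coeff_mul, Finset.Nat.sum_antidiagonal_eq_sum_range_succ_mk,
    ← Finset.sum_range_reflect, eval_eq_sum_range' (n := N - k), Finset.smul_sum]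
  · rw [show (N - 1 - k).succ = N - k by omega]
    refine Finset.sum_congr rfl fun v hv => ?_
    rw [Finset.mem_range] at hv
    rw [hasseDeriv_coeff, coeff_ofCoeffs, coeff_ofCoeffs, if_pos (by omega), if_pos (by omega),
      show N - 1 - (N - k - 1 - v) = v + k by omega, show N - 1 - k - (N - k - 1 - v) = v by omega]
    have h1 : (((v + k).choose k : ℕ) : F) =
        (k.factorial : F)⁻¹ * ((v + k).factorial * (v.factorial : F)⁻¹) := by
      have h2 := Nat.add_choose_mul_factorial_mul_factorial v k
      rw [← h2, ← Nat.choose_symm_add]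
      have h3 := hN k hk
      have h4 := hN v (by omega)
      push_cast
      field_simp
    have h5 : (((v + k).choose k : ℕ) : B) = algebraMap F B (((v + k).choose k : ℕ) : F) := by simp
    rw [h5, h1]
    simp only [Algebra.smul_def, map_mul]
    ring
  · refine Nat.lt_of_le_of_lt (m := N - k - 1) (natDegree_le_iff_coeff_eq_zero.2 fun m hm => ?_)
      (by omega)
    rw [hasseDeriv_coeff, (degree_lt_iff_coeff_zero _ _).1 hp _ (by omega), mul_zero]

/-- Three scalings by factorials or their inverses, the powers of `a` and one product, each costing
at most `mulCost N`. -/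
theorem reach_taylor {N : ℕ} (hN : ∀ i < N, (i.factorial : F) ≠ 0) {p : B[X]} (hp : p.degree < N)
    (hpS : p.coeffSet ⊆ S ∪ Set.range (algebraMap F B)) {a : B} (haS : a ∈ S) :
    𝓜.Reach S (5 * 𝓜.mulCost N) (taylor a p).coeffSet := by
  set P := ofCoeffs N (fun u => ((N - 1 - u).factorial : F) • p.coeff (N - 1 - u)) with hP
  set Q := ofCoeffs N (fun v => (v.factorial : F)⁻¹ • a ^ v) with hQ
  have e1 : 𝓜.Reach S (N * 𝓜.unit) P.coeffSet := by
    refine reach_coeffSet_of_le (degree_ofCoeffs_lt _ _) fun i hi => ?_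
    rw [hP, coeff_ofCoeffs, if_pos hi]
    exact ((𝓜.smul _ _).subset_left
      (Set.singleton_subset_iff.2 (hpS (coeff_mem_coeffSet _ _)))).of_known
  have e2 := reach_pow (𝓜 := 𝓜) (S := S ∪ P.coeffSet) a (Or.inl haS) N
  have e3 : 𝓜.Reach (S ∪ P.coeffSet ∪ (fun i => a ^ i) '' Set.Iio N) (N * 𝓜.unit) Q.coeffSet := by
    refine reach_coeffSet_of_le (degree_ofCoeffs_lt _ _) fun i hi => ?_
    rw [hQ, coeff_ofCoeffs, if_pos hi]
    exact (𝓜.smul _ _).subset_left (Set.singleton_subset_iff.2 (Or.inr ⟨i, hi, rfl⟩))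
  have e4 : 𝓜.Reach (S ∪ P.coeffSet ∪ (fun i => a ^ i) '' Set.Iio N ∪ Q.coeffSet)
      (𝓜.mulCost N) (P * Q).coeffSet :=
    reach_mul (degree_ofCoeffs_lt _ _) (degree_ofCoeffs_lt _ _)
      (fun x hx => Or.inl (Or.inl (Or.inl (Or.inr hx)))) (fun x hx => Or.inl (Or.inr hx))
  have e5 : 𝓜.Reach (S ∪ P.coeffSet ∪ (fun i => a ^ i) '' Set.Iio N ∪ Q.coeffSet ∪
      (P * Q).coeffSet) (N * 𝓜.unit) (taylor a p).coeffSet := by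
    refine reach_coeffSet_of_le (by rwa [degree_taylor]) fun i hi => ?_
    rw [coeff_taylor_eq hN hp a i hi]
    exact (𝓜.smul _ _).subset_left (Set.singleton_subset_iff.2 (Or.inr (coeff_mem_coeffSet _ _)))
  refine (e1.trans (e2.trans (e3.trans (e4.trans e5)))).cost_le ?_
  have h1 := 𝓜.unit_mul_le N
  have h2 := 𝓜.mul_mulCost_le N 1
  rw [mul_one] at h2
  rw [mul_comm] at h1
  omega

end CostModel

end Polynomial

/-! ### Straight-line programs and families of values -/

/-- The families `U` of values can be computed from the families `S` in `k` operations, all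
operations being defined for all parameters. -/
inductive PointwiseReach {F Ω : Type*} [Field F] : Set (Ω → F) → ℕ → Set (Ω → F) → Prop
  | done {S U : Set (Ω → F)} {k : ℕ} (h : U ⊆ S ∪ Set.range (algebraMap F (Ω → F))) :
      PointwiseReach S k U
  | step {S U : Set (Ω → F)} {k : ℕ} (op : ArithOp) (a b c : Ω → F)
      (ha : a ∈ S ∪ Set.range (algebraMap F (Ω → F)))
      (hb : b ∈ S ∪ Set.range (algebraMap F (Ω → F)))
      (h : ∀ ω, op.eval (a ω) (b ω) = some (c ω))
      (next : PointwiseReach (insert c S) k U) : PointwiseReach S (k + 1) U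

namespace PointwiseReach

variable {F Ω : Type*} [Field F] {S S' U U' V : Set (Ω → F)} {k k' l : ℕ}

theorem mono (h : PointwiseReach S k U) (hS : S ⊆ S' ∪ Set.range (algebraMap F (Ω → F)))
    (hk : k ≤ k') (hU : U' ⊆ U) : PointwiseReach S' k' U' := by
  induction h generalizing S' k' with
  | done h =>
    refine done fun x hx => ?_
    rcases h (hU hx) with h | h
    exacts [hS h, Or.inr h]
  | step op a b c ha hb h _ ih =>
    obtain ⟨k', rfl⟩ := Nat.exists_eq_add_of_le' (Nat.one_le_of_lt hk)
    refine step op a b c ?_ ?_ h (ih ?_ (by omega) hU)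
    · exact ha.elim (fun h => hS h) Or.inr
    · exact hb.elim (fun h => hS h) Or.inr
    · rintro x (rfl | hx)
      · exact Or.inl (Or.inl rfl)
      · exact (hS hx).imp Or.inr id

theorem union_self (h : PointwiseReach S k U) : PointwiseReach S k (S ∪ U) := by
  induction h with
  | done h => exact done (Set.union_subset Set.subset_union_left h)
  | step op a b c ha hb h _ ih =>
    exact step op a b c ha hb h (ih.mono Set.subset_union_left le_rfl
      (Set.union_subset_union_left _ (Set.subset_insert _ _)))

theorem trans (h : PointwiseReach S k U) (h' : PointwiseReach (S ∪ U) l V) :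
    PointwiseReach S (k + l) (S ∪ U ∪ V) := by
  induction h with
  | done h =>
    exact h'.union_self.mono (Set.union_subset Set.subset_union_left h) (Nat.le_add_left _ _)
      subset_rfl
  | step op a b c ha hb h _ ih =>
    rw [Nat.add_right_comm]
    refine step op a b c ha hb h ((ih (h'.mono ?_ le_rfl subset_rfl)).mono
      Set.subset_union_left le_rfl ?_)
    · intro x hx
      exact Or.inl (hx.imp Or.inr id)
    · exact Set.union_subset_union_left _ (Set.union_subset_union_left _ (Set.subset_insert _ _))

theorem of_eval (op : ArithOp) (a b c : Ω → F) (ha : a ∈ S ∪ Set.range (algebraMap F (Ω → F)))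
    (hb : b ∈ S ∪ Set.range (algebraMap F (Ω → F))) (h : ∀ ω, op.eval (a ω) (b ω) = some (c ω)) :
    PointwiseReach S 1 {c} :=
  step op a b c ha hb h (done (by rintro x rfl; exact Or.inl (Or.inl rfl)))

theorem val_mem {ι : Type*} (x : Ω → ι → F) (r : List (Ω → F)) (o : Operand F ι) :
    (fun ω => o.val (x ω) (r.map fun u => u ω)) ∈
      (Set.range fun i ω => x ω i) ∪ {u | u ∈ r} ∪ Set.range (algebraMap F (Ω → F)) := by
  rcases o with i | c | k
  · exact Or.inl (Or.inl ⟨i, rfl⟩)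
  · exact Or.inr ⟨c, rfl⟩
  · by_cases hk : k < r.length
    · refine Or.inl (Or.inr ?_)
      have : (fun ω => (Operand.result k : Operand F ι).val (x ω) (r.map fun u => u ω)) = r[k] := by
        ext ω
        simp [Operand.val, List.getD_eq_getElem?_getD, hk]
      rw [this]
      exact List.getElem_mem hk
    · refine Or.inr ⟨0, ?_⟩
      ext ω
      simp [Operand.val, List.getD_eq_getElem?_getD, hk]

/-- Running the code for all parameters at once, the list of results becomes a list of functions,
and each instruction is one `step`. -/
theorem of_runInstructions {ι : Type*} (x : Ω → ι → F) (code : List (Instruction F ι))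
    (r : List (Ω → F)) (y : Ω → List F)
    (h : ∀ ω, runInstructions (x ω) code (r.map fun u => u ω) = some (y ω)) :
    PointwiseReach ((Set.range fun i ω => x ω i) ∪ {u | u ∈ r}) code.length
      (Set.range fun (o : Operand F ι) ω => o.val (x ω) (y ω)) := by
  induction code generalizing r with
  | nil =>
    refine done ?_
    rintro _ ⟨o, rfl⟩
    have hy : ∀ ω, y ω = r.map fun u => u ω := fun ω => by simpa [runInstructions] using (h ω).symm
    simp only [hy]
    exact val_mem x r o
  | cons s code ih =>
    have h1 : ∀ ω, ∃ v, s.op.eval (s.left.val (x ω) (r.map fun u => u ω))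
        (s.right.val (x ω) (r.map fun u => u ω)) = some v ∧
        runInstructions (x ω) code ((r.map fun u => u ω) ++ [v]) = some (y ω) := by
      intro ω
      simpa [runInstructions, Option.bind_eq_some_iff] using h ω
    choose c hc hrun using h1
    refine step s.op _ _ c (val_mem x r s.left) (val_mem x r s.right) hc
      ((ih (r ++ [c]) fun ω => ?_).mono ?_ le_rfl subset_rfl)
    · simpa using hrun ω
    · rintro u (hu | hu)
      · exact Or.inl (Or.inr (Or.inl hu))
      · rcases List.mem_append.1 hu with hu | hu
        · exact Or.inl (Or.inr (Or.inr hu))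
        · exact Or.inl (Or.inl (by simpa using hu))

theorem exists_operand {ι : Type*} (x : Ω → ι → F) (r : List (Ω → F)) {a : Ω → F}
    (ha : a ∈ (Set.range fun i ω => x ω i) ∪ {u | u ∈ r} ∪ Set.range (algebraMap F (Ω → F))) :
    ∃ o : Operand F ι, ∀ ω, o.val (x ω) (r.map fun u => u ω) = a ω := by
  rcases ha with (⟨i, rfl⟩ | ha) | ⟨c, rfl⟩
  · exact ⟨.input i, fun ω => rfl⟩
  · obtain ⟨k, hk, rfl⟩ := List.getElem_of_mem ha
    exact ⟨.result k, fun ω => by simp [Operand.val, List.getD_eq_getElem?_getD, hk]⟩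
  · exact ⟨.const c, fun ω => rfl⟩

/-- Conversely a derivation is read as a list of instructions. Its steps name functions and not
values, so a single code serves all parameters. -/
theorem exists_code {ι : Type*} (x : Ω → ι → F) (h : PointwiseReach S k U) (r : List (Ω → F))
    (hS : S ⊆ (Set.range fun i ω => x ω i) ∪ {u | u ∈ r}) :
    ∃ (code : List (Instruction F ι)) (y : Ω → List F), code.length ≤ k ∧
      (∀ ω, runInstructions (x ω) code (r.map fun u => u ω) = some (y ω)) ∧
      ∀ u ∈ U, ∃ o : Operand F ι, ∀ ω, o.val (x ω) (y ω) = u ω := by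
  induction h generalizing r with
  | done h =>
    refine ⟨[], fun ω => r.map fun u => u ω, Nat.zero_le _, fun ω => rfl, fun u hu => ?_⟩
    exact exists_operand x r ((h hu).imp (fun h => hS h) id)
  | step op a b c ha hb h _ ih =>
    obtain ⟨oa, hoa⟩ := exists_operand x r (ha.imp (fun h => hS h) id)
    obtain ⟨ob, hob⟩ := exists_operand x r (hb.imp (fun h => hS h) id)
    obtain ⟨code, y, hlen, hrun, hout⟩ := ih (r ++ [c]) (by
      rintro u (rfl | hu)
      · exact Or.inr (by simp)
      · exact (hS hu).imp id fun h => List.mem_append_left _ h)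
    refine ⟨⟨op, oa, ob⟩ :: code, y, by simpa using hlen, fun ω => ?_, hout⟩
    have := hrun ω
    simp only [runInstructions, hoa, hob, h ω, Option.bind_some]
    simpa using this

/-- Families that can be reached from the inputs are the outputs of a program. -/
theorem exists_program {ι o : Type*} {x : Ω → ι → F}
    (h : PointwiseReach (Set.range fun i ω => x ω i) k U) (y : o → Ω → F)
    (hy : ∀ j, y j ∈ U) :
    ∃ P : StraightLineProgram F ι o, P.cost ≤ k ∧ ∀ ω, P.Computes (x ω) fun j => y j ω := by
  obtain ⟨code, z, hlen, hrun, hout⟩ := exists_code x h [] Set.subset_union_left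
  choose out hout using fun j => hout (y j) (hy j)
  exact ⟨⟨code, out⟩, hlen, fun ω => ⟨z ω, hrun ω, fun j => hout j ω⟩⟩

/-- This brings the given multiplication programs into the cost model. -/
theorem of_program {ι o : Type*} {x : Ω → ι → F} {y : o → Ω → F} (P : StraightLineProgram F ι o)
    (hP : ∀ ω, P.Computes (x ω) fun j => y j ω) :
    PointwiseReach (Set.range fun i ω => x ω i) P.cost (Set.range y) := by
  choose r hr hout using hP
  refine (of_runInstructions x P.code [] r hr).mono (by simp) le_rfl ?_
  rintro _ ⟨j, rfl⟩
  exact ⟨P.out j, funext fun ω => hout ω j⟩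

end PointwiseReach

open Polynomial in
/-- The cost model given by straight-line programs. -/
def Polynomial.CostModel.pointwise {F : Type*} [Field F] {M : ℕ → ℕ} (hM : IsMultiplicationTime F M)
    (Ω : Type*) : CostModel F (Ω → F) where
  Reach := PointwiseReach
  unit := 1
  -- `M 0` may be positive, and `M` is superadditive at positive arguments only; the value `0` at
  -- `0` makes superadditivity hold everywhere.
  mulCost n := if n = 0 then 0 else M n
  mono h hS hk hU := h.mono (hS.trans Set.subset_union_left) hk hU
  trans h h' := h.trans h'
  free S := .done subset_rfl
  add a b := .of_eval .add a b _ (by simp) (by simp) fun ω => rfl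
  smul c a := .of_eval .mul (algebraMap F (Ω → F) c) a _ (Or.inr ⟨c, rfl⟩) (by simp) fun ω => rfl
  mul n p q hp hq := by
    rcases Nat.eq_zero_or_pos n with rfl | hn
    · refine .done ?_
      rintro _ ⟨i, rfl⟩
      have : p = 0 := by simpa using hp
      exact Or.inr ⟨0, by simp [this]⟩
    rw [if_neg hn.ne']
    obtain ⟨P, hP, hP'⟩ := hM.exists_program n
    have h1 : ∀ (p : (Ω → F)[X]) (ω : Ω) (i : ℕ),
        (p.map (Pi.evalRingHom (fun _ => F) ω)).coeff i = p.coeff i ω := fun p ω i => by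
      rw [Polynomial.coeff_map]; rfl
    have h2 : ∀ (p : (Ω → F)[X]) (ω : Ω), p.degree < n →
        (p.map (Pi.evalRingHom (fun _ => F) ω)).degree < n := fun p ω hp =>
      Polynomial.degree_map_le.trans_lt hp
    refine (PointwiseReach.of_program (x := fun ω (i : Fin 2 × ℕ) => (![p, q] i.1).coeff i.2 ω)
      (y := fun k ω => (p * q).coeff k ω) P fun ω => ?_).mono ?_ hP ?_
    · convert hP' _ _ (h2 p ω hp) (h2 q ω hq) using 1
      · funext ⟨i, k⟩
        fin_cases i
        · exact (h1 p ω k).symm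
        · exact (h1 q ω k).symm
      · funext k
        rw [← Polynomial.map_mul, h1]
    · rintro _ ⟨⟨i, k⟩, rfl⟩
      fin_cases i
      · exact Or.inl (Or.inl ⟨k, rfl⟩)
      · exact Or.inl (Or.inr ⟨k, rfl⟩)
    · rintro _ ⟨k, rfl⟩
      exact ⟨k, rfl⟩
  unit_mul_le n := by
    split_ifs with h
    · simp [h]
    · simpa using hM.self_le n
  superadditive m n := by
    rcases Nat.eq_zero_or_pos m with rfl | hm
    · simp
    rcases Nat.eq_zero_or_pos n with rfl | hn
    · simp
    rw [if_neg hm.ne', if_neg hn.ne', if_neg (by omega)]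
    exact hM.superadditive m n hm hn

namespace Polynomial

/-! ### Evaluation of divided derivatives -/

section EvalDeriv

variable {A : Type*} [CommRing A]

/-- The value at `(x, y)` of the divided derivative of order `(k, l)` of the polynomial with
coefficients `f a b`, for `b < H` and `a < ℓ b`. -/
def evalDeriv (H : ℕ) (ℓ : ℕ → ℕ) (f : ℕ → ℕ → A) (k l : ℕ) (x y : A) : A :=
  ∑ b ∈ Finset.range H, (b.choose l : A) *
    (∑ a ∈ Finset.range (ℓ b), (a.choose k : A) * f a b * x ^ (a - k)) * y ^ (b - l)

theorem map_evalDeriv {A' : Type*} [CommRing A'] (φ : A →+* A') (H : ℕ) (ℓ : ℕ → ℕ)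
    (f : ℕ → ℕ → A) (k l : ℕ) (x y : A) :
    φ (evalDeriv H ℓ f k l x y) = evalDeriv H ℓ (fun a b => φ (f a b)) k l (φ x) (φ y) := by
  simp [evalDeriv]

theorem hasseDeriv_ofCoeffs (n k : ℕ) (f : ℕ → A) :
    hasseDeriv k (ofCoeffs n f) =
      ∑ a ∈ Finset.range n, monomial (a - k) ((a.choose k : A) * f a) := by
  simp [ofCoeffs, hasseDeriv_monomial]

theorem eval_hasseDeriv_ofCoeffs (n k : ℕ) (f : ℕ → A) (x : A) :
    (hasseDeriv k (ofCoeffs n f)).eval x =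
      ∑ a ∈ Finset.range n, (a.choose k : A) * f a * x ^ (a - k) := by
  simp [hasseDeriv_ofCoeffs, eval_finsetSum, eval_monomial]

theorem mk_hasseDeriv_ofCoeffs (t : A[X]) (n k : ℕ) (f : ℕ → A) :
    AdjoinRoot.mk t (hasseDeriv k (ofCoeffs n f)) =
      ∑ a ∈ Finset.range n,
        (a.choose k : AdjoinRoot t) * AdjoinRoot.of t (f a) * AdjoinRoot.root t ^ (a - k) := by
  rw [hasseDeriv_ofCoeffs, map_sum]
  refine Finset.sum_congr rfl fun a _ => ?_
  rw [← C_mul_X_pow_eq_monomial, map_mul, map_pow, AdjoinRoot.mk_X, AdjoinRoot.mk_C, map_mul,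
    map_natCast]

theorem degree_hasseDeriv_lt {p : A[X]} {n : ℕ} (k : ℕ) (hp : p.degree < n) :
    (hasseDeriv k p).degree < n := by
  rw [degree_lt_iff_coeff_zero] at *
  intro m hm
  rw [hasseDeriv_coeff, hp _ (by omega), mul_zero]

theorem nontrivial_adjoinRoot [Nontrivial A] {t : A[X]} (ht : t.Monic) (hd : 0 < t.natDegree) :
    Nontrivial (AdjoinRoot t) := by
  refine ⟨⟨AdjoinRoot.mk t 1, AdjoinRoot.mk t 0, fun h => ?_⟩⟩
  rw [AdjoinRoot.mk_eq_mk, sub_zero] at h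
  refine ht.not_dvd_of_degree_lt one_ne_zero ?_ h
  rw [degree_one, degree_eq_natDegree ht.ne_zero]
  exact_mod_cast hd

end EvalDeriv

/-! ### Cost of evaluating divided derivatives. -/

namespace CostModel

variable {F B : Type*} [Field F] [CommRing B] [Algebra F B] {𝓜 : CostModel F B} {S : Set B}

theorem reach_hasseDeriv {p : B[X]} {n : ℕ} (k : ℕ) (hp : p.degree < n)
    (hpS : p.coeffSet ⊆ S ∪ Set.range (algebraMap F B)) :
    𝓜.Reach S (n * 𝓜.unit) (hasseDeriv k p).coeffSet := by
  refine reach_coeffSet_of_le (degree_hasseDeriv_lt k hp) fun i _ => ?_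
  have : (hasseDeriv k p).coeff i = (((i + k).choose k : ℕ) : F) • p.coeff (i + k) := by
    rw [hasseDeriv_coeff, Algebra.smul_def, map_natCast]
  rw [this]
  exact ((𝓜.smul _ _).subset_left
    (Set.singleton_subset_iff.2 (hpS (coeff_mem_coeffSet _ _)))).of_known

theorem coeffSet_ofCoeffs_subset {n : ℕ} {f : ℕ → B}
    (h : ∀ i < n, f i ∈ S ∪ Set.range (algebraMap F B)) :
    (ofCoeffs n f).coeffSet ⊆ S ∪ Set.range (algebraMap F B) := by
  rintro _ ⟨i, rfl⟩
  rw [coeff_ofCoeffs]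
  split_ifs with hi
  exacts [h i hi, Or.inr zero_mem_consts]

/-- A dividend at least as long as the divisor absorbs the extra, incomplete block: its reduction
costs a constant number of products of its own length. This is why the rows must not be shorter than
the degree of `T₁`. -/
theorem blocks_mul_mulCost_le (𝓜 : CostModel F B) {d n : ℕ} (hd : 0 < d) (hn : d ≤ n) :
    (n / d + 1) * 𝓜.mulCost d ≤ 2 * 𝓜.mulCost n := by
  have h1 : 1 ≤ n / d := (Nat.one_le_div_iff hd).2 hn
  have h2 : n / d * 𝓜.mulCost d ≤ 𝓜.mulCost n :=
    (𝓜.mul_mulCost_le _ _).trans (𝓜.mulCost_mono (Nat.div_mul_le_self n d))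
  nlinarith

theorem lt_blocks {d n : ℕ} (hd : 0 < d) : n ≤ d * (n / d + 1) :=
  (Nat.lt_mul_div_succ n hd).le

theorem modByMonicHom_of [Nontrivial B] {t : B[X]} (ht : t.Monic) (hd0 : 0 < t.natDegree) (c : B) :
    AdjoinRoot.modByMonicHom ht (AdjoinRoot.of t c) = C c := by
  rw [← AdjoinRoot.mk_C, AdjoinRoot.modByMonicHom_mk, (modByMonic_eq_self_iff ht).2]
  exact degree_C_le.trans_lt (by rw [degree_eq_natDegree ht.ne_zero]; exact_mod_cast hd0)

theorem modByMonicHom_root {t : B[X]} (ht : t.Monic) :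
    AdjoinRoot.modByMonicHom ht (AdjoinRoot.root t) = X %ₘ t := by
  rw [← AdjoinRoot.mk_X, AdjoinRoot.modByMonicHom_mk]

/-- Taylor shifts of the rows and of the columns of a bivariate polynomial. -/
theorem reach_evalDeriv_range {H W : ℕ} {ℓ h : ℕ → ℕ}
    (hrow : ∀ b < H, ∀ i < ℓ b, (i.factorial : F) ≠ 0)
    (hcol : ∀ a < W, ∀ i < h a, (i.factorial : F) ≠ 0)
    (hW : ∀ a b, b < H → a < ℓ b → a < W ∧ b < h a)
    (hsum : ∑ a ∈ Finset.range W, h a = ∑ b ∈ Finset.range H, ℓ b)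
    {f : ℕ → ℕ → B} {x y : B} (hf : ∀ a b, f a b ∈ S) (hx : x ∈ S) (hy : y ∈ S) :
    𝓜.Reach S (10 * 𝓜.mulCost (∑ b ∈ Finset.range H, ℓ b))
      (Set.range fun e : ℕ × ℕ => evalDeriv H ℓ f e.1 e.2 x y) := by
  set T : ℕ → B[X] := fun b => taylor x (ofCoeffs (ℓ b) fun a => f a b) with hT
  have dT : ∀ b, (T b).degree < (ℓ b : WithBot ℕ) := fun b => by
    rw [hT, degree_taylor]; exact degree_ofCoeffs_lt _ _
  have cT : ∀ b k, (T b).coeff k =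
      ∑ a ∈ Finset.range (ℓ b), (a.choose k : B) * f a b * x ^ (a - k) := fun b k => by
    rw [hT, taylor_coeff, eval_hasseDeriv_ofCoeffs]
  have e1 : 𝓜.Reach S (∑ b ∈ Finset.range H, 5 * 𝓜.mulCost (ℓ b))
      (⋃ b ∈ Finset.range H, (T b).coeffSet) :=
    Reach.biUnion _ fun b hb => reach_taylor (hrow b (Finset.mem_range.1 hb))
      (degree_ofCoeffs_lt _ _) (coeffSet_ofCoeffs_subset fun i _ => Or.inl (hf i b)) hx
  -- Shifting does not lengthen a row, so the shifted rows still fill the same staircase and the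
  -- columns keep the heights `h a`.
  set col : ℕ → B[X] := fun a => ofCoeffs H fun b => (T b).coeff a with hcolDef
  have dcol : ∀ a b, ¬ (a < W ∧ b < h a) → (col a).coeff b = 0 := by
    intro a b hab
    rw [hcolDef, coeff_ofCoeffs]
    split_ifs with hb
    · refine (degree_lt_iff_coeff_zero _ _).1 (dT b) a ?_
      by_contra hlt
      exact hab (hW a b hb (by omega))
    · rfl
  have e2 : 𝓜.Reach (S ∪ ⋃ b ∈ Finset.range H, (T b).coeffSet)
      (∑ a ∈ Finset.range W, 5 * 𝓜.mulCost (h a))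
      (⋃ a ∈ Finset.range W, (taylor y (col a)).coeffSet) := by
    refine Reach.biUnion _ fun a ha => reach_taylor (hcol a (Finset.mem_range.1 ha))
      ((degree_lt_iff_coeff_zero _ _).2 fun m hm => dcol a m (by omega))
      (coeffSet_ofCoeffs_subset fun b hb => Or.inl (Or.inr ?_)) (Or.inl hy)
    exact Set.mem_biUnion (x := b) (by simpa using hb) (coeff_mem_coeffSet _ _)
  have e3 : 𝓜.Reach S 0 {(0 : B)} :=
    reach_of_subset (Set.singleton_subset_iff.2 (Or.inr zero_mem_consts))
  refine (((e1.trans e2).union e3).subset_right ?_).cost_le ?_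
  · rintro _ ⟨⟨k, l⟩, rfl⟩
    have hZ : evalDeriv H ℓ f k l x y = (taylor y (col k)).coeff l := by
      rw [taylor_coeff, hcolDef, eval_hasseDeriv_ofCoeffs]
      simp only [cT]
      rfl
    simp only
    rw [hZ]
    by_cases hk : k < W
    · exact Or.inl (Set.mem_biUnion (x := k) (by simpa using hk) (coeff_mem_coeffSet _ _))
    · have : col k = 0 := by
        ext b
        exact dcol k b (by omega)
      exact Or.inr (by simp [this])
  · rw [← Finset.mul_sum, ← Finset.mul_sum]
    have h1 := 𝓜.sum_mulCost_le (Finset.range H) ℓ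
    have h2 := 𝓜.sum_mulCost_le (Finset.range W) h
    rw [hsum] at h2
    omega

/-! ### Divided derivatives in a tower of two monic extensions. -/

section Tower

variable [Nontrivial B] {t₁ w₁ : B[X]} {d₁ : ℕ} (ht₁ : t₁.Monic) (hd₁ : t₁.natDegree = d₁)
  (hp₁ : 0 < d₁) (hw₁ : IsReciprocal t₁ w₁ d₁) [Nontrivial (AdjoinRoot t₁)]
  {t₂ w₂ : (AdjoinRoot t₁)[X]} {d₂ : ℕ} (ht₂ : t₂.Monic) (hd₂ : t₂.natDegree = d₂)
  (hp₂ : 0 < d₂) (hw₂ : IsReciprocal t₂ w₂ d₂)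

include hd₁ hp₁ hw₁ hd₂ hp₂ hw₂

/-- The value of a divided derivative at the residue classes of the variables is computed by
reducing first the rows and then the result. -/
theorem reach_evalDeriv {H : ℕ} {ℓ : ℕ → ℕ} (hℓ : ∀ b < H, d₁ ≤ ℓ b) (hH : d₂ ≤ H)
    (f : ℕ → ℕ → B) (k l : ℕ)
    (hS₁ : t₁.coeffSet ⊆ S) (hS₂ : w₁.coeffSet ⊆ S) (hS₃ : repSet ht₁ t₂.coeffSet ⊆ S)
    (hS₄ : repSet ht₁ w₂.coeffSet ⊆ S) (hf : ∀ a b, f a b ∈ S) :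
    𝓜.Reach S (5000 * 𝓜.mulCost (∑ b ∈ Finset.range H, ℓ b))
      (repSet ht₁ (repSet ht₂ {evalDeriv H ℓ
        (fun a b => AdjoinRoot.of t₂ (AdjoinRoot.of t₁ (f a b))) k l
        (AdjoinRoot.of t₂ (AdjoinRoot.root t₁)) (AdjoinRoot.root t₂)})) := by
  set N := ∑ b ∈ Finset.range H, ℓ b with hN
  set g : ℕ → B[X] := fun b => hasseDeriv k (ofCoeffs (ℓ b) fun a => f a b) with hg
  set V : (AdjoinRoot t₁)[X] := ofCoeffs H fun b => AdjoinRoot.mk t₁ (g b) with hV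
  -- Evaluation at the residue classes is passage to the quotient in each variable. So the value is
  -- the class of a polynomial in the second variable whose coefficients are the classes of the
  -- differentiated rows.
  have hZ : evalDeriv H ℓ (fun a b => AdjoinRoot.of t₂ (AdjoinRoot.of t₁ (f a b))) k l
      (AdjoinRoot.of t₂ (AdjoinRoot.root t₁)) (AdjoinRoot.root t₂) =
      AdjoinRoot.mk t₂ (hasseDeriv l V) := by
    rw [hV, mk_hasseDeriv_ofCoeffs, evalDeriv]
    refine Finset.sum_congr rfl fun b _ => ?_
    rw [hg, mk_hasseDeriv_ofCoeffs, map_sum]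
    simp only [map_mul, map_pow, map_natCast]
  have e1 : 𝓜.Reach S (∑ b ∈ Finset.range H, 65 * 𝓜.mulCost (ℓ b))
      (⋃ b ∈ Finset.range H, (g b %ₘ t₁).coeffSet) := by
    refine Reach.biUnion _ fun b hb => ?_
    have hb := hℓ b (Finset.mem_range.1 hb)
    have dg : (g b).degree < (ℓ b : WithBot ℕ) := degree_hasseDeriv_lt k (degree_ofCoeffs_lt _ _)
    have h1 : 𝓜.Reach S (ℓ b * 𝓜.unit) (g b).coeffSet := reach_hasseDeriv k (degree_ofCoeffs_lt _ _)
      (coeffSet_ofCoeffs_subset fun i _ => Or.inl (hf i b))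
    have h2 : 𝓜.Reach (S ∪ (g b).coeffSet) ((ℓ b / d₁ + 1) * (32 * 𝓜.mulCost d₁))
        (g b %ₘ t₁).coeffSet :=
      reach_modByMonic ht₁ hd₁ hp₁ hw₁ _ (degree_lt_of_degree_lt_of_le dg (lt_blocks hp₁))
        (fun x hx => Or.inl (Or.inr hx)) (fun x hx => Or.inl (hS₁ hx)) (fun x hx => Or.inl (hS₂ hx))
    refine (h1.trans h2).cost_le ?_
    have h3 := 𝓜.unit_mul_le (ℓ b)
    have h4 := 𝓜.blocks_mul_mulCost_le hp₁ hb
    have h5 : (ℓ b / d₁ + 1) * (32 * 𝓜.mulCost d₁) = 32 * ((ℓ b / d₁ + 1) * 𝓜.mulCost d₁) := by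
      ring
    rw [mul_comm] at h3
    omega
  set 𝓜₁ := 𝓜.adjoin ht₁ hd₁ hp₁ hw₁ with h𝓜
  have e2 : 𝓜₁.Reach (V.coeffSet ∪ (t₂.coeffSet ∪ w₂.coeffSet))
      (H * 𝓜₁.unit + (H / d₂ + 1) * (32 * 𝓜₁.mulCost d₂)) (hasseDeriv l V %ₘ t₂).coeffSet := by
    have h1 : 𝓜₁.Reach (V.coeffSet ∪ (t₂.coeffSet ∪ w₂.coeffSet)) (H * 𝓜₁.unit)
        (hasseDeriv l V).coeffSet :=
      reach_hasseDeriv l (degree_ofCoeffs_lt _ _) (fun x hx => Or.inl (Or.inl hx))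
    refine h1.trans (reach_modByMonic ht₂ hd₂ hp₂ hw₂ _ (degree_lt_of_degree_lt_of_le
      (degree_hasseDeriv_lt l (degree_ofCoeffs_lt _ _)) (lt_blocks hp₂))
      (fun x hx => Or.inl (Or.inr hx)) (fun x hx => Or.inl (Or.inr (Or.inl hx)))
      (fun x hx => Or.inl (Or.inr (Or.inr hx))))
  have e3 : 𝓜.Reach (S ∪ ⋃ b ∈ Finset.range H, (g b %ₘ t₁).coeffSet)
      (H * 𝓜₁.unit + (H / d₂ + 1) * (32 * 𝓜₁.mulCost d₂))
      (repSet ht₁ (repSet ht₂ {AdjoinRoot.mk t₂ (hasseDeriv l V)})) := by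
    rw [repSet_singleton, AdjoinRoot.modByMonicHom_mk]
    refine Reach.of_known (Reach.subset_left (show 𝓜.Reach _ _ _ from e2) ?_)
    rw [repSet_union, repSet_union]
    refine Set.union_subset (Set.union_subset (fun x hx => Or.inl (Or.inl (hS₁ hx)))
      fun x hx => Or.inl (Or.inl (hS₂ hx))) (Set.union_subset ?_
      (Set.union_subset (fun x hx => Or.inl (Or.inl (hS₃ hx)))
      fun x hx => Or.inl (Or.inl (hS₄ hx))))
    refine Set.iUnion₂_subset ?_
    rintro _ ⟨b, rfl⟩ _ ⟨i, rfl⟩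
    rw [hV, coeff_ofCoeffs]
    split_ifs with hb
    · rw [AdjoinRoot.modByMonicHom_mk]
      exact Or.inl (Or.inr (Set.mem_biUnion (x := b) (by simpa using hb) (coeff_mem_coeffSet _ _)))
    · rw [map_zero]
      exact Or.inr zero_mem_consts
  rw [hZ]
  -- The rows contribute `65`. The second reduction handles `H` coefficients of length `d₁`, and `d₁
  -- * H ≤ N` since all rows are that long; it contributes `1 + 64 * 77`. The total `4994` is
  -- rounded up.
  refine (e1.trans e3).cost_le ?_
  rw [← Finset.mul_sum]
  have h1 := 𝓜.sum_mulCost_le (Finset.range H) ℓ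
  have h2 : d₁ * H ≤ N := by
    rw [hN, mul_comm]
    simpa using Finset.card_nsmul_le_sum (Finset.range H) ℓ d₁
      fun b hb => hℓ b (Finset.mem_range.1 hb)
  have h3 := 𝓜.mulCost_mono h2
  have h4 := 𝓜₁.blocks_mul_mulCost_le hp₂ hH
  have h5 : (H / d₂ + 1) * (32 * 𝓜₁.mulCost d₂) = 32 * ((H / d₂ + 1) * 𝓜₁.mulCost d₂) := by ring
  have h6 : 𝓜₁.mulCost H = 77 * 𝓜.mulCost (d₁ * H) := rfl
  have h7 : H * 𝓜₁.unit = 𝓜.unit * (d₁ * H) := by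
    rw [show 𝓜₁.unit = d₁ * 𝓜.unit from rfl]; ring
  have h8 := 𝓜.unit_mul_le (d₁ * H)
  rw [← hN] at h1
  omega

/-- All divided derivatives are obtained from Taylor shifts of the rows and of the columns. -/
theorem reach_evalDeriv_of_taylor {H W : ℕ} {ℓ h : ℕ → ℕ}
    (hrow : ∀ b < H, ∀ i < ℓ b, (i.factorial : F) ≠ 0)
    (hcol : ∀ a < W, ∀ i < h a, (i.factorial : F) ≠ 0)
    (hW : ∀ a b, b < H → a < ℓ b → a < W ∧ b < h a)
    (hsum : ∑ a ∈ Finset.range W, h a = ∑ b ∈ Finset.range H, ℓ b)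
    (hN : 0 < ∑ b ∈ Finset.range H, ℓ b)
    (f : ℕ → ℕ → B)
    (hS₁ : t₁.coeffSet ⊆ S) (hS₂ : w₁.coeffSet ⊆ S) (hS₃ : repSet ht₁ t₂.coeffSet ⊆ S)
    (hS₄ : repSet ht₁ w₂.coeffSet ⊆ S) (hf : ∀ a b, f a b ∈ S) :
    𝓜.Reach S (64290 * 𝓜.mulCost (d₁ * d₂ * ∑ b ∈ Finset.range H, ℓ b))
      (repSet ht₁ (repSet ht₂ (Set.range fun e : ℕ × ℕ => evalDeriv H ℓ
        (fun a b => AdjoinRoot.of t₂ (AdjoinRoot.of t₁ (f a b))) e.1 e.2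
        (AdjoinRoot.of t₂ (AdjoinRoot.root t₁)) (AdjoinRoot.root t₂)))) := by
  set N := ∑ b ∈ Finset.range H, ℓ b with hNdef
  set ρ₁ := AdjoinRoot.of t₂ (AdjoinRoot.root t₁) with hρ₁
  set ρ₂ := AdjoinRoot.root t₂ with hρ₂
  set φ : ℕ → ℕ → AdjoinRoot t₂ := fun a b => AdjoinRoot.of t₂ (AdjoinRoot.of t₁ (f a b)) with hφ
  set 𝓜₁ := 𝓜.adjoin ht₁ hd₁ hp₁ hw₁ with h𝓜₁
  set 𝓜₂ := 𝓜₁.adjoin ht₂ hd₂ hp₂ hw₂ with h𝓜₂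
  -- If `d₁ = 1`, then `X` is not its own remainder, so the representative of the root has to be
  -- computed. Two blocks suffice because `1 < 2 * d₁`.
  have e1 : 𝓜.Reach S (2 * (32 * 𝓜.mulCost d₁)) (X %ₘ t₁).coeffSet :=
    reach_modByMonic ht₁ hd₁ hp₁ hw₁ 2
      (degree_X_le.trans_lt (by exact_mod_cast (by omega : 1 < d₁ * 2)))
      (by simpa using coeffSet_X_pow_subset (F := F) (S := S) 1) hS₁ hS₂
  have e2 : 𝓜₁.Reach (t₂.coeffSet ∪ w₂.coeffSet) (2 * (32 * 𝓜₁.mulCost d₂)) (X %ₘ t₂).coeffSet :=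
    reach_modByMonic ht₂ hd₂ hp₂ hw₂ 2
      (degree_X_le.trans_lt (by exact_mod_cast (by omega : 1 < d₂ * 2)))
      (by simpa using coeffSet_X_pow_subset (F := F) (S := t₂.coeffSet ∪ w₂.coeffSet) 1)
      Set.subset_union_left Set.subset_union_right
  have hT : t₁.coeffSet ∪ w₁.coeffSet ∪ repSet ht₁ (t₂.coeffSet ∪ w₂.coeffSet) ⊆ S := by
    rw [repSet_union]
    exact Set.union_subset (Set.union_subset hS₁ hS₂) (Set.union_subset hS₃ hS₄)
  have e2' : 𝓜.Reach S (2 * (32 * 𝓜₁.mulCost d₂)) (repSet ht₁ (X %ₘ t₂).coeffSet) :=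
    Reach.subset_left (show 𝓜.Reach _ _ _ from e2) hT
  have e3 : 𝓜₂.Reach ((Set.range fun e : ℕ × ℕ => φ e.1 e.2) ∪ {ρ₁, ρ₂}) (10 * 𝓜₂.mulCost N)
      (Set.range fun e : ℕ × ℕ => evalDeriv H ℓ φ e.1 e.2 ρ₁ ρ₂) :=
    reach_evalDeriv_range hrow hcol hW hsum (fun a b => Or.inl ⟨(a, b), rfl⟩) (by simp) (by simp)
  have hC : ∀ x : AdjoinRoot t₁, repSet ht₁ (repSet ht₂ {AdjoinRoot.of t₂ x}) ⊆
      (AdjoinRoot.modByMonicHom ht₁ x).coeffSet ∪ Set.range (algebraMap F B) := by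
    intro x
    rw [repSet_singleton, modByMonicHom_of ht₂ (hd₂ ▸ hp₂)]
    refine Set.iUnion₂_subset ?_
    rintro _ ⟨j, rfl⟩
    rw [coeff_C]
    split_ifs
    · exact Set.subset_union_left
    · rw [map_zero]
      rintro _ ⟨i, rfl⟩
      exact Or.inr zero_mem_consts
  have e4 : 𝓜.Reach (S ∪ ((X %ₘ t₁).coeffSet ∪ repSet ht₁ (X %ₘ t₂).coeffSet))
      (10 * 𝓜₂.mulCost N)
      (repSet ht₁ (repSet ht₂ (Set.range fun e : ℕ × ℕ => evalDeriv H ℓ φ e.1 e.2 ρ₁ ρ₂))) := by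
    refine Reach.of_known (Reach.subset_left (show 𝓜.Reach _ _ _ from e3) ?_)
    rw [repSet_union (t := t₁) (_ ∪ _) _, ← Set.union_assoc]
    refine Set.union_subset (hT.trans fun x hx => Or.inl (Or.inl hx)) ?_
    have hS : ∀ x ∈ ((Set.range fun e : ℕ × ℕ => φ e.1 e.2) ∪ {ρ₁, ρ₂}),
        repSet ht₁ (repSet ht₂ {x}) ⊆ S ∪ ((X %ₘ t₁).coeffSet ∪ repSet ht₁ (X %ₘ t₂).coeffSet) ∪
          Set.range (algebraMap F B) := by
      rintro x (⟨e, rfl⟩ | rfl | rfl)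
      · refine (hC _).trans (Set.union_subset ?_ Set.subset_union_right)
        rw [modByMonicHom_of ht₁ (hd₁ ▸ hp₁)]
        rintro _ ⟨j, rfl⟩
        rw [coeff_C]
        split_ifs
        exacts [Or.inl (Or.inl (hf _ _)), Or.inr zero_mem_consts]
      · refine (hC _).trans (Set.union_subset ?_ Set.subset_union_right)
        rw [modByMonicHom_root]
        exact fun x hx => Or.inl (Or.inr (Or.inl hx))
      · rw [repSet_singleton, modByMonicHom_root]
        exact fun x hx => Or.inl (Or.inr (Or.inr hx))
    intro z hz
    obtain ⟨u, hu, hz⟩ := Set.mem_iUnion₂.1 hz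
    obtain ⟨v, hv, hu⟩ := Set.mem_iUnion₂.1 hu
    refine hS v hv (Set.mem_biUnion (x := u) ?_ hz)
    rw [repSet_singleton]
    exact hu
  -- The shifts cost `10 * 77 * 77`, one factor `77` for each step of the tower; the two roots cost
  -- `64` and `64 * 77`.
  refine ((e1.union e2').trans e4).cost_le ?_
  have h1 : 𝓜₁.mulCost d₂ = 77 * 𝓜.mulCost (d₁ * d₂) := rfl
  have h2 : 𝓜₂.mulCost N = 77 * (77 * 𝓜.mulCost (d₁ * (d₂ * N))) := rfl
  have h3 := 𝓜.mulCost_mono (show d₁ ≤ d₁ * d₂ * N by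
    rw [mul_assoc]; exact Nat.le_mul_of_pos_right _ (Nat.mul_pos hp₂ hN))
  have h4 := 𝓜.mulCost_mono (show d₁ * d₂ ≤ d₁ * d₂ * N from Nat.le_mul_of_pos_right _ hN)
  rw [← mul_assoc] at h2
  rw [← mul_assoc d₁] at h2
  omega

end Tower

end CostModel

end Polynomial

namespace Polynomial

/-! ### Programs for generic input -/

section Generic

variable (F : Type*) [Field F]

/-- The exponent of the monomial `X 0 ^ a * X 1 ^ b`. -/
noncomputable def exponent (a b : ℕ) : Fin 2 →₀ ℕ := Finsupp.single 0 a + Finsupp.single 1 b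

@[simp] theorem exponent_zero_apply (a b : ℕ) : exponent a b 0 = a := by simp [exponent]

@[simp] theorem exponent_one_apply (a b : ℕ) : exponent a b 1 = b := by simp [exponent]

@[simp] theorem exponent_eta (e : Fin 2 →₀ ℕ) : exponent (e 0) (e 1) = e := by
  ext i; fin_cases i <;> simp

/-- The families of inputs, as a ring of functions. -/
abbrev InputRing : Type _ := (Fin 3 × (Fin 2 →₀ ℕ) → F) → F

/-- The generic coefficients of the `k`-th input polynomial. -/
noncomputable def inputCoeff (k : Fin 3) (a b : ℕ) : InputRing F := fun x => x (k, exponent a b)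

/-- The generic monic univariate polynomial of degree `d₁`. -/
noncomputable def genericFst (d₁ : ℕ) : (InputRing F)[X] :=
  X ^ d₁ + ofCoeffs d₁ fun i => inputCoeff F 0 i 0

/-- The generic polynomial that is monic of degree `d₂` in the second variable. -/
noncomputable def genericSnd (d₁ d₂ : ℕ) : (AdjoinRoot (genericFst F d₁))[X] :=
  X ^ d₂ + ofCoeffs d₂ fun j => AdjoinRoot.mk _ (ofCoeffs d₁ fun i => inputCoeff F 1 i j)

theorem monic_genericFst (d₁ : ℕ) : (genericFst F d₁).Monic :=
  monic_X_pow_add (degree_ofCoeffs_lt _ _)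

theorem monic_genericSnd (d₁ d₂ : ℕ) : (genericSnd F d₁ d₂).Monic :=
  monic_X_pow_add (degree_ofCoeffs_lt _ _)

theorem natDegree_genericFst (d₁ : ℕ) : (genericFst F d₁).natDegree = d₁ := by
  have h : (ofCoeffs d₁ fun i => inputCoeff F 0 i 0).degree < (X ^ d₁ : (InputRing F)[X]).degree := by
    rw [degree_X_pow]; exact degree_ofCoeffs_lt _ _
  rw [genericFst, natDegree_add_eq_left_of_degree_lt h, natDegree_X_pow]

theorem nontrivial_adjoinRoot_genericFst {d₁ : ℕ} (h : 0 < d₁) :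
    Nontrivial (AdjoinRoot (genericFst F d₁)) :=
  nontrivial_adjoinRoot (monic_genericFst F d₁) (by rwa [natDegree_genericFst])

theorem natDegree_genericSnd {d₁ : ℕ} (hd₁ : 0 < d₁) (d₂ : ℕ) :
    (genericSnd F d₁ d₂).natDegree = d₂ := by
  have := nontrivial_adjoinRoot_genericFst F hd₁
  have h : (ofCoeffs d₂ fun j => AdjoinRoot.mk (genericFst F d₁)
      (ofCoeffs d₁ fun i => inputCoeff F 1 i j)).degree <
      (X ^ d₂ : (AdjoinRoot (genericFst F d₁))[X]).degree := by
    rw [degree_X_pow]; exact degree_ofCoeffs_lt _ _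
  rw [genericSnd, natDegree_add_eq_left_of_degree_lt h, natDegree_X_pow]

variable {F}

theorem eval₂_ofCoeffs {A L : Type*} [CommRing A] [CommRing L] (φ : A →+* L) (n : ℕ) (f : ℕ → A)
    (x : L) : (ofCoeffs n f).eval₂ φ x = ∑ i ∈ Finset.range n, φ (f i) * x ^ i := by
  simp [ofCoeffs, eval₂_finsetSum, eval₂_monomial]

theorem eval₂_eq_sum_of_degree_lt {A L : Type*} [CommRing A] [CommRing L] (φ : A →+* L) {n : ℕ}
    {p : A[X]} (hp : p.degree < n) (x : L) :
    p.eval₂ φ x = ∑ i ∈ Finset.range n, φ (p.coeff i) * x ^ i := by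
  have : p = ofCoeffs n p.coeff := by
    ext i
    rw [coeff_ofCoeffs]
    split_ifs with h
    exacts [rfl, (degree_lt_iff_coeff_zero _ _).1 hp i (by omega)]
  conv_lhs => rw [this]
  exact eval₂_ofCoeffs φ n p.coeff x

/-- The point `(α₁, α₂)` is a zero of the two polynomials whose lower coefficients are the inputs
`x`. -/
def IsZero {L : Type*} [CommRing L] [Algebra F L] (d₁ d₂ : ℕ) (x : Fin 3 × (Fin 2 →₀ ℕ) → F)
    (α₁ α₂ : L) : Prop :=
  α₁ ^ d₁ + ∑ i ∈ Finset.range d₁, algebraMap F L (x (0, exponent i 0)) * α₁ ^ i = 0 ∧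
  α₂ ^ d₂ + ∑ j ∈ Finset.range d₂, (∑ i ∈ Finset.range d₁,
    algebraMap F L (x (1, exponent i j)) * α₁ ^ i) * α₂ ^ j = 0

/-- The universal property of `AdjoinRoot`, used twice, extends evaluation at the input `x` to the
generic tower. Applied to representatives, it says that the generic coordinates, evaluated at `x`,
express the image of `z` by the monomials in `α₁` and `α₂`. -/
theorem exists_specialization {L : Type*} [CommRing L] [Algebra F L] {d₁ d₂ : ℕ} (hd₁ : 0 < d₁)
    {x : Fin 3 × (Fin 2 →₀ ℕ) → F} {α₁ α₂ : L} (h : IsZero d₁ d₂ x α₁ α₂) :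
    ∃ ψ : AdjoinRoot (genericSnd F d₁ d₂) →+* L,
      (∀ c, ψ (AdjoinRoot.of _ (AdjoinRoot.of _ c)) = algebraMap F L (c x)) ∧
      ψ (AdjoinRoot.of _ (AdjoinRoot.root _)) = α₁ ∧ ψ (AdjoinRoot.root _) = α₂ ∧
      ∀ z, ψ z = ∑ j ∈ Finset.range d₂, (∑ i ∈ Finset.range d₁, algebraMap F L
        ((AdjoinRoot.modByMonicHom (monic_genericFst F d₁)
          ((AdjoinRoot.modByMonicHom (monic_genericSnd F d₁ d₂) z).coeff j)).coeff i x) *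
            α₁ ^ i) * α₂ ^ j := by
  have := nontrivial_adjoinRoot_genericFst F hd₁
  set σ : InputRing F →+* L := (algebraMap F L).comp (Pi.evalRingHom (fun _ => F) x)
  have hσ : ∀ c, σ c = algebraMap F L (c x) := fun c => rfl
  have h₁ : (genericFst F d₁).eval₂ σ α₁ = 0 := by
    rw [genericFst, eval₂_add, eval₂_X_pow, eval₂_ofCoeffs]
    exact h.1
  set φ := AdjoinRoot.lift σ α₁ h₁
  have h₂ : (genericSnd F d₁ d₂).eval₂ φ α₂ = 0 := by
    rw [genericSnd, eval₂_add, eval₂_X_pow, eval₂_ofCoeffs]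
    simp only [φ, AdjoinRoot.lift_mk, eval₂_ofCoeffs]
    exact h.2
  refine ⟨AdjoinRoot.lift φ α₂ h₂, fun c => ?_, ?_, ?_, fun z => ?_⟩
  · rw [AdjoinRoot.lift_of, AdjoinRoot.lift_of, hσ]
  · rw [AdjoinRoot.lift_of, AdjoinRoot.lift_root]
  · rw [AdjoinRoot.lift_root]
  · conv_lhs => rw [← AdjoinRoot.mk_leftInverse (monic_genericSnd F d₁ d₂) z]
    rw [AdjoinRoot.lift_mk, eval₂_eq_sum_of_degree_lt φ
      (CostModel.degree_modByMonicHom_lt _ (natDegree_genericSnd F hd₁ d₂) z)]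
    refine Finset.sum_congr rfl fun j _ => ?_
    congr 1
    set u := (AdjoinRoot.modByMonicHom (monic_genericSnd F d₁ d₂) z).coeff j
    conv_lhs => rw [← AdjoinRoot.mk_leftInverse (monic_genericFst F d₁) u]
    rw [AdjoinRoot.lift_mk, eval₂_eq_sum_of_degree_lt σ
      (CostModel.degree_modByMonicHom_lt _ (natDegree_genericFst F d₁) u)]
    rfl

/-- The program `P` computes, for all inputs, the divided derivatives of the orders in `E` of the
third input polynomial at the zeros of the first two. -/
def EvaluatesDerivatives.{u} {F : Type u} [Field F]
    (P : StraightLineProgram F (Fin 3 × (Fin 2 →₀ ℕ)) ((Fin 2 →₀ ℕ) × (Fin 2 →₀ ℕ)))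
    (d₁ d₂ H : ℕ) (ℓ : ℕ → ℕ) (E : Finset (ℕ × ℕ)) : Prop :=
  ∀ x : Fin 3 × (Fin 2 →₀ ℕ) → F, ∃ y, P.Computes x y ∧
    (∀ q, ¬ ((q.1 0, q.1 1) ∈ E ∧ q.2 0 < d₁ ∧ q.2 1 < d₂) → y q = 0) ∧
    ∀ (L : Type u) [CommRing L] [Algebra F L] (α₁ α₂ : L), IsZero d₁ d₂ x α₁ α₂ →
      ∀ k l, (k, l) ∈ E → ∑ j ∈ Finset.range d₂, (∑ i ∈ Finset.range d₁,
        algebraMap F L (y (exponent k l, exponent i j)) * α₁ ^ i) * α₂ ^ j =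
        evalDeriv H ℓ (fun a b => algebraMap F L (x (2, exponent a b))) k l α₁ α₂

/-- The generic value of a divided derivative. -/
noncomputable def genericEvalDeriv (F : Type*) [Field F] (d₁ d₂ H : ℕ) (ℓ : ℕ → ℕ) (k l : ℕ) :
    AdjoinRoot (genericSnd F d₁ d₂) :=
  evalDeriv H ℓ (fun a b => AdjoinRoot.of _ (AdjoinRoot.of _ (inputCoeff F 2 a b))) k l
    (AdjoinRoot.of _ (AdjoinRoot.root _)) (AdjoinRoot.root _)

/-- The inputs, the generic polynomials and their reciprocals. -/
def availableSet {d₁ d₂ : ℕ} (w₁ : (InputRing F)[X]) (w₂ : (AdjoinRoot (genericFst F d₁))[X]) :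
    Set (InputRing F) :=
  (Set.range fun i x => x i) ∪ ((genericFst F d₁).coeffSet ∪ w₁.coeffSet ∪
    (CostModel.repSet (monic_genericFst F d₁) (genericSnd F d₁ d₂).coeffSet ∪
      CostModel.repSet (monic_genericFst F d₁) w₂.coeffSet))

-- The reciprocals of the two generic polynomials are computed once, for `102 * M d₁` and `102 * 77
-- * M (d₁ * d₂)`; this is the term `7956 * M (d₁ * d₂)`.
open CostModel in
theorem exists_program_of_reach.{u} {F : Type u} [Field F] {M : ℕ → ℕ}
    (hM : IsMultiplicationTime F M) {d₁ d₂ : ℕ} (hd₁ : 0 < d₁) (hd₂ : 0 < d₂) (H : ℕ) (ℓ : ℕ → ℕ)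
    (E : Finset (ℕ × ℕ)) (K : ℕ)
    (hZ : ∀ w₁ w₂, IsReciprocal (genericFst F d₁) w₁ d₁ → IsReciprocal (genericSnd F d₁ d₂) w₂ d₂ →
      (CostModel.pointwise hM (Fin 3 × (Fin 2 →₀ ℕ) → F)).Reach (availableSet (d₂ := d₂) w₁ w₂) K
        (repSet (monic_genericFst F d₁) (repSet (monic_genericSnd F d₁ d₂)
          ((fun e : ℕ × ℕ => genericEvalDeriv F d₁ d₂ H ℓ e.1 e.2) '' E)))) :
    ∃ P, EvaluatesDerivatives (F := F) P d₁ d₂ H ℓ E ∧ P.cost ≤ 7956 * M (d₁ * d₂) + K := by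
  have := nontrivial_adjoinRoot_genericFst F hd₁
  set 𝓜 := CostModel.pointwise hM (Fin 3 × (Fin 2 →₀ ℕ) → F) with h𝓜
  set S₀ : Set (InputRing F) := Set.range fun i x => x i with hS₀
  have hin : ∀ k a b, inputCoeff F k a b ∈ S₀ := fun k a b => ⟨(k, exponent a b), rfl⟩
  have hfst : (genericFst F d₁).coeffSet ⊆ S₀ ∪ Set.range (algebraMap F (InputRing F)) := by
    rintro _ ⟨i, rfl⟩
    rw [genericFst, coeff_add, coeff_X_pow, coeff_ofCoeffs]
    split_ifs with h1 h2 h2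
    · omega
    · rw [add_zero]; exact Or.inr one_mem_consts
    · rw [zero_add]; exact Or.inl (hin _ _ _)
    · rw [zero_add]; exact Or.inr zero_mem_consts
  have hone : AdjoinRoot.modByMonicHom (monic_genericFst F d₁) 1 = 1 := by
    have := modByMonicHom_of (monic_genericFst F d₁) (by rwa [natDegree_genericFst]) 1
    simpa using this
  have hsnd : repSet (monic_genericFst F d₁) (genericSnd F d₁ d₂).coeffSet ⊆
      S₀ ∪ Set.range (algebraMap F (InputRing F)) := by
    refine Set.iUnion₂_subset ?_
    rintro _ ⟨j, rfl⟩ _ ⟨i, rfl⟩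
    rw [genericSnd, coeff_add, coeff_X_pow, coeff_ofCoeffs]
    split_ifs with h1 h2 h2
    · omega
    · rw [add_zero, hone, coeff_one]
      split_ifs
      exacts [Or.inr one_mem_consts, Or.inr zero_mem_consts]
    · rw [zero_add, AdjoinRoot.modByMonicHom_mk, (modByMonic_eq_self_iff (monic_genericFst F d₁)).2,
        coeff_ofCoeffs]
      · split_ifs
        exacts [Or.inl (hin _ _ _), Or.inr zero_mem_consts]
      · rw [degree_eq_natDegree (monic_genericFst F d₁).ne_zero, natDegree_genericFst]
        exact degree_ofCoeffs_lt _ _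
    · rw [zero_add, map_zero]; exact Or.inr zero_mem_consts
  have htop : ∀ (d : ℕ) {A : Type u} [CommRing A] [Nontrivial A] {t : A[X]}, t.Monic →
      t.natDegree = d → t.degree < ((d + 1 : ℕ) : WithBot ℕ) ∧ t.coeff d = 1 := by
    rintro d A _ _ t ht rfl
    refine ⟨?_, ht.coeff_natDegree⟩
    rw [degree_eq_natDegree ht.ne_zero]
    exact_mod_cast Nat.lt_succ_self _
  obtain ⟨w₁, hw₁, e₁⟩ := exists_isReciprocal 𝓜 d₁ hd₁ (genericFst F d₁)
    (htop d₁ (monic_genericFst F d₁) (natDegree_genericFst F d₁)).1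
    (htop d₁ (monic_genericFst F d₁) (natDegree_genericFst F d₁)).2
  set 𝓜₁ := 𝓜.adjoin (monic_genericFst F d₁) (natDegree_genericFst F d₁) hd₁ hw₁ with h𝓜₁
  obtain ⟨w₂, hw₂, e₂⟩ := exists_isReciprocal 𝓜₁ d₂ hd₂ (genericSnd F d₁ d₂)
    (htop d₂ (monic_genericSnd F d₁ d₂) (natDegree_genericSnd F hd₁ d₂)).1
    (htop d₂ (monic_genericSnd F d₁ d₂) (natDegree_genericSnd F hd₁ d₂)).2
  have e₁' : 𝓜.Reach S₀ (102 * 𝓜.mulCost d₁) w₁.coeffSet := (e₁.subset_left hfst).of_known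
  have e₂' : 𝓜.Reach (S₀ ∪ w₁.coeffSet) (102 * 𝓜₁.mulCost d₂)
      (repSet (monic_genericFst F d₁) w₂.coeffSet) := by
    refine Reach.of_known (Reach.subset_left (show 𝓜.Reach _ _ _ from e₂) ?_)
    refine Set.union_subset (Set.union_subset ?_ fun x hx => Or.inl (Or.inr hx)) ?_
    · exact fun x hx => (hfst hx).imp Or.inl id
    · exact fun x hx => (hsnd hx).imp Or.inl id
  have e₃ : 𝓜.Reach (S₀ ∪ w₁.coeffSet ∪ repSet (monic_genericFst F d₁) w₂.coeffSet) K
      (repSet (monic_genericFst F d₁) (repSet (monic_genericSnd F d₁ d₂)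
        ((fun e : ℕ × ℕ => genericEvalDeriv F d₁ d₂ H ℓ e.1 e.2) '' E))) := by
    refine Reach.of_known (Reach.subset_left (hZ w₁ w₂ hw₁ hw₂) ?_)
    refine Set.union_subset (fun x hx => Or.inl (Or.inl (Or.inl hx))) (Set.union_subset
      (Set.union_subset ?_ fun x hx => Or.inl (Or.inl (Or.inr hx))) (Set.union_subset ?_
      fun x hx => Or.inl (Or.inr hx)))
    · exact fun x hx => (hfst hx).imp (fun h => Or.inl (Or.inl h)) id
    · exact fun x hx => (hsnd hx).imp (fun h => Or.inl (Or.inl h)) id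
  have e₄ : 𝓜.Reach S₀ 0 {(0 : InputRing F)} :=
    reach_of_subset (Set.singleton_subset_iff.2 (Or.inr zero_mem_consts))
  have e := (e₁'.trans (e₂'.trans e₃)).union e₄
  classical
  obtain ⟨P, hP, hcomp⟩ := PointwiseReach.exists_program
    (x := fun x : Fin 3 × (Fin 2 →₀ ℕ) → F => x) (show PointwiseReach _ _ _ from e)
    (fun q : (Fin 2 →₀ ℕ) × (Fin 2 →₀ ℕ) =>
      if (q.1 0, q.1 1) ∈ E ∧ q.2 0 < d₁ ∧ q.2 1 < d₂ then
        (AdjoinRoot.modByMonicHom (monic_genericFst F d₁) ((AdjoinRoot.modByMonicHom (monic_genericSnd F d₁ d₂)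
          (genericEvalDeriv F d₁ d₂ H ℓ (q.1 0) (q.1 1))).coeff (q.2 1))).coeff (q.2 0)
      else 0) (by
    intro q
    split_ifs with hq
    · have h1 : genericEvalDeriv F d₁ d₂ H ℓ (q.1 0) (q.1 1) ∈
          (fun e : ℕ × ℕ => genericEvalDeriv F d₁ d₂ H ℓ e.1 e.2) '' E := ⟨_, hq.1, rfl⟩
      exact Or.inl (mem_repSet (mem_repSet h1 _) _)
    · exact Or.inr rfl)
  refine ⟨P, fun x => ⟨_, hcomp x, fun q hq => by rw [if_neg hq]; rfl, ?_⟩, hP.trans ?_⟩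
  · intro L _ _ α₁ α₂ h k l hkl
    obtain ⟨ψ, hψ₀, hψ₁, hψ₂, hψ⟩ := exists_specialization hd₁ h
    have : evalDeriv H ℓ (fun a b => algebraMap F L (x (2, exponent a b))) k l α₁ α₂ =
        ψ (genericEvalDeriv F d₁ d₂ H ℓ k l) := by
      rw [genericEvalDeriv, map_evalDeriv, hψ₁, hψ₂]
      simp only [hψ₀]
      rfl
    rw [this, hψ]
    refine Finset.sum_congr rfl fun j hj => ?_
    congr 1
    refine Finset.sum_congr rfl fun i hi => ?_
    rw [Finset.mem_range] at hi hj
    simp only [exponent_zero_apply, exponent_one_apply]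
    rw [if_pos ⟨hkl, hi, hj⟩]
  · have h1 : 𝓜₁.mulCost d₂ = 77 * 𝓜.mulCost (d₁ * d₂) := rfl
    have h2 := 𝓜.mulCost_mono (show d₁ ≤ d₁ * d₂ from Nat.le_mul_of_pos_right _ hd₂)
    have h3 : 𝓜.mulCost (d₁ * d₂) = M (d₁ * d₂) := if_neg (Nat.mul_pos hd₁ hd₂).ne'
    omega

-- The derivatives of the orders in `E` are computed separately, and superadditivity collects their
-- costs. The reciprocals are absorbed since `d₁ * d₂ ≤ N`, so the constant is `7956 + 5000`.
open CostModel in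
theorem exists_evaluatesDerivatives.{u} {F : Type u} [Field F] {M : ℕ → ℕ}
    (hM : IsMultiplicationTime F M) {d₁ d₂ : ℕ} (hd₁ : 0 < d₁) (hd₂ : 0 < d₂) {H : ℕ} {ℓ : ℕ → ℕ}
    (hℓ : ∀ b < H, d₁ ≤ ℓ b) (hH : d₂ ≤ H) (E : Finset (ℕ × ℕ)) (hE : E.Nonempty) :
    ∃ P, EvaluatesDerivatives (F := F) P d₁ d₂ H ℓ E ∧
      P.cost ≤ 12956 * M (E.card * ∑ b ∈ Finset.range H, ℓ b) := by
  have := nontrivial_adjoinRoot_genericFst F hd₁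
  set 𝓜 := CostModel.pointwise hM (Fin 3 × (Fin 2 →₀ ℕ) → F) with h𝓜
  set N := ∑ b ∈ Finset.range H, ℓ b with hN
  obtain ⟨P, hP, hcost⟩ := exists_program_of_reach hM hd₁ hd₂ H ℓ E
    (∑ e ∈ E, 5000 * 𝓜.mulCost N) (by
    intro w₁ w₂ hw₁ hw₂
    refine (Reach.biUnion (𝓜 := 𝓜) E fun e _ => reach_evalDeriv (monic_genericFst F d₁)
      (natDegree_genericFst F d₁) hd₁ hw₁ (monic_genericSnd F d₁ d₂) (natDegree_genericSnd F hd₁ d₂)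
      hd₂ hw₂ hℓ hH (inputCoeff F 2) e.1 e.2 ?_ ?_ ?_ ?_ ?_).subset_right ?_
    · exact fun x hx => Or.inr (Or.inl (Or.inl hx))
    · exact fun x hx => Or.inr (Or.inl (Or.inr hx))
    · exact fun x hx => Or.inr (Or.inr (Or.inl hx))
    · exact fun x hx => Or.inr (Or.inr (Or.inr hx))
    · exact fun a b => Or.inl ⟨(2, exponent a b), rfl⟩
    · intro z hz
      obtain ⟨u, hu, hz⟩ := Set.mem_iUnion₂.1 hz
      obtain ⟨v, ⟨e, he, rfl⟩, hu⟩ := Set.mem_iUnion₂.1 hu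
      refine Set.mem_biUnion (x := e) he (Set.mem_biUnion (x := u) ?_ hz)
      rw [repSet_singleton]
      exact hu)
  refine ⟨P, hP, hcost.trans ?_⟩
  have h2 : d₁ * d₂ ≤ N := by
    calc d₁ * d₂ ≤ H * d₁ := by rw [mul_comm]; exact Nat.mul_le_mul_right _ hH
      _ ≤ N := by simpa using Finset.card_nsmul_le_sum (Finset.range H) ℓ d₁
                    fun b hb => hℓ b (Finset.mem_range.1 hb)
  have h0 : 0 < N := (Nat.mul_pos hd₁ hd₂).trans_le h2
  have h3 : 𝓜.mulCost (d₁ * d₂) = M (d₁ * d₂) := if_neg (Nat.mul_pos hd₁ hd₂).ne'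
  have h4 : 𝓜.mulCost (E.card * N) = M (E.card * N) := if_neg (Nat.mul_pos hE.card_pos h0).ne'
  have h5 := 𝓜.mulCost_mono (h2.trans (Nat.le_mul_of_pos_left N hE.card_pos))
  have h6 := 𝓜.mul_mulCost_le E.card N
  rw [Finset.sum_const, smul_eq_mul, mul_left_comm]
  omega

-- The shifts give all derivatives together, so the size of `E` does not enter the cost. The
-- constant is `7956 + 64290`.
open CostModel in
theorem exists_evaluatesDerivatives_of_factorial.{u} {F : Type u} [Field F] {M : ℕ → ℕ}
    (hM : IsMultiplicationTime F M) {d₁ d₂ : ℕ} (hd₁ : 0 < d₁) (hd₂ : 0 < d₂)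
    {H W : ℕ} {ℓ h : ℕ → ℕ}
    (hrow : ∀ b < H, ∀ i < ℓ b, (i.factorial : F) ≠ 0)
    (hcol : ∀ a < W, ∀ i < h a, (i.factorial : F) ≠ 0)
    (hW : ∀ a b, b < H → a < ℓ b → a < W ∧ b < h a)
    (hsum : ∑ a ∈ Finset.range W, h a = ∑ b ∈ Finset.range H, ℓ b)
    (hN : 0 < ∑ b ∈ Finset.range H, ℓ b) (E : Finset (ℕ × ℕ)) :
    ∃ P, EvaluatesDerivatives (F := F) P d₁ d₂ H ℓ E ∧
      P.cost ≤ 72246 * M (d₁ * d₂ * ∑ b ∈ Finset.range H, ℓ b) := by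
  have := nontrivial_adjoinRoot_genericFst F hd₁
  set 𝓜 := CostModel.pointwise hM (Fin 3 × (Fin 2 →₀ ℕ) → F) with h𝓜
  set N := ∑ b ∈ Finset.range H, ℓ b
  obtain ⟨P, hP, hcost⟩ := exists_program_of_reach hM hd₁ hd₂ H ℓ E
    (64290 * 𝓜.mulCost (d₁ * d₂ * N)) (by
    intro w₁ w₂ hw₁ hw₂
    refine (reach_evalDeriv_of_taylor (𝓜 := 𝓜) (monic_genericFst F d₁)
      (natDegree_genericFst F d₁) hd₁ hw₁ (monic_genericSnd F d₁ d₂) (natDegree_genericSnd F hd₁ d₂)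
      hd₂ hw₂ hrow hcol hW hsum hN (inputCoeff F 2) ?_ ?_ ?_ ?_ ?_).subset_right
      (repSet_mono (repSet_mono (Set.image_subset_range _ _)))
    · exact fun x hx => Or.inr (Or.inl (Or.inl hx))
    · exact fun x hx => Or.inr (Or.inl (Or.inr hx))
    · exact fun x hx => Or.inr (Or.inr (Or.inl hx))
    · exact fun x hx => Or.inr (Or.inr (Or.inr hx))
    · exact fun a b => Or.inl ⟨(2, exponent a b), rfl⟩)
  refine ⟨P, hP, hcost.trans ?_⟩
  have h2 : 0 < d₁ * d₂ := Nat.mul_pos hd₁ hd₂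
  have h3 : 𝓜.mulCost (d₁ * d₂) = M (d₁ * d₂) := if_neg h2.ne'
  have h4 : 𝓜.mulCost (d₁ * d₂ * N) = M (d₁ * d₂ * N) := if_neg (Nat.mul_pos h2 hN).ne'
  have h5 := 𝓜.mulCost_mono (Nat.le_mul_of_pos_right (d₁ * d₂) hN)
  omega

end Generic

end Polynomial

namespace MvPolynomial

open Polynomial (exponent exponent_zero_apply exponent_one_apply exponent_eta)

/-! ### Bivariate polynomials and the lexicographic order -/

theorem exponent_inj {a b k l : ℕ} : exponent a b = exponent k l ↔ a = k ∧ b = l := by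
  refine ⟨fun h => ⟨?_, ?_⟩, fun h => by rw [h.1, h.2]⟩
  · simpa using DFunLike.congr_fun h 0
  · simpa using DFunLike.congr_fun h 1

theorem exponent_le {a b : ℕ} {e : Fin 2 →₀ ℕ} : exponent a b ≤ e ↔ a ≤ e 0 ∧ b ≤ e 1 := by
  refine ⟨fun h => ⟨by simpa using h 0, by simpa using h 1⟩, fun h i => ?_⟩
  fin_cases i
  · simpa using h.1
  · simpa using h.2

theorem lexOrder_lt_iff {a b : Fin 2 →₀ ℕ} :
    lexOrder.toSyn a < lexOrder.toSyn b ↔ a 1 < b 1 ∨ (a 1 = b 1 ∧ a 0 < b 0) := by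
  have : lexOrder.toSyn a < lexOrder.toSyn b ↔
      toLex (Finsupp.domCongr (Equiv.swap (0 : Fin 2) 1) a) <
        toLex (Finsupp.domCongr (Equiv.swap (0 : Fin 2) 1) b) := Iff.rfl
  rw [this, Finsupp.Lex.lt_iff]
  simp [Fin.exists_fin_two]

theorem lexOrder_le_iff {a b : Fin 2 →₀ ℕ} :
    lexOrder.toSyn a ≤ lexOrder.toSyn b ↔ a 1 < b 1 ∨ (a 1 = b 1 ∧ a 0 ≤ b 0) := by
  rw [← not_lt, lexOrder_lt_iff]
  omega

section CommRing

variable {k : Type*} [CommRing k]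

/-- A bivariate polynomial supported under a staircase, as a sum of monomials. -/
theorem eq_sum_monomial {p : MvPolynomial (Fin 2) k} {H : ℕ} {ℓ : ℕ → ℕ}
    (hp : ∀ e ∈ p.support, e 1 < H ∧ e 0 < ℓ (e 1)) :
    p = ∑ b ∈ Finset.range H, ∑ a ∈ Finset.range (ℓ b),
      monomial (exponent a b) (p.coeff (exponent a b)) := by
  ext e
  rw [coeff_sum]
  simp only [coeff_sum, coeff_monomial]
  have h : ∀ a b, exponent a b = e ↔ a = e 0 ∧ b = e 1 := fun a b => by
    conv_lhs => rw [← exponent_eta e, exponent_inj]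
  by_cases he : e ∈ p.support
  · obtain ⟨h1, h2⟩ := hp e he
    rw [Finset.sum_eq_single (e 1), Finset.sum_eq_single (e 0)]
    · simp
    · intro a _ ha
      rw [if_neg (by rw [h]; tauto)]
    · intro ha
      simp [h2] at ha
    · intro b _ hb
      refine Finset.sum_eq_zero fun a _ => ?_
      rw [if_neg (by rw [h]; tauto)]
    · intro hb
      simp [h1] at hb
  · rw [notMem_support_iff.1 he]
    refine (Finset.sum_eq_zero fun b _ => Finset.sum_eq_zero fun a _ => ?_).symm
    split_ifs with h1
    · rw [h1, notMem_support_iff.1 he]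
    · rfl

theorem monomial_exponent (a b : ℕ) (c : k) :
    monomial (exponent a b) c = C c * X 0 ^ a * X 1 ^ b := by
  rw [exponent, mul_assoc, X_pow_eq_monomial, X_pow_eq_monomial, monomial_mul, C_mul_monomial,
    mul_one, mul_one]

theorem aeval_eq_sum {L : Type*} [CommRing L] [Algebra k L] (α : Fin 2 → L)
    {p : MvPolynomial (Fin 2) k} {H : ℕ} {ℓ : ℕ → ℕ}
    (hp : ∀ e ∈ p.support, e 1 < H ∧ e 0 < ℓ (e 1)) :
    aeval α p = ∑ b ∈ Finset.range H, (∑ a ∈ Finset.range (ℓ b),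
      algebraMap k L (p.coeff (exponent a b)) * α 0 ^ a) * α 1 ^ b := by
  conv_lhs => rw [eq_sum_monomial hp]
  simp only [map_sum, monomial_exponent, map_mul, map_pow, aeval_C, aeval_X, Finset.sum_mul]

theorem aeval_X_eq_sum (i : Fin 2) (P : Polynomial k) :
    Polynomial.aeval (X i : MvPolynomial (Fin 2) k) P =
      ∑ j ∈ Finset.range (P.natDegree + 1), monomial (Finsupp.single i j) (P.coeff j) := by
  rw [Polynomial.aeval_eq_sum_range]
  refine Finset.sum_congr rfl fun j _ => ?_
  rw [X_pow_eq_monomial, smul_monomial, smul_eq_mul, mul_one]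

theorem coeff_aeval_X_mul_aeval_X (P Q : Polynomial k) (a b : ℕ) :
    (Polynomial.aeval (X 0 : MvPolynomial (Fin 2) k) P *
      Polynomial.aeval (X 1 : MvPolynomial (Fin 2) k) Q).coeff (exponent a b) =
      P.coeff a * Q.coeff b := by
  rw [aeval_X_eq_sum, aeval_X_eq_sum, Finset.sum_mul_sum, coeff_sum]
  simp only [coeff_sum, monomial_mul, coeff_monomial]
  have h : ∀ i j, Finsupp.single (0 : Fin 2) i + Finsupp.single 1 j = exponent a b ↔
      i = a ∧ j = b := fun i j => exponent_inj
  simp only [h]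
  rw [Finset.sum_eq_single a, Finset.sum_eq_single b]
  · simp
  · intro j _ hj
    rw [if_neg (by tauto)]
  · intro hb
    rw [if_pos ⟨rfl, rfl⟩, Polynomial.coeff_eq_zero_of_natDegree_lt (n := b)
      (by rw [Finset.mem_range] at hb; omega), mul_zero]
  · intro i _ hi
    refine Finset.sum_eq_zero fun j _ => ?_
    rw [if_neg (by tauto)]
  · intro ha
    refine Finset.sum_eq_zero fun j _ => ?_
    split_ifs
    · rw [Polynomial.coeff_eq_zero_of_natDegree_lt (n := a)
        (by rw [Finset.mem_range] at ha; omega), zero_mul]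
    · rfl

theorem exists_single_of_mem_support_aeval_X {i : Fin 2} {P : Polynomial k} {e : Fin 2 →₀ ℕ}
    (he : e ∈ (Polynomial.aeval (X i : MvPolynomial (Fin 2) k) P).support) :
    ∃ j, e = Finsupp.single i j ∧ P.coeff j ≠ 0 := by
  rw [aeval_X_eq_sum, mem_support_iff, coeff_sum] at he
  obtain ⟨j, _, hj⟩ := Finset.exists_ne_zero_of_sum_ne_zero he
  rw [coeff_monomial] at hj
  split_ifs at hj with h
  · exact ⟨j, h.symm, hj⟩
  · exact absurd rfl hj

theorem aeval_X_injective (i : Fin 2) :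
    Function.Injective (Polynomial.aeval (R := k) (X i : MvPolynomial (Fin 2) k)) := by
  rw [injective_iff_map_eq_zero]
  intro P hP
  ext a
  have h0 := coeff_aeval_X_mul_aeval_X P 1 a 0
  have h1 := coeff_aeval_X_mul_aeval_X 1 P 0 a
  rw [map_one] at h0 h1
  fin_cases i
  · rw [mul_one, show Polynomial.aeval (X 0 : MvPolynomial (Fin 2) k) P = 0 from hP] at h0
    simpa using h0.symm
  · rw [one_mul, show Polynomial.aeval (X 1 : MvPolynomial (Fin 2) k) P = 0 from hP] at h1
    simpa using h1.symm

theorem standardMonomials_isLowerSet (I : Ideal (MvPolynomial (Fin 2) k)) :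
    IsLowerSet (standardMonomials I) :=
  fun _ _ hba ha p hp hp0 h => ha p hp hp0 (h.trans hba)

theorem standardMonomials_anti {I I' : Ideal (MvPolynomial (Fin 2) k)} (h : I ≤ I') :
    standardMonomials I' ⊆ standardMonomials I :=
  fun _ he p hp => he p (h hp)

/-- A relation gives an element of `I` supported on standard monomials; were it nonzero, its leading
monomial would be standard. No division is involved, so any commutative ring of coefficients will
do. Independence alone bounds the staircase by the degree, the only direction that the cost bounds
require. -/
theorem linearIndependent_standardMonomials (I : Ideal (MvPolynomial (Fin 2) k)) :
    LinearIndependent k fun e : standardMonomials I =>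
      Ideal.Quotient.mk I (monomial (e : Fin 2 →₀ ℕ) (1 : k)) := by
  rw [linearIndependent_iff']
  intro s g hg
  set p : MvPolynomial (Fin 2) k := ∑ e ∈ s, monomial (e : Fin 2 →₀ ℕ) (g e) with hp
  have hpI : p ∈ I := by
    rw [← Ideal.Quotient.eq_zero_iff_mem, ← hg, hp, map_sum]
    refine Finset.sum_congr rfl fun e _ => ?_
    have : monomial (e : Fin 2 →₀ ℕ) (g e) = g e • monomial (e : Fin 2 →₀ ℕ) (1 : k) := by
      rw [smul_monomial, smul_eq_mul, mul_one]
    rw [this]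
    exact map_smul (Ideal.Quotient.mkₐ k I) (g e) _
  have hcoeff : ∀ e : standardMonomials I, p.coeff e = if e ∈ s then g e else 0 := by
    intro e
    rw [hp, coeff_sum]
    simp only [coeff_monomial, ← Subtype.ext_iff]
    rw [Finset.sum_ite_eq' s e g]
  have hp0 : p = 0 := by
    by_contra hne
    have h1 := lexOrder.degree_mem_support hne
    have h2 : lexOrder.degree p ∈ standardMonomials I := by
      rw [hp, mem_support_iff, coeff_sum] at h1
      obtain ⟨e, _, he⟩ := Finset.exists_ne_zero_of_sum_ne_zero h1
      rw [coeff_monomial] at he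
      split_ifs at he with h
      · rw [← hp] at h
        rw [← h]
        exact e.2
      · exact absurd rfl he
    exact h2 p hpI hne le_rfl
  intro e he
  have := hcoeff e
  rw [if_pos he, hp0, coeff_zero] at this
  exact this.symm

theorem finite_standardMonomials [Nontrivial k] (I : Ideal (MvPolynomial (Fin 2) k))
    [Module.Finite k (MvPolynomial (Fin 2) k ⧸ I)] : (standardMonomials I).Finite :=
  (linearIndependent_standardMonomials I).finite

theorem ncard_standardMonomials_le [Nontrivial k] (I : Ideal (MvPolynomial (Fin 2) k))
    [Module.Finite k (MvPolynomial (Fin 2) k ⧸ I)] :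
    (standardMonomials I).ncard ≤ idealDegree I := by
  have := (finite_standardMonomials I).fintype
  rw [← Nat.card_coe_set_eq, Nat.card_eq_fintype_card]
  exact (linearIndependent_standardMonomials I).fintype_card_le_finrank

end CommRing

/-- The coefficients of a translated polynomial are its divided derivatives. -/
theorem coeff_aeval_X_add_C {k L : Type*} [CommRing k] [CommRing L] [Algebra k L] (α : Fin 2 → L)
    {f : MvPolynomial (Fin 2) k} {H : ℕ} {ℓ : ℕ → ℕ}
    (hf : ∀ e ∈ f.support, e 1 < H ∧ e 0 < ℓ (e 1)) (a b : ℕ) :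
    (aeval (fun i => (X i + C (α i) : MvPolynomial (Fin 2) L)) f).coeff (exponent a b) =
      Polynomial.evalDeriv H ℓ (fun a b => algebraMap k L (f.coeff (exponent a b))) a b
        (α 0) (α 1) := by
  conv_lhs => rw [eq_sum_monomial hf]
  simp only [map_sum, coeff_sum]
  rw [Polynomial.evalDeriv]
  refine Finset.sum_congr rfl fun j _ => ?_
  rw [Finset.mul_sum, Finset.sum_mul]
  refine Finset.sum_congr rfl fun i _ => ?_
  have h : ∀ (s : Fin 2) (n : ℕ), (X s + C (α s) : MvPolynomial (Fin 2) L) ^ n =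
      Polynomial.aeval (X s) ((Polynomial.X + Polynomial.C (α s)) ^ n) := by
    intro s n
    simp [algebraMap_eq]
  rw [monomial_exponent, map_mul, map_mul, map_pow, map_pow, aeval_X, aeval_X, aeval_C,
    IsScalarTower.algebraMap_apply k L (MvPolynomial (Fin 2) L), algebraMap_eq, mul_assoc,
    coeff_C_mul, h, h, coeff_aeval_X_mul_aeval_X, Polynomial.coeff_X_add_C_pow,
    Polynomial.coeff_X_add_C_pow]
  ring

/-! ### Staircases -/

/-- Each row of a finite lower set is an initial segment, so its length is the first missing
abscissa. -/
theorem exists_row_lengths (E : Finset (ℕ × ℕ)) (hE : IsLowerSet (E : Set (ℕ × ℕ))) :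
    ∃ (H : ℕ) (ℓ : ℕ → ℕ), (∀ a b, (a, b) ∈ E ↔ b < H ∧ a < ℓ b) ∧
      (∀ b, b < H ↔ (0, b) ∈ E) ∧ ∑ b ∈ Finset.range H, ℓ b = E.card := by
  classical
  have hex : ∀ f : ℕ → ℕ × ℕ, Function.Injective f → ∃ a, f a ∉ E := by
    intro f hf
    by_contra! h
    exact Set.infinite_of_injective_forall_mem hf h E.finite_toSet
  have hℓ : ∀ b, ∃ a, (a, b) ∉ E := fun b => hex (fun a => (a, b)) fun _ _ h => (Prod.ext_iff.1 h).1
  have hH : ∃ b, (0, b) ∉ E := hex (fun b => (0, b)) fun _ _ h => (Prod.ext_iff.1 h).2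
  have key : ∀ (g : ℕ → ℕ × ℕ) (hg : Monotone g) (h : ∃ a, g a ∉ E) (a : ℕ),
      a < Nat.find h ↔ g a ∈ E := by
    intro g hg h a
    refine ⟨fun ha => by simpa using Nat.find_min h ha, fun ha => ?_⟩
    by_contra hlt
    exact Nat.find_spec h (hE (hg (not_lt.1 hlt)) ha)
  have h1 : ∀ b a, a < Nat.find (hℓ b) ↔ (a, b) ∈ E := fun b =>
    key (fun a => (a, b)) (fun _ _ h => ⟨h, le_rfl⟩) (hℓ b)
  have h2 : ∀ b, b < Nat.find hH ↔ (0, b) ∈ E :=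
    key (fun b => (0, b)) (fun _ _ h => ⟨le_rfl, h⟩) hH
  have h3 : ∀ a b, (a, b) ∈ E → b < Nat.find hH := fun a b h =>
    (h2 b).2 (hE (show ((0, b) : ℕ × ℕ) ≤ (a, b) from ⟨Nat.zero_le a, le_rfl⟩) h)
  refine ⟨Nat.find hH, fun b => Nat.find (hℓ b), fun a b => ?_, h2, ?_⟩
  · rw [h1]
    exact ⟨fun h => ⟨h3 a b h, h⟩, fun h => h.2⟩
  · rw [Finset.card_eq_sum_card_fiberwise (f := Prod.snd) (t := Finset.range (Nat.find hH))
      fun x hx => by simpa using h3 x.1 x.2 hx]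
    refine Finset.sum_congr rfl fun b _ => ?_
    have : {x ∈ E | x.2 = b} = (Finset.range (Nat.find (hℓ b))).image fun a => (a, b) := by
      ext ⟨a, b'⟩
      simp only [Finset.mem_filter, Finset.mem_image, Finset.mem_range, Prod.mk.injEq]
      constructor
      · rintro ⟨h, rfl⟩
        exact ⟨a, (h1 _ _).2 h, rfl, rfl⟩
      · rintro ⟨a', h, rfl, rfl⟩
        exact ⟨(h1 _ _).1 h, rfl⟩
    rw [this, Finset.card_image_of_injective _ fun _ _ h => (Prod.ext_iff.1 h).1, Finset.card_range]

theorem exists_column_lengths (E : Finset (ℕ × ℕ)) (hE : IsLowerSet (E : Set (ℕ × ℕ))) :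
    ∃ (W : ℕ) (h : ℕ → ℕ), (∀ a b, (a, b) ∈ E ↔ a < W ∧ b < h a) ∧
      ∑ a ∈ Finset.range W, h a = E.card := by
  classical
  obtain ⟨W, h, h1, _, h2⟩ := exists_row_lengths (E.map (Equiv.prodComm ℕ ℕ).toEmbedding) (by
    rintro ⟨a, b⟩ ⟨a', b'⟩ hab h
    simp only [Finset.coe_map, Set.mem_image, Finset.mem_coe] at h ⊢
    obtain ⟨⟨x, y⟩, hx, hxy⟩ := h
    cases hxy
    exact ⟨(b', a'), hE (show ((b', a') : ℕ × ℕ) ≤ (x, y) from ⟨hab.2, hab.1⟩) hx, rfl⟩)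
  refine ⟨W, h, fun a b => ?_, by rw [h2, Finset.card_map]⟩
  rw [← h1]
  simp

end MvPolynomial

section Untangling

open Polynomial (exponent exponent_zero_apply exponent_one_apply exponent_eta)

variable {F : Type*} [Field F] {m : Ideal (MvPolynomial (Fin 2) F)}

/-! ### The residue field -/

theorem aeval_alpha (p : MvPolynomial (Fin 2) F) :
    aeval (alpha m) p = (Ideal.Quotient.mk m p : MvPolynomial (Fin 2) F ⧸ m) := by
  have : (aeval (alpha m) : MvPolynomial (Fin 2) F →ₐ[F] ResidueRing m) =
      (Ideal.Quotient.mkₐ F m : MvPolynomial (Fin 2) F →ₐ[F] MvPolynomial (Fin 2) F ⧸ m) :=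
    MvPolynomial.algHom_ext fun i => by rw [aeval_X]; rfl
  exact DFunLike.congr_fun this p

theorem aeval_alpha_eq_zero_iff {p : MvPolynomial (Fin 2) F} : aeval (alpha m) p = 0 ↔ p ∈ m := by
  rw [aeval_alpha]
  exact Ideal.Quotient.eq_zero_iff_mem

theorem aeval_alpha_surjective : Function.Surjective (aeval (R := F) (alpha m)) := by
  intro z
  obtain ⟨p, hp⟩ := Ideal.Quotient.mk_surjective (I := m) z
  exact ⟨p, (aeval_alpha p).trans hp⟩

variable [hm : m.IsMaximal]

include hm

theorem isDomain_residueRing : IsDomain (ResidueRing m) :=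
  inferInstanceAs (IsDomain (MvPolynomial (Fin 2) F ⧸ m))

/-- Zariski's lemma. -/
theorem finite_residueRing : Module.Finite F (ResidueRing m) := by
  have : Module.Finite F (MvPolynomial (Fin 2) F ⧸ m) := by
    let _ := Ideal.Quotient.field m
    have : Algebra.FiniteType F (MvPolynomial (Fin 2) F ⧸ m) := inferInstance
    exact finite_of_finite_type_of_isJacobsonRing F (MvPolynomial (Fin 2) F ⧸ m)
  exact this

theorem isIntegral_alpha (i : Fin 2) : IsIntegral F (alpha m i) := by
  have := finite_residueRing (m := m)
  exact Algebra.IsIntegral.isIntegral _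

omit hm in
theorem aeval_X_minpoly_mem (i : Fin 2) :
    Polynomial.aeval (X i : MvPolynomial (Fin 2) F) (minpoly F (alpha m i)) ∈ m := by
  rw [← aeval_alpha_eq_zero_iff, ← Polynomial.aeval_algHom_apply, aeval_X, minpoly.aeval]

/-! ### The Gröbner basis of a maximal ideal -/

/-- The minimal polynomial of `α i`, read in the variable `X i`, lies in `m`. Its leading monomial
is a power of `X i`, hence so is any leading monomial that divides it. A zero exponent would put `1`
in `m`. -/
theorem IsReducedGroebnerBasis.exists_degree_eq_single {T : Fin 2 → MvPolynomial (Fin 2) F}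
    (hT : IsReducedGroebnerBasis m T) (i : Fin 2) :
    ∃ j d, 0 < d ∧ lexOrder.degree (T j) = Finsupp.single i d := by
  have hP0 : Polynomial.aeval (X i : MvPolynomial (Fin 2) F) (minpoly F (alpha m i)) ≠ 0 := by
    rw [Ne, map_eq_zero_iff _ (aeval_X_injective i)]
    exact minpoly.ne_zero (isIntegral_alpha i)
  obtain ⟨j, hj⟩ := hT.exists_le _ (aeval_X_minpoly_mem i) hP0
  obtain ⟨r, hr, _⟩ := exists_single_of_mem_support_aeval_X (lexOrder.degree_mem_support hP0)
  rw [hr] at hj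
  have h1 : lexOrder.degree (T j) = Finsupp.single i (lexOrder.degree (T j) i) := by
    ext s
    by_cases hs : s = i
    · rw [hs, Finsupp.single_eq_same]
    · have := hj s
      rw [Finsupp.single_eq_of_ne hs] at this ⊢
      omega
  refine ⟨j, _, Nat.pos_of_ne_zero fun h0 => ?_, h1⟩
  rw [h0, Finsupp.single_zero, lexOrder.degree_eq_zero_iff,
    show lexOrder.leadingCoeff (T j) = 1 from hT.monic j, C_1] at h1
  exact hm.ne_top ((Ideal.eq_top_iff_one m).2 (h1 ▸ hT.mem j))

theorem IsReducedGroebnerBasis.exists_degrees {T : Fin 2 → MvPolynomial (Fin 2) F}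
    (hT : IsReducedGroebnerBasis m T) :
    ∃ d₁ d₂, 0 < d₁ ∧ 0 < d₂ ∧ lexOrder.degree (T 0) = exponent d₁ 0 ∧
      lexOrder.degree (T 1) = exponent 0 d₂ := by
  obtain ⟨i, d₁, hd₁, hi⟩ := hT.exists_degree_eq_single 0
  obtain ⟨j, d₂, hd₂, hj⟩ := hT.exists_degree_eq_single 1
  have hi' : lexOrder.degree (T i) = exponent d₁ 0 := by simp [hi, exponent]
  have hj' : lexOrder.degree (T j) = exponent 0 d₂ := by simp [hj, exponent]
  have hlt : lexOrder.toSyn (lexOrder.degree (T i)) < lexOrder.toSyn (lexOrder.degree (T j)) := by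
    rw [hi', hj', lexOrder_lt_iff]
    simp [hd₂]
  -- There are only two basis elements, so the order of their leading monomials determines which is
  -- which.
  have hij : i < j := hT.increasing.lt_iff_lt.1 hlt
  obtain ⟨rfl, rfl⟩ : i = 0 ∧ j = 1 := by omega
  exact ⟨d₁, d₂, hd₁, hd₂, hi', hj'⟩

omit hm in
theorem IsReducedGroebnerBasis.standardMonomials_eq {T : Fin 2 → MvPolynomial (Fin 2) F}
    (hT : IsReducedGroebnerBasis m T) {d₁ d₂ : ℕ}
    (h₁ : lexOrder.degree (T 0) = exponent d₁ 0) (h₂ : lexOrder.degree (T 1) = exponent 0 d₂) :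
    standardMonomials m = {e | e 0 < d₁ ∧ e 1 < d₂} := by
  have hne : ∀ i, T i ≠ 0 := fun i h => by
    have := hT.monic i
    rw [h, MonomialOrder.Monic, MonomialOrder.leadingCoeff_zero] at this
    exact zero_ne_one this
  ext e
  refine ⟨fun he => ⟨?_, ?_⟩, fun he p hp hp0 hle => ?_⟩
  · by_contra hlt
    refine he (T 0) (hT.mem 0) (hne 0) ?_
    rw [h₁, exponent_le]
    omega
  · by_contra hlt
    refine he (T 1) (hT.mem 1) (hne 1) ?_
    rw [h₂, exponent_le]
    omega
  · obtain ⟨i, hi⟩ := hT.exists_le p hp hp0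
    have h3 := hi.trans hle
    have he' : e 0 < d₁ ∧ e 1 < d₂ := he
    fin_cases i
    · rw [show lexOrder.degree (T ((fun i => i) ⟨0, by decide⟩)) = exponent d₁ 0 from h₁,
        exponent_le] at h3
      omega
    · rw [show lexOrder.degree (T ((fun i => i) ⟨1, by decide⟩)) = exponent 0 d₂ from h₂,
        exponent_le] at h3
      omega

-- Reducedness confines the lower terms of `T 1` to the box of sides `d₁` and `d₂`, and the leading
-- coefficients are `1`. So the inputs in the box determine both polynomials.
omit hm in
theorem IsReducedGroebnerBasis.isZero_alpha {T : Fin 2 → MvPolynomial (Fin 2) F}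
    (hT : IsReducedGroebnerBasis m T) {d₁ d₂ : ℕ}
    (h₁ : lexOrder.degree (T 0) = exponent d₁ 0) (h₂ : lexOrder.degree (T 1) = exponent 0 d₂)
    (f : MvPolynomial (Fin 2) F) :
    Polynomial.IsZero d₁ d₂ (fun i => (![T 0, T 1, f] i.1).coeff i.2) (alpha m 0) (alpha m 1) := by
  have hc : ∀ i, (T i).coeff (lexOrder.degree (T i)) = 1 := hT.monic
  have hz : ∀ i, aeval (alpha m) (T i) = 0 := fun i => aeval_alpha_eq_zero_iff.2 (hT.mem i)
  constructor
  · have hs : ∀ e ∈ (T 0).support, e 1 < 1 ∧ e 0 < d₁ + 1 := by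
      intro e he
      have := lexOrder.le_degree he
      rw [h₁, lexOrder_le_iff] at this
      simp at this
      omega
    have := hz 0
    rw [aeval_eq_sum (ℓ := fun _ => d₁ + 1) _ hs, Finset.sum_range_one, pow_zero, mul_one,
      Finset.sum_range_succ, ← h₁, hc 0, map_one, one_mul, add_comm] at this
    exact this
  · have hs : ∀ e ∈ (T 1).support, e 1 < d₂ + 1 ∧ e 0 < if e 1 < d₂ then d₁ else 1 := by
      intro e he
      have h3 := lexOrder.le_degree he
      have h4 := hT.reduced 1 0 (by decide) e he
      rw [h₁, exponent_le] at h4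
      rw [h₂, lexOrder_le_iff] at h3
      simp at h3
      split_ifs <;> omega
    have := hz 1
    rw [aeval_eq_sum (ℓ := fun b => if b < d₂ then d₁ else 1) _ hs, Finset.sum_range_succ,
      if_neg (lt_irrefl d₂), Finset.sum_range_one, ← h₂, hc 1, map_one, one_mul, pow_zero, one_mul,
      add_comm] at this
    rw [← this]
    congr 1
    refine Finset.sum_congr rfl fun j hj => ?_
    rw [if_pos (Finset.mem_range.1 hj)]
    rfl

/-! ### The ideals `J`, `J'` and `I` -/

omit hm in
theorem shiftHom_eq (p : MvPolynomial (Fin 2) F) :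
    shiftHom m p = translation m (MvPolynomial.map (algebraMap F (ResidueRing m)) p) := by
  simp only [shiftHom, translation, aeval_map_algebraMap]

omit hm in
theorem translation_bijective : Function.Bijective (translation m) := by
  set τ : MvPolynomial (Fin 2) (ResidueRing m) →ₐ[ResidueRing m] MvPolynomial (Fin 2) (ResidueRing m) :=
    aeval fun i => X i - C (alpha m i) with hτ
  have h1 : τ.comp (translation m) = AlgHom.id _ _ := MvPolynomial.algHom_ext fun i => by
    simp [translation, hτ, MvPolynomial.algebraMap_eq]
  have h2 : (translation m).comp τ = AlgHom.id _ _ := MvPolynomial.algHom_ext fun i => by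
    simp [translation, hτ, MvPolynomial.algebraMap_eq]
  exact Function.bijective_iff_has_inverse.2 ⟨τ, DFunLike.congr_fun h1, DFunLike.congr_fun h2⟩

variable {J : Ideal (MvPolynomial (Fin 2) (ResidueRing m))}

omit hm in
theorem translation_mem_iff {p : MvPolynomial (Fin 2) (ResidueRing m)} :
    translation m p ∈ translatedIdeal J ↔ p ∈ J := by
  rw [translatedIdeal, ← Ideal.mem_comap, Ideal.comap_map_of_bijective _ translation_bijective]

omit hm in
theorem mem_contraction_iff {p : MvPolynomial (Fin 2) F} :
    p ∈ contraction J ↔ shiftHom m p ∈ translatedIdeal J := by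
  rw [shiftHom_eq, translation_mem_iff]
  rfl

omit hm in
theorem untangling_injective : Function.Injective (untangling J) := by
  rw [injective_iff_map_eq_zero]
  intro z hz
  obtain ⟨p, rfl⟩ := Ideal.Quotient.mk_surjective z
  have : Ideal.Quotient.mk (translatedIdeal J) (shiftHom m p) = 0 := hz
  rw [Ideal.Quotient.eq_zero_iff_mem] at this ⊢
  exact mem_contraction_iff.2 this

omit hm in
theorem constantCoeff_shiftHom (p : MvPolynomial (Fin 2) F) :
    constantCoeff (shiftHom m p) = aeval (alpha m) p := by
  have : ((constantCoeff : MvPolynomial (Fin 2) (ResidueRing m) →+* ResidueRing m).comp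
      (shiftHom m : MvPolynomial (Fin 2) F →+* _)) = (aeval (alpha m) : _ →ₐ[F] ResidueRing m) := by
    refine MvPolynomial.ringHom_ext (fun c => ?_) fun i => ?_
    · simp [shiftHom, IsScalarTower.algebraMap_apply F (ResidueRing m)
        (MvPolynomial (Fin 2) (ResidueRing m)), MvPolynomial.algebraMap_eq]
    · simp [shiftHom]
  exact DFunLike.congr_fun this p

omit hm in
theorem IsPrimaryAtAlpha.constantCoeff_eq_zero (hJ : IsPrimaryAtAlpha J)
    {p : MvPolynomial (Fin 2) (ResidueRing m)} (hp : p ∈ translatedIdeal J) :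
    constantCoeff p = 0 := by
  have h : translatedIdeal J ≤ RingHom.ker (constantCoeff (R := ResidueRing m) (σ := Fin 2)) := by
    refine Ideal.map_le_iff_le_comap.2 (Ideal.le_radical.trans ?_)
    rw [hJ.2, Ideal.span_le]
    rintro _ ⟨i, rfl⟩
    simp [translation, RingHom.mem_ker, MvPolynomial.algebraMap_eq]
  exact h hp

omit hm in
theorem IsPrimaryAtAlpha.contraction_le (hJ : IsPrimaryAtAlpha J) : contraction J ≤ m := by
  intro p hp
  rw [← aeval_alpha_eq_zero_iff, ← constantCoeff_shiftHom]
  exact hJ.constantCoeff_eq_zero (mem_contraction_iff.1 hp)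

omit hm in
theorem IsPrimaryAtAlpha.exists_X_pow_mem (hJ : IsPrimaryAtAlpha J) (i : Fin 2) :
    ∃ N, X i ^ N ∈ translatedIdeal J := by
  have h : X i - C (alpha m i) ∈ J.radical := hJ.2 ▸ Ideal.subset_span ⟨i, rfl⟩
  obtain ⟨N, hN⟩ := h
  refine ⟨N, ?_⟩
  have : translation m ((X i - C (alpha m i)) ^ N) = X i ^ N := by
    simp [translation, MvPolynomial.algebraMap_eq]
  rw [← this]
  exact translation_mem_iff.2 hN

-- `P(ξᵢ + αᵢ)` is congruent to `P(αᵢ) = 0` modulo `ξᵢ`, and `ξᵢ` is nilpotent modulo `J'`.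
omit hm in
theorem IsPrimaryAtAlpha.exists_aeval_pow_mem (hJ : IsPrimaryAtAlpha J) (i : Fin 2)
    {P : Polynomial F} (hP : Polynomial.aeval (alpha m i) P = 0) :
    ∃ N, Polynomial.aeval (X i : MvPolynomial (Fin 2) F) P ^ N ∈ contraction J := by
  obtain ⟨N, hN⟩ := hJ.exists_X_pow_mem i
  refine ⟨N, mem_contraction_iff.2 ?_⟩
  have h : (X i : MvPolynomial (Fin 2) (ResidueRing m)) ∣
      shiftHom m (Polynomial.aeval (X i : MvPolynomial (Fin 2) F) P) := by
    have h1 : shiftHom m (Polynomial.aeval (X i : MvPolynomial (Fin 2) F) P) =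
        Polynomial.aeval (X i + C (alpha m i) : MvPolynomial (Fin 2) (ResidueRing m)) P := by
      rw [← Polynomial.aeval_algHom_apply, shiftHom, aeval_X]
    have h2 : Polynomial.aeval (C (alpha m i) : MvPolynomial (Fin 2) (ResidueRing m)) P = 0 := by
      rw [← MvPolynomial.algebraMap_eq, Polynomial.aeval_algebraMap_apply, hP, map_zero]
    have h3 := Polynomial.sub_dvd_eval_sub (X i + C (alpha m i))
      (C (alpha m i) : MvPolynomial (Fin 2) (ResidueRing m))
      (P.map (algebraMap F (MvPolynomial (Fin 2) (ResidueRing m))))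
    rw [Polynomial.eval_map_algebraMap, Polynomial.eval_map_algebraMap, h2, sub_zero,
      add_sub_cancel_right] at h3
    rwa [h1]
  rw [map_pow]
  exact Ideal.mem_of_dvd _ (pow_dvd_pow_of_dvd h N) hN

/-- A row of the staircase of `I` is empty or at least as long as the rows of that of `m`. -/
theorem IsPrimaryAtAlpha.exponent_mem_standardMonomials (hJ : IsPrimaryAtAlpha J) {d₁ d₂ : ℕ}
    (hd₂ : 0 < d₂) (hm' : standardMonomials m = {e | e 0 < d₁ ∧ e 1 < d₂}) {a b : ℕ} (ha : a < d₁)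
    (hb : exponent 0 b ∈ standardMonomials (contraction J)) :
    exponent a b ∈ standardMonomials (contraction J) := by
  intro p hp hp0 hle
  set e := lexOrder.degree p with he
  rw [← exponent_eta e, exponent_le] at hle
  simp only [exponent_zero_apply, exponent_one_apply] at hle
  -- It remains to find an element of `I` with leading monomial `x₂ ^ (e 1)`: this monomial divides
  -- `x₂ ^ b`, which is standard.
  refine absurd (standardMonomials_isLowerSet _
    (show exponent 0 (e 1) ≤ exponent 0 b by rw [exponent_le]; simpa using hle.2) hb) fun hb' => ?_
  clear hb
  have := isDomain_residueRing (m := m)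
  -- `c` is the coefficient of `x₂ ^ (e 1)` in `p`, a polynomial in `x₁`. Its degree `e 0 ≤ a < d₁`
  -- is too small for a nonzero element of `m`.
  set c : Polynomial F := Polynomial.ofCoeffs (e 0 + 1) fun i => p.coeff (exponent i (e 1)) with hc
  have hc0 : c ≠ 0 := by
    intro h0
    have h1 : c.coeff (e 0) = p.coeff e := by
      rw [hc, Polynomial.coeff_ofCoeffs, if_pos (Nat.lt_succ_self _), exponent_eta]
    rw [h0, Polynomial.coeff_zero] at h1
    exact mem_support_iff.1 (lexOrder.degree_mem_support hp0) h1.symm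
  have hcm : Polynomial.aeval (X 0 : MvPolynomial (Fin 2) F) c ∉ m := by
    intro hmem
    have hne : Polynomial.aeval (X 0 : MvPolynomial (Fin 2) F) c ≠ 0 := by
      rwa [Ne, map_eq_zero_iff _ (aeval_X_injective 0)]
    obtain ⟨r, hr, hr'⟩ := exists_single_of_mem_support_aeval_X (lexOrder.degree_mem_support hne)
    have h1 : exponent a 0 ∈ standardMonomials m := by
      rw [hm']
      simpa using ⟨ha, hd₂⟩
    refine h1 _ hmem hne ?_
    rw [hr, show Finsupp.single 0 r = exponent r 0 by simp [exponent], exponent_le]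
    rw [hc, Polynomial.coeff_ofCoeffs] at hr'
    split_ifs at hr' with hlt
    · simpa using hle.1.trans' (by omega)
    · exact absurd rfl hr'
  have hirr := minpoly.irreducible (isIntegral_alpha (m := m) 0)
  obtain ⟨N, hN⟩ := hJ.exists_aeval_pow_mem 0 (minpoly.aeval F (alpha m 0))
  -- Outside `m`, `c` is prime to the irreducible minimal polynomial of `α₁`, hence invertible
  -- modulo the power of it that lies in `I`. Multiplication by the inverse makes `p` monic in `x₂`.
  have hcop : IsCoprime c (minpoly F (alpha m 0) ^ N) := by
    refine IsCoprime.pow_right ((hirr.coprime_iff_not_dvd.2 fun hdvd => hcm ?_).symm)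
    obtain ⟨q, hq⟩ := hdvd
    rw [hq, map_mul]
    exact Ideal.mul_mem_right _ _ (aeval_X_minpoly_mem 0)
  obtain ⟨u, v, huv⟩ := hcop
  set A := Polynomial.aeval (R := F) (X 0 : MvPolynomial (Fin 2) F) with hA
  set p' := p - A c * X 1 ^ (e 1) with hp'
  have hsupp' : ∀ s ∈ p'.support, s 1 < e 1 := by
    intro s hs
    by_contra hlt
    refine mem_support_iff.1 hs ?_
    have h1 := coeff_aeval_X_mul_aeval_X c (Polynomial.X ^ (e 1)) (s 0) (s 1)
    rw [map_pow, Polynomial.aeval_X, exponent_eta, Polynomial.coeff_X_pow, hc,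
      Polynomial.coeff_ofCoeffs, ← hc, ← hA] at h1
    rw [hp', coeff_sub, h1]
    by_cases h2 : s 1 = e 1
    · rw [if_pos h2, mul_one]
      split_ifs with h3
      · rw [← h2, exponent_eta, sub_self]
      · rw [sub_zero]
        by_contra h4
        have := lexOrder.le_degree (mem_support_iff.2 h4)
        rw [← he, lexOrder_le_iff] at this
        omega
    · rw [if_neg h2, mul_zero, sub_zero]
      by_contra h4
      have := lexOrder.le_degree (mem_support_iff.2 h4)
      rw [← he, lexOrder_le_iff] at this
      omega
  set r := A u * p' with hr
  have hsuppr : ∀ s ∈ r.support, s 1 < e 1 := by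
    intro s hs
    classical
    obtain ⟨x, hx, y, hy, rfl⟩ := Finset.mem_add.1 (support_mul _ _ hs)
    obtain ⟨i, rfl, _⟩ := exists_single_of_mem_support_aeval_X hx
    simpa using hsupp' y hy
  have hq : X 1 ^ (e 1) + r ∈ contraction J := by
    have h1 : A u * A c + A v * A (minpoly F (alpha m 0)) ^ N = 1 := by
      rw [← map_pow, ← map_mul, ← map_mul, ← map_add, huv, map_one]
    have h2 : X 1 ^ (e 1) + r = A u * p + A v * X 1 ^ (e 1) * A (minpoly F (alpha m 0)) ^ N := by
      rw [hr, hp']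
      linear_combination (-X 1 ^ (e 1)) * h1
    rw [h2]
    exact Ideal.add_mem _ (Ideal.mul_mem_left _ _ hp) (Ideal.mul_mem_left _ _ hN)
  have hX : (X 1 ^ (e 1) : MvPolynomial (Fin 2) F) = monomial (exponent 0 (e 1)) 1 := by
    rw [monomial_exponent]; simp
  have hcoeff : (X 1 ^ (e 1) + r).coeff (exponent 0 (e 1)) = 1 := by
    have : r.coeff (exponent 0 (e 1)) = 0 := by
      by_contra h
      have := hsuppr _ (mem_support_iff.2 h)
      simp at this
    rw [coeff_add, hX, coeff_monomial, if_pos rfl, this, add_zero]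
  have hq0 : X 1 ^ (e 1) + r ≠ 0 := fun h => by simp [h] at hcoeff
  refine hb' _ hq hq0 ?_
  have hmem := lexOrder.degree_mem_support hq0
  have hle' := lexOrder.le_degree (mem_support_iff.2 (hcoeff ▸ one_ne_zero))
  rw [lexOrder_le_iff] at hle'
  rw [← exponent_eta (lexOrder.degree _), exponent_le]
  rw [mem_support_iff, coeff_add, hX, coeff_monomial] at hmem
  split_ifs at hmem with h
  · rw [hX, ← h]
    simp
  · rw [zero_add] at hmem
    have := hsuppr _ (mem_support_iff.2 hmem)
    rw [hX] at hle' 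
    simp at hle'
    omega

end Untangling

/-! ### Monomial ideals -/

namespace IsMonomialIdeal

variable {k : Type*} [CommRing k] {I : Ideal (MvPolynomial (Fin 2) k)}

/-- A monomial that is not standard is divisible by the leading monomial of some `p` in `I`. That
monomial occurs in `p`, so it is itself divisible by a generator. -/
theorem mem_of_support (hI : IsMonomialIdeal I) {q : MvPolynomial (Fin 2) k}
    (hq : ∀ e ∈ q.support, e ∉ standardMonomials I) : q ∈ I := by
  obtain ⟨S, rfl⟩ := hI
  rw [mem_ideal_span_monomial_image]
  intro e he
  have := hq e he
  simp only [standardMonomials, Set.mem_ofPred_eq] at this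
  push Not at this
  obtain ⟨p, hp, hp0, hle⟩ := this
  obtain ⟨s, hs, hs'⟩ := mem_ideal_span_monomial_image.1 hp _ (lexOrder.degree_mem_support hp0)
  exact ⟨s, hs, hs'.trans hle⟩

/-- The normal form modulo a monomial ideal is obtained by truncation. -/
theorem isNormalForm_sum (hI : IsMonomialIdeal I) {E : Finset (Fin 2 →₀ ℕ)}
    (hE : (E : Set (Fin 2 →₀ ℕ)) = standardMonomials I) (q : MvPolynomial (Fin 2) k) :
    IsNormalForm I (∑ e ∈ E, monomial e (q.coeff e)) (Ideal.Quotient.mk I q) := by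
  have hcoeff : ∀ e, (∑ e ∈ E, monomial e (q.coeff e)).coeff e = if e ∈ E then q.coeff e else 0 := by
    intro e
    rw [coeff_sum]
    simp only [coeff_monomial]
    exact Finset.sum_ite_eq' E e fun e => q.coeff e
  refine ⟨fun e he => ?_, ?_⟩
  · rw [← hE]
    by_contra h
    rw [Finset.mem_coe] at h
    rw [Finset.mem_coe, mem_support_iff, hcoeff, if_neg h] at he
    exact he rfl
  · rw [← sub_eq_zero, ← map_sub, Ideal.Quotient.eq_zero_iff_mem]
    refine hI.mem_of_support fun e he h => ?_
    rw [← hE, Finset.mem_coe] at h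
    rw [mem_support_iff, coeff_sub, hcoeff, if_pos h, sub_self] at he
    exact he rfl

theorem nonempty_basis (hI : IsMonomialIdeal I) (hfin : (standardMonomials I).Finite) :
    Nonempty (Module.Basis (standardMonomials I) k (MvPolynomial (Fin 2) k ⧸ I)) := by
  refine ⟨Module.Basis.mk (linearIndependent_standardMonomials I) ?_⟩
  intro z _
  obtain ⟨q, rfl⟩ := Ideal.Quotient.mk_surjective z
  rw [← (hI.isNormalForm_sum hfin.coe_toFinset q).2, map_sum]
  refine Submodule.sum_mem _ fun e he => ?_
  have h1 : monomial e (q.coeff e) = q.coeff e • monomial e (1 : k) := by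
    rw [smul_monomial, smul_eq_mul, mul_one]
  have h2 : Ideal.Quotient.mk I (q.coeff e • monomial e (1 : k)) =
      q.coeff e • Ideal.Quotient.mk I (monomial e (1 : k)) :=
    map_smul (Ideal.Quotient.mkₐ k I) _ _
  rw [h1, h2]
  exact Submodule.smul_mem _ _ (Submodule.subset_span ⟨⟨e, by simpa using he⟩, rfl⟩)

end IsMonomialIdeal

section Untangling

open Polynomial (exponent exponent_zero_apply exponent_one_apply exponent_eta)

variable {F : Type*} [Field F] {m : Ideal (MvPolynomial (Fin 2) F)} [hm : m.IsMaximal]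
  {J : Ideal (MvPolynomial (Fin 2) (ResidueRing m))}

/-! ### Degrees -/

include hm

theorem IsPrimaryAtAlpha.finite_standardMonomials_translatedIdeal (hJ : IsPrimaryAtAlpha J) :
    (standardMonomials (translatedIdeal J)).Finite := by
  have := isDomain_residueRing (m := m)
  choose N hN using hJ.exists_X_pow_mem
  have h : ∀ e ∈ standardMonomials (translatedIdeal J), ∀ i, e i < N i := by
    intro e he i
    by_contra hlt
    have hne : (X i ^ N i : MvPolynomial (Fin 2) (ResidueRing m)) ≠ 0 :=
      pow_ne_zero _ (X_ne_zero i)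
    refine he _ (hN i) hne ?_
    have hmem := lexOrder.degree_mem_support hne
    rw [X_pow_eq_monomial] at hmem ⊢
    rw [Finset.mem_singleton.1 (support_monomial_subset hmem)]
    simpa using hlt
  refine ((Finset.range (N 0) ×ˢ Finset.range (N 1)).image
    fun x => exponent x.1 x.2).finite_toSet.subset fun e he => ?_
  simp only [Finset.coe_image, Set.mem_image, Finset.mem_coe, Finset.mem_product, Finset.mem_range]
  exact ⟨(e 0, e 1), ⟨h e he 0, h e he 1⟩, exponent_eta e⟩

omit hm in
theorem IsPrimaryAtAlpha.zero_mem_standardMonomials (hJ : IsPrimaryAtAlpha J) :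
    0 ∈ standardMonomials (translatedIdeal J) := by
  intro p hp hp0 hle
  have h0 : lexOrder.degree p = 0 := le_antisymm hle zero_le
  have hc := hJ.constantCoeff_eq_zero hp
  have := lexOrder.degree_mem_support hp0
  rw [h0, mem_support_iff] at this
  exact this hc

theorem finite_quotient_translatedIdeal (hJ : IsPrimaryAtAlpha J)
    (hmon : IsMonomialIdeal (translatedIdeal J)) :
    Module.Finite (ResidueRing m) (MvPolynomial (Fin 2) (ResidueRing m) ⧸ translatedIdeal J) ∧
    Module.Free (ResidueRing m) (MvPolynomial (Fin 2) (ResidueRing m) ⧸ translatedIdeal J) := by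
  have hfin := hJ.finite_standardMonomials_translatedIdeal
  obtain ⟨b⟩ := hmon.nonempty_basis hfin
  have := hfin.fintype
  exact ⟨.of_basis b, .of_basis b⟩

/-- Untangling embeds this quotient in a finite-dimensional space. -/
theorem finite_quotient_contraction (hJ : IsPrimaryAtAlpha J)
    (hmon : IsMonomialIdeal (translatedIdeal J)) :
    Module.Finite F (MvPolynomial (Fin 2) F ⧸ contraction J) := by
  have := finite_residueRing (m := m)
  have := (finite_quotient_translatedIdeal hJ hmon).1
  have : Module.Finite F (MvPolynomial (Fin 2) (ResidueRing m) ⧸ translatedIdeal J) :=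
    Module.Finite.trans (ResidueRing m) _
  exact Module.Finite.of_injective (untangling J).toLinearMap untangling_injective

/-- Over a perfect field, the coordinates of `α` are in the image of the untangling map. -/
theorem IsPrimaryAtAlpha.mk_C_alpha_mem_range [PerfectField F] (hJ : IsPrimaryAtAlpha J)
    (i : Fin 2) :
    Ideal.Quotient.mk (translatedIdeal J) (C (alpha m i)) ∈ (untangling J).range := by
  have := isDomain_residueRing (m := m)
  set P := minpoly F (alpha m i) with hP
  have hsep : P.Separable :=
    PerfectField.separable_of_irreducible (minpoly.irreducible (isIntegral_alpha i))
  set x : MvPolynomial (Fin 2) F ⧸ contraction J := Ideal.Quotient.mk _ (X i) with hx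
  have haeval : ∀ Q : Polynomial F, Polynomial.aeval x Q =
      Ideal.Quotient.mk (contraction J) (Polynomial.aeval (X i) Q) := fun Q =>
    Polynomial.aeval_algHom_apply (Ideal.Quotient.mkₐ F (contraction J)) (X i) Q
  have hnil : IsNilpotent (Polynomial.aeval x P) := by
    obtain ⟨N, hN⟩ := hJ.exists_aeval_pow_mem i (minpoly.aeval F (alpha m i))
    refine ⟨N, ?_⟩
    rw [haeval, ← map_pow, Ideal.Quotient.eq_zero_iff_mem]
    exact hN
  have hunit : IsUnit (Polynomial.aeval x (Polynomial.derivative P)) := by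
    obtain ⟨u, v, huv⟩ := hsep
    have h1 := congrArg (Polynomial.aeval x) huv
    rw [map_add, map_mul, map_mul, map_one] at h1
    have h2 : IsUnit (Polynomial.aeval x v * Polynomial.aeval x (Polynomial.derivative P)) := by
      rw [eq_sub_of_add_eq' h1]
      exact ((Commute.all _ _).isNilpotent_mul_left hnil).isUnit_one_sub
    exact isUnit_of_mul_isUnit_right h2
  -- Newton lifting: `P` takes a nilpotent value at `x` and its derivative a unit, by separability.
  -- So `P` has exactly one root at nilpotent distance from `x`.
  obtain ⟨r, ⟨hr, hr0⟩, _⟩ := Polynomial.existsUnique_nilpotent_sub_and_aeval_eq_zero hnil hunit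
  set π := untangling J with hπ
  have hnil' : IsNilpotent (Polynomial.aeval (π x) P) := by
    rw [Polynomial.aeval_algHom_apply]; exact hnil.map π
  have hunit' : IsUnit (Polynomial.aeval (π x) (Polynomial.derivative P)) := by
    rw [Polynomial.aeval_algHom_apply]; exact hunit.map π
  -- Both `π r` and `αᵢ` are roots of `P` at nilpotent distance from `π x = ξᵢ + αᵢ`, so uniqueness
  -- on the target side identifies them.
  have huniq := (Polynomial.existsUnique_nilpotent_sub_and_aeval_eq_zero hnil' hunit').unique
    (y₁ := π r) (y₂ := Ideal.Quotient.mk (translatedIdeal J) (C (alpha m i))) ⟨?_, ?_⟩ ⟨?_, ?_⟩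
  · exact ⟨r, huniq⟩
  · rw [← map_sub]; exact hr.map π
  · rw [Polynomial.aeval_algHom_apply, hr0, map_zero]
  · obtain ⟨N, hN⟩ := hJ.exists_X_pow_mem i
    refine ⟨N, ?_⟩
    have hπx : π x = Ideal.Quotient.mk (translatedIdeal J) (X i + C (alpha m i)) := by
      have : π x = Ideal.Quotient.mk (translatedIdeal J) (shiftHom m (X i)) := rfl
      rw [this, shiftHom, aeval_X]
    rw [hπx, ← map_sub, add_sub_cancel_right, ← map_pow, Ideal.Quotient.eq_zero_iff_mem]
    exact hN
  · have : Ideal.Quotient.mk (translatedIdeal J) (C (alpha m i)) = algebraMap (ResidueRing m)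
        (MvPolynomial (Fin 2) (ResidueRing m) ⧸ translatedIdeal J) (alpha m i) := rfl
    rw [this, Polynomial.aeval_algebraMap_apply, minpoly.aeval, map_zero]

theorem untangling_surjective [PerfectField F] (hJ : IsPrimaryAtAlpha J) :
    Function.Surjective (untangling J) := by
  have hX : ∀ i, Ideal.Quotient.mk (translatedIdeal J) (X i) ∈ (untangling J).range := by
    intro i
    have h1 : Ideal.Quotient.mk (translatedIdeal J) (X i + C (alpha m i)) ∈
        (untangling J).range := by
      refine ⟨Ideal.Quotient.mk _ (X i), ?_⟩
      have : untangling J (Ideal.Quotient.mk _ (X i)) =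
          Ideal.Quotient.mk (translatedIdeal J) (shiftHom m (X i)) := rfl
      exact this.trans (by rw [shiftHom, aeval_X])
    have h2 := Subalgebra.sub_mem _ h1 (hJ.mk_C_alpha_mem_range i)
    rwa [← map_sub, add_sub_cancel_right] at h2
  have hC : ∀ c, Ideal.Quotient.mk (translatedIdeal J) (C c) ∈ (untangling J).range := by
    intro c
    obtain ⟨p, rfl⟩ := aeval_alpha_surjective c
    have h1 : Ideal.Quotient.mk (translatedIdeal J) (C (aeval (alpha m) p)) =
        aeval (fun i => Ideal.Quotient.mk (translatedIdeal J) (C (alpha m i))) p :=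
      (MvPolynomial.comp_aeval_apply (alpha m) (IsScalarTower.toAlgHom F (ResidueRing m)
        (MvPolynomial (Fin 2) (ResidueRing m) ⧸ translatedIdeal J)) p)
    rw [h1]
    clear h1
    induction p using MvPolynomial.induction_on with
    | C a => rw [aeval_C]; exact Subalgebra.algebraMap_mem _ a
    | add p q hp hq => rw [map_add]; exact Subalgebra.add_mem _ hp hq
    | mul_X p i hp =>
      rw [map_mul, aeval_X]
      exact Subalgebra.mul_mem _ hp (hJ.mk_C_alpha_mem_range i)
  intro z
  obtain ⟨q, rfl⟩ := Ideal.Quotient.mk_surjective z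
  change Ideal.Quotient.mk (translatedIdeal J) q ∈ (untangling J).range
  induction q using MvPolynomial.induction_on with
  | C a => exact hC a
  | add p q hp hq => rw [map_add]; exact Subalgebra.add_mem _ hp hq
  | mul_X p i hp => rw [map_mul]; exact Subalgebra.mul_mem _ hp (hX i)

/-- Surjectivity of untangling yields this inequality of dimensions, which is all that the last
bound needs. -/
theorem idealDegree_mul_le [PerfectField F] (hJ : IsPrimaryAtAlpha J)
    (hmon : IsMonomialIdeal (translatedIdeal J)) :
    idealDegree m * idealDegree (translatedIdeal J) ≤ idealDegree (contraction J) := by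
  have := isDomain_residueRing (m := m)
  have := (finite_quotient_translatedIdeal hJ hmon).2
  have := finite_quotient_contraction hJ hmon
  have h1 : idealDegree m = Module.finrank F (ResidueRing m) := rfl
  rw [h1, idealDegree, Module.finrank_mul_finrank F (ResidueRing m)]
  exact LinearMap.finrank_le_finrank_of_surjective (f := (untangling J).toLinearMap)
    (untangling_surjective hJ)

-- The image of an element of `m` has constant coefficient zero, so here all its monomials lie in
-- `J'`.
omit hm in
theorem le_contraction_of_standardMonomials_eq (hmon : IsMonomialIdeal (translatedIdeal J))
    (h : standardMonomials (translatedIdeal J) = {0}) : m ≤ contraction J := by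
  intro p hp
  refine mem_contraction_iff.2 (hmon.mem_of_support fun e he he' => ?_)
  rw [h, Set.mem_singleton_iff] at he'
  rw [he', mem_support_iff] at he
  exact he ((constantCoeff_shiftHom p).trans (aeval_alpha_eq_zero_iff.2 hp))

end Untangling

section Untangling

open Polynomial (exponent exponent_zero_apply exponent_one_apply exponent_eta EvaluatesDerivatives)

universe u

variable {F : Type u} [Field F]

/-! ### Programs for the untangling map -/

/-- The program `P` computes the untangling map for all ideals with the given monomial bases. -/
def IsUntanglingProgram
    (P : StraightLineProgram F (Fin 3 × (Fin 2 →₀ ℕ)) ((Fin 2 →₀ ℕ) × (Fin 2 →₀ ℕ)))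
    (S₁ S₂ S₃ : Set (Fin 2 →₀ ℕ)) : Prop :=
  ∀ (m : Ideal (MvPolynomial (Fin 2) F)) [m.IsMaximal] (T : Fin 2 → MvPolynomial (Fin 2) F)
    (J : Ideal (MvPolynomial (Fin 2) (ResidueRing m))), IsReducedGroebnerBasis m T →
    IsPrimaryAtAlpha J → IsMonomialIdeal (translatedIdeal J) → standardMonomials m = S₁ →
    standardMonomials (contraction J) = S₂ → standardMonomials (translatedIdeal J) = S₃ →
    ComputesUntangling P T J

theorem coeff_sum_sum_monomial (d₁ d₂ : ℕ) (c : ℕ → ℕ → F) (s : Fin 2 →₀ ℕ) :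
    (∑ j ∈ Finset.range d₂, ∑ i ∈ Finset.range d₁, monomial (exponent i j) (c i j)).coeff s =
      if s 0 < d₁ ∧ s 1 < d₂ then c (s 0) (s 1) else 0 := by
  have h : ∀ i j, exponent i j = s ↔ i = s 0 ∧ j = s 1 := fun i j => by
    conv_lhs => rw [← exponent_eta s, exponent_inj]
  simp only [coeff_sum, coeff_monomial, h, ite_and]
  have h2 : ∀ j, (∑ i ∈ Finset.range d₁, if i = s 0 then if j = s 1 then c i j else 0 else 0) =
      if j = s 1 then (if s 0 < d₁ then c (s 0) j else 0) else 0 := by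
    intro j
    rw [Finset.sum_ite_eq' (Finset.range d₁) (s 0)]
    simp only [Finset.mem_range]
    split_ifs <;> rfl
  simp only [h2]
  rw [Finset.sum_ite_eq' (Finset.range d₂) (s 1)]
  simp only [Finset.mem_range]
  split_ifs <;> rfl

/-- Programs are chosen from monomial bases alone, so the sides of the box have to be recovered from
the set; its extreme points on the axes do that. -/
theorem eq_of_box_eq {d₁ d₂ d₁' d₂' : ℕ} (h₁ : 0 < d₁) (h₂ : 0 < d₂) (h₁' : 0 < d₁') (h₂' : 0 < d₂')
    (h : {e : Fin 2 →₀ ℕ | e 0 < d₁ ∧ e 1 < d₂} = {e | e 0 < d₁' ∧ e 1 < d₂'}) :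
    d₁ = d₁' ∧ d₂ = d₂' := by
  have key : ∀ a b, (a < d₁ ∧ b < d₂) ↔ (a < d₁' ∧ b < d₂') := fun a b => by
    have := Set.ext_iff.1 h (exponent a b)
    simpa using this
  have k1 := key (d₁ - 1) 0
  have k2 := key (d₁' - 1) 0
  have k3 := key 0 (d₂ - 1)
  have k4 := key 0 (d₂' - 1)
  omega

theorem isUntanglingProgram_of_evaluatesDerivatives
    {P : StraightLineProgram F (Fin 3 × (Fin 2 →₀ ℕ)) ((Fin 2 →₀ ℕ) × (Fin 2 →₀ ℕ))}
    {d₁ d₂ H : ℕ} {ℓ : ℕ → ℕ} {E : Finset (ℕ × ℕ)} (hP : EvaluatesDerivatives P d₁ d₂ H ℓ E)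
    (hd₁ : 0 < d₁) (hd₂ : 0 < d₂) {S₂ S₃ : Set (Fin 2 →₀ ℕ)}
    (hS₂ : ∀ e ∈ S₂, e 1 < H ∧ e 0 < ℓ (e 1)) (hS₃ : ∀ a b, (a, b) ∈ E ↔ exponent a b ∈ S₃) :
    IsUntanglingProgram P {e | e 0 < d₁ ∧ e 1 < d₂} S₂ S₃ := by
  rintro m _ T J hT hJ hmon hm rfl rfl f hf
  obtain ⟨d₁', d₂', hd₁', hd₂', h₁, h₂⟩ := hT.exists_degrees
  have hbox := hT.standardMonomials_eq h₁ h₂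
  obtain ⟨rfl, rfl⟩ := eq_of_box_eq hd₁ hd₂ hd₁' hd₂' (hm.symm.trans hbox)
  obtain ⟨y, hy, hy0, hyE⟩ := hP fun i => (![T 0, T 1, f] i.1).coeff i.2
  have hfin := hJ.finite_standardMonomials_translatedIdeal
  -- These representatives are supported in the box, that is, on the standard monomials of `m`,
  -- hence they are normal forms.
  set g : (Fin 2 →₀ ℕ) → MvPolynomial (Fin 2) F := fun e =>
    ∑ j ∈ Finset.range d₂, ∑ i ∈ Finset.range d₁, monomial (exponent i j) (y (e, exponent i j))
    with hg
  have hgc : ∀ e s, (g e).coeff s = if s 0 < d₁ ∧ s 1 < d₂ then y (e, s) else 0 := fun e s => by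
    rw [hg, coeff_sum_sum_monomial d₁ d₂ (fun i j => y (e, exponent i j)), exponent_eta]
  refine ⟨_, g, hmon.isNormalForm_sum hfin.coe_toFinset (shiftHom m f), fun e => ⟨?_, ?_⟩, ?_⟩
  · intro s hs
    rw [hm]
    by_contra h
    rw [Finset.mem_coe, mem_support_iff, hgc] at hs
    exact hs (if_neg h)
  · have h3 : (∑ e ∈ hfin.toFinset, monomial e ((shiftHom m f).coeff e)).coeff e =
        if e ∈ hfin.toFinset then (shiftHom m f).coeff e else 0 := by
      rw [coeff_sum]
      simp only [coeff_monomial]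
      exact Finset.sum_ite_eq' _ e fun e => (shiftHom m f).coeff e
    have h4 : aeval (alpha m) (g e) = ∑ j ∈ Finset.range d₂, (∑ i ∈ Finset.range d₁,
        algebraMap F (ResidueRing m) (y (e, exponent i j)) * alpha m 0 ^ i) * alpha m 1 ^ j := by
      simp only [hg, map_sum, monomial_exponent, map_mul, map_pow, aeval_C, aeval_X, Finset.sum_mul]
    refine (aeval_alpha (g e)).symm.trans (h4.trans (Eq.trans ?_ h3.symm))
    have hmem := hS₃ (e 0) (e 1)
    rw [exponent_eta] at hmem
    split_ifs with he
    · have := hyE (ResidueRing m) _ _ (hT.isZero_alpha h₁ h₂ f) (e 0) (e 1)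
        (hmem.2 (hfin.mem_toFinset.1 he))
      rw [exponent_eta] at this
      rw [this, ← exponent_eta e, exponent_zero_apply, exponent_one_apply]
      exact (coeff_aeval_X_add_C (alpha m) (fun s hs => hS₂ s (hf hs)) _ _).symm
    · refine Finset.sum_eq_zero fun j _ => ?_
      rw [Finset.sum_eq_zero, zero_mul]
      intro i _
      rw [hy0, map_zero, zero_mul]
      exact fun h => he (hfin.mem_toFinset.2 (hmem.1 h.1))
  · have : y = fun q => (g q.1).coeff q.2 := by
      funext q
      rw [hgc]
      split_ifs with h
      · rfl
      · exact hy0 q fun h' => h h'.2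
    rwa [← this]

/-- If `J'` is the maximal ideal at the origin, no operation is needed. -/
theorem exists_isUntanglingProgram_of_eq_zero (S₁ S₂ : Set (Fin 2 →₀ ℕ)) :
    ∃ P : StraightLineProgram F (Fin 3 × (Fin 2 →₀ ℕ)) ((Fin 2 →₀ ℕ) × (Fin 2 →₀ ℕ)),
      IsUntanglingProgram P S₁ S₂ {0} ∧ P.cost = 0 := by
  classical
  refine ⟨⟨[], fun q => if q.1 = 0 then .input (2, q.2) else .const 0⟩, ?_, rfl⟩
  rintro m _ T J hT hJ hmon rfl rfl h0 f hf
  have hle := le_contraction_of_standardMonomials_eq hmon h0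
  have hcoeff : ∀ e, (∑ e ∈ ({0} : Finset (Fin 2 →₀ ℕ)),
      monomial e ((shiftHom m f).coeff e)).coeff e =
        if e = 0 then aeval (alpha m) f else 0 := by
    intro e
    rw [Finset.sum_singleton, coeff_monomial, ← constantCoeff_shiftHom]
    simp only [eq_comm (a := (0 : Fin 2 →₀ ℕ))]
    rfl
  refine ⟨_, fun e => if e = 0 then f else 0,
    hmon.isNormalForm_sum (E := {0}) (by rw [h0, Finset.coe_singleton]) (shiftHom m f),
    fun e => ⟨?_, ?_⟩, [], rfl, fun q => ?_⟩
  · beta_reduce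
    split_ifs
    -- Since `m ≤ I`, the monomials standard for `I` are standard for `m`; so `f` is already the
    -- normal form of the only coefficient.
    · exact hf.trans (standardMonomials_anti hle)
    · simp
  · refine Eq.trans ?_ (hcoeff e).symm
    beta_reduce
    split_ifs
    · exact (aeval_alpha f).symm
    · exact map_zero _
  · simp only
    split_ifs
    · rfl
    · simp [Operand.val]

open Classical in
/-- A program of minimal cost for the untangling map. -/
noncomputable def optimalUntangling (F : Type u) [Field F] : UntanglingAlgorithm F :=
  fun S₁ S₂ S₃ =>
    if h : {P : StraightLineProgram F (Fin 3 × (Fin 2 →₀ ℕ)) ((Fin 2 →₀ ℕ) × (Fin 2 →₀ ℕ)) |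
        IsUntanglingProgram P S₁ S₂ S₃}.Nonempty then
      Function.argminOn StraightLineProgram.cost _ h
    else ⟨[], fun _ => .const 0⟩

/-- By minimality, the bound for any correct program passes to the chosen one. This is why one
recipe can serve for all three bounds. -/
theorem optimalUntangling_untangles {m : Ideal (MvPolynomial (Fin 2) F)} [m.IsMaximal]
    {T : Fin 2 → MvPolynomial (Fin 2) F} {J : Ideal (MvPolynomial (Fin 2) (ResidueRing m))}
    (hT : IsReducedGroebnerBasis m T) (hJ : IsPrimaryAtAlpha J)
    (hmon : IsMonomialIdeal (translatedIdeal J))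
    {P : StraightLineProgram F (Fin 3 × (Fin 2 →₀ ℕ)) ((Fin 2 →₀ ℕ) × (Fin 2 →₀ ℕ))}
    (hP : IsUntanglingProgram P (standardMonomials m) (standardMonomials (contraction J))
      (standardMonomials (translatedIdeal J))) {B : ℝ} (hB : (P.cost : ℝ) ≤ B) :
    (optimalUntangling F).Untangles T J B := by
  have hne : {P : StraightLineProgram F _ _ | IsUntanglingProgram P (standardMonomials m)
      (standardMonomials (contraction J)) (standardMonomials (translatedIdeal J))}.Nonempty :=
    ⟨P, hP⟩
  rw [UntanglingAlgorithm.Untangles, optimalUntangling, dif_pos hne]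
  refine ⟨Function.argminOn_mem StraightLineProgram.cost _ hne m T J hT hJ hmon rfl rfl rfl, ?_⟩
  refine le_trans ?_ hB
  exact_mod_cast Function.argminOn_le StraightLineProgram.cost _ hP

/-! ### The bounds -/

theorem exists_finset_of_finite {S : Set (Fin 2 →₀ ℕ)} (hS : S.Finite) :
    ∃ E : Finset (ℕ × ℕ), (∀ a b, (a, b) ∈ E ↔ exponent a b ∈ S) ∧ E.card = S.ncard := by
  classical
  refine ⟨hS.toFinset.image fun e => (e 0, e 1), fun a b => ?_, ?_⟩
  · rw [Finset.mem_image]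
    constructor
    · rintro ⟨e, he, h⟩
      rw [Prod.mk.injEq] at h
      rw [← h.1, ← h.2, exponent_eta]
      exact hS.mem_toFinset.1 he
    · exact fun h => ⟨exponent a b, hS.mem_toFinset.2 h, by simp⟩
  · rw [Finset.card_image_of_injective, Set.ncard_eq_toFinset_card _ hS]
    intro e e' h
    rw [← exponent_eta e, ← exponent_eta e']
    simp only [Prod.mk.injEq] at h
    rw [h.1, h.2]

theorem IsMultiplicationTime.mono {M : ℕ → ℕ} (hM : IsMultiplicationTime F M) {a b : ℕ}
    (ha : 0 < a) (hab : a ≤ b) : M a ≤ M b := by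
  obtain ⟨c, rfl⟩ := Nat.exists_eq_add_of_le hab
  rcases Nat.eq_zero_or_pos c with rfl | hc
  · simp
  · exact (Nat.le_add_right _ _).trans (hM.superadditive a c ha hc)

theorem factorial_ne_zero_of_lt {n i : ℕ} (hchar : ringChar F = 0 ∨ n ≤ ringChar F) (hi : i < n) :
    (i.factorial : F) ≠ 0 := by
  rw [Ne, CharP.cast_eq_zero_iff F (ringChar F)]
  intro hdvd
  rcases CharP.char_is_prime_or_zero F (ringChar F) with hp | hp
  · have := hp.dvd_factorial.1 hdvd
    have := hp.pos
    omega
  · rw [hp, zero_dvd_iff] at hdvd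
    exact Nat.factorial_ne_zero i hdvd

/-- The two programs, with bounds in terms of the degrees `δ ≤ d`, `ε ≤ μ` and `N ≤ n` (which are
in fact equalities) of `m`, `J'` and `I`. -/
theorem exists_isUntanglingProgram [PerfectField F] {M : ℕ → ℕ} (hM : IsMultiplicationTime F M)
    {m : Ideal (MvPolynomial (Fin 2) F)} [m.IsMaximal]
    {T : Fin 2 → MvPolynomial (Fin 2) F} {J : Ideal (MvPolynomial (Fin 2) (ResidueRing m))}
    (hT : IsReducedGroebnerBasis m T) (hJ : IsPrimaryAtAlpha J)
    (hmon : IsMonomialIdeal (translatedIdeal J))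
    (hchar : ringChar F = 0 ∨ idealDegree (contraction J) ≤ ringChar F) :
    ∃ δ ε N : ℕ, 0 < δ ∧ 0 < ε ∧ 0 < N ∧ δ ≤ idealDegree m ∧ ε ≤ idealDegree (translatedIdeal J) ∧
      N ≤ idealDegree (contraction J) ∧
      (∃ P : StraightLineProgram F (Fin 3 × (Fin 2 →₀ ℕ)) ((Fin 2 →₀ ℕ) × (Fin 2 →₀ ℕ)),
        IsUntanglingProgram P (standardMonomials m) (standardMonomials (contraction J))
          (standardMonomials (translatedIdeal J)) ∧ P.cost ≤ 72246 * M (δ * N)) ∧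
      (∃ P : StraightLineProgram F (Fin 3 × (Fin 2 →₀ ℕ)) ((Fin 2 →₀ ℕ) × (Fin 2 →₀ ℕ)),
        IsUntanglingProgram P (standardMonomials m) (standardMonomials (contraction J))
          (standardMonomials (translatedIdeal J)) ∧ P.cost ≤ 12956 * M (ε * N)) ∧
      (ε = 1 → ∃ P : StraightLineProgram F (Fin 3 × (Fin 2 →₀ ℕ)) ((Fin 2 →₀ ℕ) × (Fin 2 →₀ ℕ)),
        IsUntanglingProgram P (standardMonomials m) (standardMonomials (contraction J))
          (standardMonomials (translatedIdeal J)) ∧ P.cost = 0) := by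
  have := isDomain_residueRing (m := m)
  have : Module.Finite F (MvPolynomial (Fin 2) F ⧸ m) := finite_residueRing (m := m)
  have := (finite_quotient_translatedIdeal hJ hmon).1
  have := finite_quotient_contraction hJ hmon
  obtain ⟨d₁, d₂, hd₁, hd₂, h₁, h₂⟩ := hT.exists_degrees
  have hbox := hT.standardMonomials_eq h₁ h₂
  obtain ⟨E₁, hE₁, hE₁c⟩ := exists_finset_of_finite (finite_standardMonomials m)
  obtain ⟨E₂, hE₂, hE₂c⟩ := exists_finset_of_finite (finite_standardMonomials (contraction J))
  obtain ⟨E₃, hE₃, hE₃c⟩ := exists_finset_of_finite (finite_standardMonomials (translatedIdeal J))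
  have hδ : d₁ * d₂ = E₁.card := by
    have : E₁ = Finset.range d₁ ×ˢ Finset.range d₂ := by
      ext ⟨a, b⟩
      rw [hE₁, hbox]
      simp
    rw [this, Finset.card_product, Finset.card_range, Finset.card_range]
  have hlow : IsLowerSet (E₂ : Set (ℕ × ℕ)) := by
    rintro ⟨a, b⟩ ⟨a', b'⟩ hab h
    rw [Finset.mem_coe, hE₂] at h ⊢
    refine standardMonomials_isLowerSet _ ?_ h
    rw [exponent_le]
    simpa using hab
  obtain ⟨H, ℓ, hmem, hH, hsum⟩ := exists_row_lengths E₂ hlow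
  obtain ⟨W, h, hmem', hsum'⟩ := exists_column_lengths E₂ hlow
  have hsub := standardMonomials_anti hJ.contraction_le
  have hd₂H : d₂ ≤ H := by
    have : d₂ - 1 < H := by
      rw [hH, hE₂]
      refine hsub ?_
      rw [hbox]
      simp
      omega
    omega
  have hℓ : ∀ b < H, d₁ ≤ ℓ b := by
    intro b hb
    rw [hH, hE₂] at hb
    have := hJ.exponent_mem_standardMonomials hd₂ hbox (a := d₁ - 1) (by omega) hb
    rw [← hE₂, hmem] at this
    omega
  have hε : 0 < E₃.card := by
    refine Finset.card_pos.2 ⟨(0, 0), (hE₃ 0 0).2 ?_⟩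
    convert hJ.zero_mem_standardMonomials
    simp [exponent]
  have hN : 0 < ∑ b ∈ Finset.range H, ℓ b := by
    rw [hsum]
    refine Finset.card_pos.2 ⟨(0, 0), (hE₂ 0 0).2 (hsub ?_)⟩
    rw [hbox]
    simp [hd₁, hd₂]
  have hNn : ∑ b ∈ Finset.range H, ℓ b ≤ idealDegree (contraction J) := by
    rw [hsum, hE₂c]
    exact ncard_standardMonomials_le _
  have hS₂ : ∀ e ∈ standardMonomials (contraction J), e 1 < H ∧ e 0 < ℓ (e 1) := by
    intro e he
    rwa [← exponent_eta e, ← hE₂, hmem] at he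
  have hfac : ∀ i < ∑ b ∈ Finset.range H, ℓ b, (i.factorial : F) ≠ 0 := fun i hi =>
    factorial_ne_zero_of_lt hchar (hi.trans_le hNn)
  refine ⟨d₁ * d₂, E₃.card, ∑ b ∈ Finset.range H, ℓ b, Nat.mul_pos hd₁ hd₂, hε, hN, ?_, ?_, hNn,
    ?_, ?_, ?_⟩
  · rw [hδ, hE₁c]
    exact ncard_standardMonomials_le _
  · rw [hE₃c]
    exact ncard_standardMonomials_le _
  -- No row or column is longer than the whole staircase, which has at most `n` elements, so the
  -- factorials that occur are invertible.
  · obtain ⟨P, hP, hcost⟩ := Polynomial.exists_evaluatesDerivatives_of_factorial hM hd₁ hd₂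
      (H := H) (W := W) (ℓ := ℓ) (h := h)
      (fun b hb i hi => hfac i (hi.trans_le
        (Finset.single_le_sum (f := ℓ) (fun _ _ => Nat.zero_le _) (Finset.mem_range.2 hb))))
      (fun a ha i hi => hfac i (hi.trans_le ((Finset.single_le_sum (f := h)
        (fun _ _ => Nat.zero_le _) (Finset.mem_range.2 ha)).trans (hsum'.trans hsum.symm).le)))
      (fun a b hb ha => (hmem' a b).1 ((hmem a b).2 ⟨hb, ha⟩)) (hsum'.trans hsum.symm) hN E₃
    refine ⟨P, ?_, hcost⟩
    rw [hbox]
    exact isUntanglingProgram_of_evaluatesDerivatives hP hd₁ hd₂ hS₂ hE₃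
  · obtain ⟨P, hP, hcost⟩ := Polynomial.exists_evaluatesDerivatives hM hd₁ hd₂ hℓ hd₂H E₃
      (Finset.card_pos.1 hε)
    refine ⟨P, ?_, hcost⟩
    rw [hbox]
    exact isUntanglingProgram_of_evaluatesDerivatives hP hd₁ hd₂ hS₂ hE₃
  · intro h1
    rw [hE₃c, Set.ncard_eq_one] at h1
    obtain ⟨e, he⟩ := h1
    have h0 := hJ.zero_mem_standardMonomials
    rw [he, Set.mem_singleton_iff] at h0
    rw [he, ← h0]
    exact exists_isUntanglingProgram_of_eq_zero _ _

theorem half_le_log {k : ℕ} (hk : 2 ≤ k) : 1 / 2 ≤ Real.log k := by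
  have h1 := Real.log_two_gt_d9
  have h2 : Real.log 2 ≤ Real.log k := Real.log_le_log (by norm_num) (by exact_mod_cast hk)
  linarith

/-- Here `a ≤ √n` and `N ≤ n`; the product is an integer, so taking the floor of `n ^ 1.5` loses
nothing. -/
theorem mul_le_floor_rpow {a N n : ℕ} (ha : a * a ≤ n) (hN : N ≤ n) :
    a * N ≤ ⌊(n : ℝ) ^ (1.5 : ℝ)⌋₊ := by
  refine Nat.le_floor ?_
  have h1 : (n : ℝ) ^ (1.5 : ℝ) = √n * n := by
    rw [show (1.5 : ℝ) = 1 / 2 + 1 by norm_num, Real.rpow_add_one' (by positivity) (by norm_num),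
      ← Real.sqrt_eq_rpow]
  rw [h1]
  push_cast
  refine mul_le_mul (Real.le_sqrt_of_sq_le ?_) (by exact_mod_cast hN) (by positivity)
    (by positivity)
  rw [sq]
  exact_mod_cast ha

end Untangling

/-! ### The main theorem. -/

theorem proposition4 :
    ∃ c : ℝ, ∀ (F : Type*) [Field F] [PerfectField F] (M : ℕ → ℕ), IsMultiplicationTime F M →
      ∃ A₁ A₂ A₃ : UntanglingAlgorithm F,
        ∀ (m : Ideal (MvPolynomial (Fin 2) F)) [m.IsMaximal]
          (T : Fin 2 → MvPolynomial (Fin 2) F)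
          (J : Ideal (MvPolynomial (Fin 2) (ResidueRing m))) (d μ n : ℕ),
          IsReducedGroebnerBasis m T →
          IsPrimaryAtAlpha J →
          d = idealDegree m → μ = idealDegree (translatedIdeal J) →
          n = idealDegree (contraction J) →
          (ringChar F = 0 ∨ n ≤ ringChar F) →
          IsMonomialIdeal (translatedIdeal J) →
          A₁.Untangles T J (c * M (d * n)) ∧
          A₂.Untangles T J (c * (M (μ * n) * Real.log μ)) ∧
          A₃.Untangles T J (c * (M ⌊(n : ℝ) ^ (1.5 : ℝ)⌋₊ * Real.log n)) := by
  -- Twice `72246`, the larger of the two constants, because `log k ≥ 1 / 2` for `k ≥ 2`.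
  refine ⟨144492, fun F _ _ M hM => ⟨optimalUntangling F, optimalUntangling F, optimalUntangling F,
    ?_⟩⟩
  rintro m _ T J d μ n hT hJ rfl rfl rfl hchar hmon
  have hdμ := idealDegree_mul_le hJ hmon
  obtain ⟨δ, ε, N, hδ, hε, hN, hδd, hεμ, hNn, ⟨P₁, hP₁, hc₁⟩, ⟨P₂, hP₂, hc₂⟩, h₀⟩ :=
    exists_isUntanglingProgram hM hT hJ hmon hchar
  set d := idealDegree m
  set μ := idealDegree (translatedIdeal J)
  set n := idealDegree (contraction J)
  have hlog : ∀ {K B k : ℕ}, K ≤ 72246 * M B → 2 ≤ k →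
      (K : ℝ) ≤ 144492 * (M B * Real.log k) := by
    intro K B k hK hk
    have h1 := half_le_log hk
    have h2 : (K : ℝ) ≤ 72246 * M B := by exact_mod_cast hK
    have h3 : (0 : ℝ) ≤ M B := Nat.cast_nonneg _
    nlinarith [mul_le_mul_of_nonneg_left h1 h3]
  refine ⟨?_, ?_⟩
  · refine optimalUntangling_untangles hT hJ hmon hP₁ ?_
    have h1 := hM.mono (Nat.mul_pos hδ hN) (Nat.mul_le_mul hδd hNn)
    exact_mod_cast (show P₁.cost ≤ 144492 * M (d * n) by omega)
  -- At `μ = 1` the logarithm is zero, so only a program without operations meets the bound. If `ε ≠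
  -- 1`, then `μ` and `n` are at least `2`.
  by_cases hε1 : ε = 1
  · obtain ⟨P, hP, hc⟩ := h₀ hε1
    have hlog0 := Real.log_natCast_nonneg
    refine ⟨optimalUntangling_untangles hT hJ hmon hP ?_,
      optimalUntangling_untangles hT hJ hmon hP ?_⟩ <;> rw [hc, Nat.cast_zero]
    · have := hlog0 μ
      positivity
    · have := hlog0 n
      positivity
  · have hδε : δ * ε ≤ n := (Nat.mul_le_mul hδd hεμ).trans hdμ
    have hεn : ε ≤ n := (Nat.le_mul_of_pos_left ε hδ).trans hδε
    refine ⟨?_, ?_⟩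
    · refine optimalUntangling_untangles hT hJ hmon hP₂ (hlog ?_ (by omega))
      have h1 := hM.mono (Nat.mul_pos hε hN) (Nat.mul_le_mul hεμ hNn)
      omega
    -- From `δ * ε ≤ n`, the square of the smaller factor is at most `n`; the program whose cost
    -- involves that factor is used.
    · rcases le_total δ ε with hle | hle
      · refine optimalUntangling_untangles hT hJ hmon hP₁ (hlog ?_ (by omega))
        have h1 := hM.mono (Nat.mul_pos hδ hN)
          (mul_le_floor_rpow ((Nat.mul_le_mul_left δ hle).trans hδε) hNn)
        omega
      · refine optimalUntangling_untangles hT hJ hmon hP₂ (hlog ?_ (by omega))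
        have h1 := hM.mono (Nat.mul_pos hε hN)
          (mul_le_floor_rpow ((Nat.mul_le_mul_right ε hle).trans hδε) hNn)
        omega
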